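/- Let $A$ be the supersingular elliptic curve $y^2+y=x^3+x^2+x+1$ over $\mathbb F_2$, and let $p$ be an odd prime. For a field $k$ write $\bar k$ for an algebraic closure and $\Gamma_k$ for the group of $k$-automorphisms of $\bar k$; $E_n$ denotes the $n$-torsion of $E(\bar k)$, as a $\Gamma_k$-module. (1) Let $F/\mathbb F_2$ be a finite extension of even degree. (1a) The $p$-primary subgroup of $A(F)$ is isomorphic to $\mathbb Z/p^k\times\mathbb Z/p^k$ for some $k\ge 0$. Suppose from now on in (1) that the $p$-primary subgroup of $A(F)$ is isomorphic to $\mathbb Z/p^k\times\mathbb Z/p^k$ with $k\ge 1$. (1b) If $L/F$ is an extension of degree $p$, then the $p$-primary subgroup of $A(L)$ is isomorphic to $\mathbb Z/p^{k+1}\times\mathbb Z/p^{k+1}$. (1c) Let $m\ge 0$ and let $F_m$ be the fixed field of the kernel of $\Gamma_F\to\mathrm{Aut}(A_{p^{k+m}})$. Then $[F_m:F]=p^m$ and $\mathrm{Gal}(F_m/F)\cong\mathbb Z/p^m$. The image of the Kummer map $\partial:A(F)/p^m\to H^1(F,A_{p^m})$ lies in the image of the inflation map $\mathrm{inf}:H^1(\mathrm{Gal}(F_m/F),A_{p^m})\to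 H^1(F,A_{p^m})$. If $B_m=\mathrm{inf}^{-1}(\mathrm{Im}\,\partial)$, then $\phi_*(B_m)\subset B_m$ for every $\phi\in\mathrm{End}_{\Gamma_F}(A_{p^m})$, where $\phi_*$ is the induced endomorphism of $H^1(\mathrm{Gal}(F_m/F),A_{p^m})$. (2) Let $K/\mathbb Q_2$ be a finite extension with even residue degree and residue field $F$. Let $E/K$ be an elliptic curve with good reduction whose reduction is isomorphic over $F$ to $A\otimes_{\mathbb F_2}F$. Suppose that the $p$-primary subgroup of $A(F)$ is isomorphic to $\mathbb Z/p^k\times\mathbb Z/p^k$ with $k\ge 1$. Let $m\ge 0$ and let $K_m$ be the fixed field of the kernel of $\Gamma_K\to\mathrm{Aut}(E_{p^{k+m}})$. Then: (i) $\mathrm{Gal}(K_m/K)\cong\mathbb Z/p^m$. (ii) The image of the Kummer map $\partial:E(K)/p^m\to H^1(K,E_{p^m})$ lies in the image of the inflation map $\mathrm{inf}:H^1(\mathrm{Gal}(K_m/K),E_{p^m})\to H^1(K,E_{p^m})$. If $B_m=\mathrm{inf}^{-1}(\mathrm{Im}\,\partial)$, then $\phi_*(B_m)\subset B_m$ for every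 $\phi\in\mathrm{End}_{\Gamma_K}(E_{p^m})$, where $\phi_*$ is the induced endomorphism of $H^1(\mathrm{Gal}(K_m/K),E_{p^m})$. -/

import Mathlib

/-- The group law on a Weierstrass curve over a field `F` uses decidability of equality in `F`;
it is taken classically throughout. -/
@[reducible] noncomputable def fieldDecEq (F : Type*) [Field F] : DecidableEq F :=
  Classical.decEq F

attribute [local instance] fieldDecEq

/-! ### First cohomology of a topological group with coefficients in a discrete module -/

namespace GalCoh

section

variable (G : Type*) [Group G] [TopologicalSpace G]
variable (M : Type*) [AddCommGroup M] [DistribMulAction G M]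

/-- Continuous 1-cocycles `G → M`, where `M` carries the discrete topology: locally constant maps
`f` with `f (gh) = f g + g • f h`. -/
def Z1 : AddSubgroup (G → M) where
  carrier := {f | IsLocallyConstant f ∧ ∀ g h : G, f (g * h) = f g + g • f h}
  zero_mem' := ⟨IsLocallyConstant.const 0, fun g h => by simp⟩
  add_mem' := by
    rintro a b ⟨ha, ha'⟩ ⟨hb, hb'⟩
    refine ⟨ha.add hb, fun g h => ?_⟩
    simp only [Pi.add_apply, ha', hb', smul_add]
    abel
  neg_mem' := by
    rintro a ⟨ha, ha'⟩
    refine ⟨ha.neg, fun g h => ?_⟩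
    simp only [Pi.neg_apply, ha', smul_neg]
    abel

/-- Continuous 1-coboundaries: the cocycles of the form `g ↦ g • a - a` with `a : M`. -/
def B1 : AddSubgroup (Z1 G M) where
  carrier := {f | ∃ a : M, ∀ g : G, f.1 g = g • a - a}
  zero_mem' := ⟨0, fun g => by simp⟩
  add_mem' := by
    rintro f f' ⟨a, ha⟩ ⟨b, hb⟩
    refine ⟨a + b, fun g => ?_⟩
    simp only [AddSubgroup.coe_add, Pi.add_apply, ha, hb, smul_add]
    abel
  neg_mem' := by
    rintro f ⟨a, ha⟩
    refine ⟨-a, fun g => ?_⟩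
    simp only [AddSubgroup.coe_neg, Pi.neg_apply, ha, smul_neg]
    abel

/-- The first (continuous) cohomology group `H¹(G, M)` of the discrete `G`-module `M`. -/
abbrev H1 : Type _ := Z1 G M ⧸ B1 G M

end

section Functoriality

variable {G G' : Type*} [Group G] [TopologicalSpace G] [Group G'] [TopologicalSpace G']
variable {M M' : Type*} [AddCommGroup M] [DistribMulAction G M]
  [AddCommGroup M'] [DistribMulAction G' M']

/-- Pull-back of cocycles along a compatible pair `ρ : G → G'`, `f : M' → M`. -/
def mapZ1 (ρ : G →* G') (hρ : Continuous ρ) (f : M' →+ M)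
    (hf : ∀ (g : G) (x : M'), f (ρ g • x) = g • f x) : Z1 G' M' →+ Z1 G M where
  toFun c := ⟨fun g => f (c.1 (ρ g)),
    (c.2.1.comp_continuous hρ).comp f, fun g h => by
      simp only [map_mul, c.2.2, map_add, hf]⟩
  map_zero' := by ext g; simp
  map_add' a b := by ext g; simp

/-- The map `H¹(G', M') → H¹(G, M)`, `[c] ↦ [f ∘ c ∘ ρ]`, of a compatible pair. -/
def mapH1 (ρ : G →* G') (hρ : Continuous ρ) (f : M' →+ M)
    (hf : ∀ (g : G) (x : M'), f (ρ g • x) = g • f x) : H1 G' M' →+ H1 G M :=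
  QuotientAddGroup.map (B1 G' M') (B1 G M) (mapZ1 ρ hρ f hf) (by
    rintro c ⟨a, ha⟩
    refine ⟨f a, fun g => ?_⟩
    change f (c.1 (ρ g)) = _
    rw [ha, map_sub, hf])

/-- The endomorphism of `H¹(G, M)` induced by an endomorphism of the `G`-module `M`. -/
def endH1 (φ : M →+[G] M) : H1 G M →+ H1 G M :=
  mapH1 (MonoidHom.id G) continuous_id (φ : M →+ M) (fun g x => map_smul φ g x)

end Functoriality

end GalCoh

/-! ### Points of elliptic curves, Galois action, torsion -/

namespace WeierstrassCurve

section Points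

variable {k : Type*} [Field k] (W : WeierstrassCurve k)

/-- The group `W(L)` for a field extension `L` of `k`. -/
def Pts (L : Type*) [Field L] [Algebra k L] : Type _ := (W.baseChange L).toAffine.Point

noncomputable instance (L : Type*) [Field L] [Algebra k L] : AddCommGroup (W.Pts L) :=
  inferInstanceAs (AddCommGroup (W.baseChange L).toAffine.Point)

/-- The map `W(L) → W(L')` induced by a `k`-embedding `L → L'`. -/
noncomputable def ptsMap {L L' : Type*} [Field L] [Field L'] [Algebra k L] [Algebra k L']
    (f : L →ₐ[k] L') : W.Pts L →+ W.Pts L' :=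
  Affine.Point.map (W' := W.toAffine) f

theorem ptsMap_ptsMap {L L' L'' : Type*} [Field L] [Field L'] [Field L''] [Algebra k L]
    [Algebra k L'] [Algebra k L''] (f : L →ₐ[k] L') (g : L' →ₐ[k] L'') (P : W.Pts L) :
    W.ptsMap g (W.ptsMap f P) = W.ptsMap (g.comp f) P :=
  Affine.Point.map_map (W' := W.toAffine) f g P

theorem ptsMap_injective {L L' : Type*} [Field L] [Field L'] [Algebra k L] [Algebra k L']
    (f : L →ₐ[k] L') : Function.Injective (W.ptsMap f) :=
  Affine.Point.map_injective (W' := W.toAffine) f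

/-- The inclusion `W(k) → W(L)`. -/
noncomputable def ptsIncl (L : Type*) [Field L] [Algebra k L] :
    W.toAffine.Point →+ W.Pts L :=
  Affine.Point.map (W' := W.toAffine) (Algebra.ofId k L)

/-- The Galois action on `W(L)`: automorphisms act on coordinates. -/
noncomputable instance galAction (L : Type*) [Field L] [Algebra k L] :
    DistribMulAction Gal(L/k) (W.Pts L) where
  smul σ P := W.ptsMap (σ : L →ₐ[k] L) P
  one_smul P := by cases P <;> rfl
  mul_smul σ τ P := by cases P <;> rfl
  smul_zero σ := rfl
  smul_add σ P Q := map_add (W.ptsMap (σ : L →ₐ[k] L)) P Q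

/-- `W(L)[n]`, the `n`-torsion of `W(L)`. -/
noncomputable abbrev Tors (L : Type*) [Field L] [Algebra k L] (n : ℕ) : AddSubgroup (W.Pts L) :=
  AddSubgroup.torsionBy (W.Pts L) (n : ℤ)

theorem mem_tors {L : Type*} [Field L] [Algebra k L] {n : ℕ} (P : W.Pts L) :
    P ∈ W.Tors L n ↔ n • P = 0 := by
  change (n : ℤ) • P = 0 ↔ _
  rw [natCast_zsmul]

noncomputable instance galActionTors (L : Type*) [Field L] [Algebra k L] (n : ℕ) :
    DistribMulAction Gal(L/k) (W.Tors L n) where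
  smul σ P := ⟨σ • P.1, by
    have h := (W.mem_tors P.1).1 P.2
    rw [mem_tors, ← smul_comm, h, smul_zero]⟩
  one_smul P := Subtype.ext (one_smul _ P.1)
  mul_smul σ τ P := Subtype.ext (mul_smul σ τ P.1)
  smul_zero σ := Subtype.ext (smul_zero σ)
  smul_add σ P Q := Subtype.ext (smul_add σ P.1 Q.1)

/-- The field cut out by the `N`-torsion: the fixed field, inside an algebraic closure of `k`,
of the kernel of the representation `Gal(k̄/k) → Aut(W(k̄)[N])`. -/
noncomputable def torsionField (N : ℕ) : IntermediateField k (AlgebraicClosure k) :=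
  IntermediateField.fixedField
    (DistribMulAction.toAddAut Gal(AlgebraicClosure k/k) (W.Tors (AlgebraicClosure k) N)).ker

instance torsionField_normal (N : ℕ) : Normal k (W.torsionField N) := by
  rw [IntermediateField.normal_iff_forall_map_le']
  rintro σ _ ⟨x, hx, rfl⟩
  rintro ⟨τ, hτ⟩
  have h := hx ⟨σ⁻¹ * τ * σ, by
    simpa using (inferInstance : (DistribMulAction.toAddAut Gal(AlgebraicClosure k/k)
      (W.Tors (AlgebraicClosure k) N)).ker.Normal).conj_mem τ hτ σ⁻¹⟩
  have h2 := congrArg σ h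
  change σ (σ⁻¹ (τ (σ x))) = σ x at h2
  change τ (σ x) = σ x
  have h3 : ∀ z, σ (σ⁻¹ z) = z := σ.apply_symm_apply
  rwa [h3] at h2

/-- Restriction of automorphisms `Gal(k̄/k) → Gal(L/k)`, with `L` the field cut out by the
`N`-torsion. -/
noncomputable def galRes (N : ℕ) : Gal(AlgebraicClosure k/k) →* Gal(W.torsionField N/k) :=
  AlgEquiv.restrictNormalHom (W.torsionField N)

theorem galRes_continuous (N : ℕ) : Continuous (W.galRes N) :=
  InfiniteGalois.restrictNormalHom_continuous (W.torsionField N)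

/-- The inclusion `W(L)[n] → W(k̄)[n]`, with `L` the field cut out by the `N`-torsion. -/
noncomputable def torsIncl (N n : ℕ) :
    W.Tors (W.torsionField N) n →+ W.Tors (AlgebraicClosure k) n where
  toFun P := ⟨W.ptsMap (W.torsionField N).val P.1, by
    have h := (W.mem_tors P.1).1 P.2
    rw [mem_tors, ← map_nsmul, h, map_zero]⟩
  map_zero' := Subtype.ext (map_zero _)
  map_add' P Q := Subtype.ext (map_add _ P.1 Q.1)

theorem torsIncl_galRes (N n : ℕ) (σ : Gal(AlgebraicClosure k/k))
    (P : W.Tors (W.torsionField N) n) :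
    W.torsIncl N n (W.galRes N σ • P) = σ • W.torsIncl N n P := by
  obtain ⟨P, hP⟩ := P
  apply Subtype.ext
  change W.ptsMap (W.torsionField N).val (W.ptsMap _ P) =
    W.ptsMap _ (W.ptsMap (W.torsionField N).val P)
  have hc : ∀ x : W.torsionField N, ((W.galRes N σ x : W.torsionField N) : AlgebraicClosure k)
      = σ (x : AlgebraicClosure k) := fun x => AlgEquiv.restrictNormal_commutes σ _ x
  have hh : (W.torsionField N).val.comp
      ((W.galRes N σ : Gal(W.torsionField N/k)) : W.torsionField N →ₐ[k] W.torsionField N) =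
      (σ : AlgebraicClosure k →ₐ[k] AlgebraicClosure k).comp (W.torsionField N).val :=
    AlgHom.ext hc
  rw [ptsMap_ptsMap, ptsMap_ptsMap, hh]

/-- For `n ∣ N` the `n`-torsion over `k̄` is already defined over the field cut out by the
`N`-torsion. -/
theorem torsIncl_bijective {N n : ℕ} (h : n ∣ N) : Function.Bijective (W.torsIncl N n) := by
  constructor
  · intro P Q hPQ
    exact Subtype.ext (W.ptsMap_injective (W.torsionField N).val
      (congrArg Subtype.val hPQ))
  · rintro ⟨P, hP⟩
    have hN : P ∈ W.Tors (AlgebraicClosure k) N := by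
      obtain ⟨d, rfl⟩ := h
      rw [mem_tors] at hP ⊢
      rw [mul_comm, mul_nsmul', hP]
      simp
    have hfix : ∀ τ ∈ (DistribMulAction.toAddAut Gal(AlgebraicClosure k/k)
        (W.Tors (AlgebraicClosure k) N)).ker, W.ptsMap (τ : _ →ₐ[k] _) P = P := fun τ hτ =>
      congrArg (fun e : Multiplicative (AddAut (W.Tors (AlgebraicClosure k) N)) =>
        (e.toAdd ⟨P, hN⟩).1) (MonoidHom.mem_ker.1 hτ)
    suffices ∃ Q, W.ptsMap (W.torsionField N).val Q = P by
      obtain ⟨Q, rfl⟩ := this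
      refine ⟨⟨Q, ?_⟩, rfl⟩
      rw [mem_tors, ← map_nsmul] at hP
      rw [mem_tors]
      exact W.ptsMap_injective (W.torsionField N).val
        (hP.trans (map_zero _).symm)
    cases P with
    | zero => exact ⟨0, rfl⟩
    | some x y hxy =>
      have hx : x ∈ W.torsionField N := fun τ =>
        (Affine.Point.some.inj (hfix τ.1 τ.2)).1
      have hy : y ∈ W.torsionField N := fun τ =>
        (Affine.Point.some.inj (hfix τ.1 τ.2)).2
      exact ⟨.some ⟨x, hx⟩ ⟨y, hy⟩ ((W.toAffine.baseChange_nonsingular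
        (W.torsionField N).val.injective _ _).1 hxy), rfl⟩

/-- The identification `W(L)[n] = W(k̄)[n]` for `n ∣ N`, with `L` the field cut out by the
`N`-torsion. -/
noncomputable def torsEquiv {N n : ℕ} (h : n ∣ N) :
    W.Tors (W.torsionField N) n ≃+ W.Tors (AlgebraicClosure k) n :=
  AddEquiv.ofBijective (W.torsIncl N n) (W.torsIncl_bijective h)

theorem galRes_surjective (N : ℕ) : Function.Surjective (W.galRes N) :=
  AlgEquiv.restrictNormalHom_surjective (AlgebraicClosure k)

/-- A `Gal(k̄/k)`-equivariant endomorphism of `W[n]`, seen as a `Gal(L/k)`-equivariant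
endomorphism. -/
noncomputable def torsEnd {N n : ℕ} (h : n ∣ N)
    (φ : W.Tors (AlgebraicClosure k) n →+[Gal(AlgebraicClosure k/k)]
      W.Tors (AlgebraicClosure k) n) :
    W.Tors (W.torsionField N) n →+[Gal(W.torsionField N/k)] W.Tors (W.torsionField N) n where
  toFun P := (W.torsEquiv h).symm (φ (W.torsEquiv h P))
  map_smul' σ P := by
    obtain ⟨σ, rfl⟩ := W.galRes_surjective N σ
    apply (W.torsEquiv h).injective
    have h1 : ∀ P, W.torsEquiv h (W.galRes N σ • P) = σ • W.torsEquiv h P :=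
      W.torsIncl_galRes N n σ
    simp only [MonoidHom.id_apply, AddEquiv.apply_symm_apply, h1, map_smul]
  map_zero' := by simp
  map_add' P Q := by simp

/-! ### Inflation and the Kummer map -/

/-- `H¹(k, W[n])`. -/
abbrev H1Abs (n : ℕ) : Type _ :=
  GalCoh.H1 Gal(AlgebraicClosure k/k) (W.Tors (AlgebraicClosure k) n)

/-- `H¹(Gal(L/k), W(L)[n])`, with `L` the field cut out by the `N`-torsion
(for `n ∣ N`, `W(L)[n] = W[n]`). -/
abbrev H1Fin (N n : ℕ) : Type _ :=
  GalCoh.H1 Gal(W.torsionField N/k) (W.Tors (W.torsionField N) n)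

/-- The inflation map `H¹(Gal(L/k), W[n]) → H¹(k, W[n])`. -/
noncomputable def inflation (N n : ℕ) : W.H1Fin N n →+ W.H1Abs n :=
  GalCoh.mapH1 (W.galRes N) (W.galRes_continuous N) (W.torsIncl N n) (W.torsIncl_galRes N n)

/-- The endomorphism `φ_*` of `H¹(Gal(L/k), W[n])` induced by `φ ∈ End_{Gal(k̄/k)}(W[n])`. -/
noncomputable def pushforward {N n : ℕ} (h : n ∣ N)
    (φ : W.Tors (AlgebraicClosure k) n →+[Gal(AlgebraicClosure k/k)]
      W.Tors (AlgebraicClosure k) n) : W.H1Fin N n →+ W.H1Fin N n :=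
  GalCoh.endH1 (W.torsEnd h φ)

/-- `W(k)/n`. -/
abbrev PtsMod (n : ℕ) : Type _ :=
  W.toAffine.Point ⧸ (nsmulAddMonoidHom n : W.toAffine.Point →+ W.toAffine.Point).range

/-- `δ : W(k)/n → H¹(k, W[n])` is the Kummer (connecting) map: every `P ∈ W(k)` is of the form
`n Q` with `Q ∈ W(k̄)`, and for each such `Q` the class `δ(P)` is that of `σ ↦ σ Q - Q`.
This determines `δ`. -/
def IsKummerMap (n : ℕ) (δ : W.PtsMod n →+ W.H1Abs n) : Prop :=
  ∀ P : W.toAffine.Point,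
    (∃ Q : W.Pts (AlgebraicClosure k), n • Q = W.ptsIncl (AlgebraicClosure k) P) ∧
    ∀ Q : W.Pts (AlgebraicClosure k), n • Q = W.ptsIncl (AlgebraicClosure k) P →
      ∃ c : GalCoh.Z1 Gal(AlgebraicClosure k/k) (W.Tors (AlgebraicClosure k) n),
        (∀ σ : Gal(AlgebraicClosure k/k), (c.1 σ : W.Pts (AlgebraicClosure k)) = σ • Q - Q) ∧
        δ (QuotientAddGroup.mk P) = QuotientAddGroup.mk c

theorem IsKummerMap.unique {n : ℕ} {δ δ' : W.PtsMod n →+ W.H1Abs n}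
    (h : W.IsKummerMap n δ) (h' : W.IsKummerMap n δ') : δ = δ' := by
  ext P
  obtain ⟨Q, hQ⟩ := (h P).1
  obtain ⟨c, hc, e⟩ := (h P).2 Q hQ
  obtain ⟨c', hc', e'⟩ := (h' P).2 Q hQ
  have : c = c' := by
    ext σ
    rw [hc, hc']
  subst this
  exact e.trans e'.symm

/-- For `n ∣ N` and `L` the field cut out by the `N`-torsion: the image of the Kummer map
`δ : W(k)/n → H¹(k, W[n])` lies in the image of inflation from `H¹(Gal(L/k), W[n])`, and its
preimage `B` under inflation satisfies `φ_*(B) ⊆ B` for all `φ ∈ End_{Gal(k̄/k)}(W[n])`. -/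
def KummerStable {N n : ℕ} (h : n ∣ N) : Prop :=
  ∃ δ : W.PtsMod n →+ W.H1Abs n, W.IsKummerMap n δ ∧
    δ.range ≤ (W.inflation N n).range ∧
    ∀ φ : W.Tors (AlgebraicClosure k) n →+[Gal(AlgebraicClosure k/k)]
      W.Tors (AlgebraicClosure k) n,
      (δ.range.comap (W.inflation N n)).map (W.pushforward h φ) ≤
        δ.range.comap (W.inflation N n)

end Points

/-- The Weierstrass curve `y² + y = x³ + x² + x + 1` over a commutative ring `R`. For `R` of
characteristic two this is the base change to `R` of the supersingular curve `A` over `𝔽₂`. -/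
def curveA (R : Type*) [CommRing R] : WeierstrassCurve R := ⟨0, 1, 1, 1, 1⟩

theorem curveA_map {R S : Type*} [CommRing R] [CommRing S] (f : R →+* S) :
    (curveA R).map f = curveA S := by
  simp [curveA, WeierstrassCurve.map]

end WeierstrassCurve

/-! ### Rings of integers of finite extensions of `ℚ_q` -/

namespace LocalInt

section

variable (q : ℕ) [Fact q.Prime] (K : Type*) [Field K] [Algebra ℚ_[q] K]
  [FiniteDimensional ℚ_[q] K] [Algebra ℤ_[q] K] [IsScalarTower ℤ_[q] ℚ_[q] K]

/-- The ring of integers of a finite extension `K` of `ℚ_q`. -/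
abbrev 𝒪 : Type _ := integralClosure ℤ_[q] K

theorem isIntegral_iff (x : K) : IsIntegral ℤ_[q] x ↔ spectralNorm ℚ_[q] K x ≤ 1 := by
  have hx : IsIntegral ℚ_[q] x := Algebra.IsIntegral.isIntegral x
  rw [spectralNorm, spectralValue_le_one_iff (minpoly.monic hx)]
  constructor
  · intro h n
    rw [minpoly.isIntegrallyClosed_eq_field_fractions' ℚ_[q] h, Polynomial.coeff_map]
    exact PadicInt.norm_le_one _
  · intro h
    have hl : minpoly ℚ_[q] x ∈ Polynomial.lifts (algebraMap ℤ_[q] ℚ_[q]) := by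
      rw [Polynomial.lifts_iff_coeff_lifts]
      exact fun n => ⟨⟨_, h n⟩, rfl⟩
    obtain ⟨P, hP, -, hm⟩ := Polynomial.lifts_and_natDegree_eq_and_monic hl (minpoly.monic hx)
    refine ⟨P, hm, ?_⟩
    have := minpoly.aeval ℚ_[q] x
    rw [← hP, Polynomial.aeval_map_algebraMap] at this
    exact this

instance : IsFractionRing (𝒪 q K) K :=
  IsIntegralClosure.isFractionRing_of_finite_extension ℤ_[q] ℚ_[q] K (𝒪 q K)

instance : IsDedekindDomain (𝒪 q K) := integralClosure.isDedekindDomain ℤ_[q] ℚ_[q] K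

instance : ValuationRing (𝒪 q K) := by
  rw [ValuationRing.iff_isInteger_or_isInteger (𝒪 q K) K]
  intro x
  have key : ∀ y : K, spectralNorm ℚ_[q] K y ≤ 1 → IsLocalization.IsInteger (𝒪 q K) y :=
    fun y hy => ⟨⟨y, (isIntegral_iff q K y).2 hy⟩, rfl⟩
  rcases le_total (spectralNorm ℚ_[q] K x) 1 with h | h
  · exact Or.inl (key x h)
  · refine Or.inr (key _ ?_)
    have := map_inv₀ (spectralMulAlgNorm ℚ_[q] K) x
    rw [spectralMulAlgNorm_def, spectralMulAlgNorm_def] at this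
    rw [this]
    exact inv_le_one_of_one_le₀ h

theorem not_isField : ¬ IsField (𝒪 q K) := by
  intro h
  have hi : Function.Injective (algebraMap ℤ_[q] (𝒪 q K)) := by
    have h1 : Function.Injective (algebraMap ℤ_[q] K) := by
      rw [IsScalarTower.algebraMap_eq ℤ_[q] ℚ_[q] K]
      exact (algebraMap ℚ_[q] K).injective.comp (IsFractionRing.injective ℤ_[q] ℚ_[q])
    rw [IsScalarTower.algebraMap_eq ℤ_[q] (𝒪 q K) K, RingHom.coe_comp] at h1
    exact Function.Injective.of_comp h1
  exact (IsDiscreteValuationRing.not_isField ℤ_[q]) (isField_of_isIntegral_of_isField hi h)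

instance : IsDiscreteValuationRing (𝒪 q K) := by
  exact ((IsDiscreteValuationRing.TFAE (𝒪 q K) (not_isField q K)).out 0 1).2
    (inferInstance : ValuationRing (𝒪 q K))

/-- The residue field of `K`. -/
abbrev κ : Type _ := IsLocalRing.ResidueField (𝒪 q K)

/-- The residue degree of `K` over `ℚ_q`. -/
noncomputable def residueDegree : ℕ :=
  (IsLocalRing.maximalIdeal (𝒪 q K)).inertiaDeg ℤ_[q]

variable {K}

/-- `E/K` has good reduction, and its reduction is isomorphic to the curve `B` over the residue
field: some minimal Weierstrass equation of `E` has good reduction, and its reduction becomes `B`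
after an admissible change of variables. -/
def HasReduction (E : WeierstrassCurve K) (B : WeierstrassCurve (κ q K)) : Prop :=
  ∃ (C : WeierstrassCurve.VariableChange K) (_ : (C • E).HasGoodReduction (𝒪 q K))
    (D : WeierstrassCurve.VariableChange (κ q K)), D • (C • E).reduction (𝒪 q K) = B

end

end LocalInt

/-! On `A` the Frobenius of `𝔽₄` is an integer: the tangent at `(x, y)` has slope `x² + 1`, and
doubling yields `-(x⁴, y⁴)`, so `(x, y) ↦ (x⁴, y⁴)` is multiplication by `-2`. Over a field `F` with
`4ʳ` elements Frobenius is therefore the scalar `s = (-2)ʳ`, and `A(F)` is the kernel of `s - 1`.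
Write `s = 1 + pᵏu` with `p ∤ u`. The `p`-primary part of `A(F)` is then `A[pᵏ]`, and an extension
of degree `p` replaces `s` by `sᵖ`, which raises the valuation of `s - 1` by exactly one because `p`
is odd.

That `A[pⁿ] ≅ (ℤ/pⁿ)²` is obtained by counting. The sum of `χ(x³)`, for the sign character `χ` of
`F` trivial on `y² + y`, gives `#A(F) = (s - 1)²`, so `A[|s - 1|]` has the expected order for every
`r > 0`. The exponents `r = (p - 1)pᵐ` reach all large powers of `p`, and group theory supplies the
remaining ones (`card_nTorsion_pow`, `nonempty_nTorsion_addEquiv`).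

Galois acts on `p`-power torsion through powers of `s`, hence inside `1 + pᵏℤ_p`. Its image on
`A[p^(k+m)]` is cyclic of order `pᵐ`, generated by some `σ₀` acting as `s' = 1 + pᵏu'` with `p ∤
u'`. Modulo `pᵐA(F)` every rational point is `pᵏ`-torsion, its `pᵐ`-th parts are `p^(k+m)`-torsion,
and so Kummer classes are inflated. Conversely a cocycle of a cyclic group is determined by its
value at the generator. That value has the form `(s' - 1)Q` with `Q` in `A[p^(k+m)]`; then `pᵐQ` is
killed by `pᵏ`, hence rational, and its Kummer class is the given one. Thus `B_m` is the whole of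
`H¹(Gal(F_m/F), A[pᵐ])`, and stability under `φ_*` is automatic. The argument uses only
divisibility, the scalar action and the shape of the rational points, so it is stated abstractly in
`kummerStable_of_scalar_action`.

For `E/K` the reduction map on points over the closure is a surjective equivariant homomorphism. Its
kernel is uniquely divisible by odd integers: the parameter `z = x / y` turns differences of points
into differences of parameters as far as norms are concerned (`norm_paramZ_sub`), even multiples
contract, and an odd `n = 1 - 2(-m)` is inverted by a geometric series
(`exists_mem_formalSubgroup_zsmul_eq`). Hence `E` and `A` have the same `p`-power torsion with the
same scalar action, the decomposition of rational points modulo `pᵐ` lifts, and the abstract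
argument applies again. -/

/-! ### Torsion in abelian groups, from orders alone -/

section TorsionCounting

/-- The subgroup of elements killed by `n`. -/
def nTorsion (M : Type*) [AddCommGroup M] (n : ℕ) : AddSubgroup M :=
  (nsmulAddMonoidHom n : M →+ M).ker

variable {M : Type*} [AddCommGroup M]

theorem mem_nTorsion {n : ℕ} {x : M} : x ∈ nTorsion M n ↔ n • x = 0 := Iff.rfl

theorem nTorsion_mono {a b : ℕ} (h : a ∣ b) : nTorsion M a ≤ nTorsion M b := by
  rintro x hx
  obtain ⟨c, rfl⟩ := h
  rw [mem_nTorsion] at hx ⊢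
  rw [mul_comm, mul_nsmul', hx, smul_zero]

theorem AddMonoidHom.card_ker_mul_card_range {A B : Type*} [AddCommGroup A] [AddCommGroup B]
    (f : A →+ B) : Nat.card f.ker * Nat.card f.range = Nat.card A := by
  rw [AddSubgroup.card_eq_card_quotient_mul_card_addSubgroup f.ker,
    Nat.card_congr (QuotientAddGroup.quotientKerEquivRange f).toEquiv, mul_comm]

theorem card_nTorsion_mul (a b : ℕ) :
    Nat.card (nTorsion M a) * Nat.card ((nTorsion M (a * b)).map (nsmulAddMonoidHom a : M →+ M)) =
      Nat.card (nTorsion M (a * b)) := by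
  let f : nTorsion M (a * b) →+ M := (nsmulAddMonoidHom a : M →+ M).comp (nTorsion M (a * b)).subtype
  have hf : f.range = (nTorsion M (a * b)).map (nsmulAddMonoidHom a : M →+ M) := by
    rw [AddMonoidHom.range_comp, AddSubgroup.range_subtype]
  rw [← f.card_ker_mul_card_range, hf]
  congr 1
  refine Nat.card_congr ⟨fun x => ⟨⟨x.1, nTorsion_mono (Dvd.intro _ rfl) x.2⟩, x.2⟩,
    fun x => ⟨x.1.1, x.2⟩, fun _ => rfl, fun _ => rfl⟩

/-- By Cauchy, a common prime factor would be the order of an element, hence a divisor of `n` as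
well. -/
theorem coprime_card_of_nsmul_eq_zero {A : Type*} [AddCommGroup A] [Finite A] {n m : ℕ}
    (hA : ∀ x : A, n • x = 0) (h : Nat.Coprime n m) : Nat.Coprime (Nat.card A) m := by
  refine Nat.coprime_of_dvd fun q hq hqA hqm => ?_
  have := Fact.mk hq
  obtain ⟨x, hx⟩ := exists_prime_addOrderOf_dvd_card' q hqA
  have := addOrderOf_dvd_of_nsmul_eq_zero (hA x)
  rw [hx] at this
  exact hq.one_lt.ne' (Nat.eq_one_of_dvd_coprimes h this hqm)

/-- Orders of the primary parts of `M[n]` when `M[n]` has order `n ^ 2`. -/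
theorem card_nTorsion_of_coprime_mul {a b : ℕ} (ha : a ≠ 0) (hb : b ≠ 0) (hab : Nat.Coprime a b)
    (h : Nat.card (nTorsion M (a * b)) = (a * b) ^ 2) : Nat.card (nTorsion M a) = a ^ 2 := by
  have h1 := card_nTorsion_mul (M := M) a b
  -- `#M[a]` is prime to `b`, and `#D` is prime to `a` since `b` kills `D`. So they divide `a²` and
  -- `b²`, and their product `(ab)²` leaves no room.
  set D := (nTorsion M (a * b)).map (nsmulAddMonoidHom a : M →+ M)
  rw [h] at h1
  have hne : Nat.card (nTorsion M a) * Nat.card D ≠ 0 := by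
    rw [h1]; positivity
  have : Finite (nTorsion M a) := Nat.finite_of_card_ne_zero (left_ne_zero_of_mul hne)
  have : Finite D := Nat.finite_of_card_ne_zero (right_ne_zero_of_mul hne)
  have hc : Nat.Coprime (Nat.card (nTorsion M a)) b :=
    coprime_card_of_nsmul_eq_zero (fun x => Subtype.ext x.2) hab
  have hd : Nat.Coprime (Nat.card D) a := by
    refine coprime_card_of_nsmul_eq_zero (n := b) ?_ hab.symm
    rintro ⟨_, x, hx, rfl⟩
    refine Subtype.ext ?_
    change b • a • x = 0
    rw [← mul_nsmul]
    exact hx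
  have e1 : Nat.card (nTorsion M a) ∣ a ^ 2 := by
    refine (Nat.Coprime.pow_right 2 hc).dvd_of_dvd_mul_right (k := _) (n := b ^ 2) ?_
    rw [← mul_pow, ← h1]; exact Dvd.intro _ rfl
  have e2 : Nat.card D ∣ b ^ 2 := by
    refine (Nat.Coprime.pow_right 2 hd).dvd_of_dvd_mul_left (m := a ^ 2) ?_
    rw [← mul_pow, ← h1]; exact Dvd.intro_left _ rfl
  have l1 := Nat.le_of_dvd (by positivity) e1
  have l2 := Nat.le_of_dvd (by positivity) e2
  rw [mul_pow] at h1
  have hb2 : 0 < b ^ 2 := by positivity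
  nlinarith [Nat.zero_le (Nat.card (nTorsion M a))]

variable {p : ℕ} [hp : Fact p.Prime]

section

variable {v : ℕ} (h : ∀ n, v ≤ n → Nat.card (nTorsion M (p ^ n)) = p ^ (2 * n))
include h

theorem finite_nTorsion_pow (n : ℕ) : Finite (nTorsion M (p ^ n)) := by
  have hp0 := hp.out.pos
  have : Finite (nTorsion M (p ^ (n + v))) := by
    refine Nat.finite_of_card_ne_zero ?_
    rw [h _ (Nat.le_add_left _ _)]
    positivity
  have hle : nTorsion M (p ^ n) ≤ nTorsion M (p ^ (n + v)) :=
    nTorsion_mono (pow_dvd_pow p (Nat.le_add_right _ _))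
  exact Finite.of_injective _ (AddSubgroup.inclusion_injective hle)

/-- The ratio `#M[p^(i+1)] / #M[pⁱ]` is the order of `pⁱM[p^(i+1)]`. These subgroups decrease with
`i` and eventually have order `p²`, so every ratio is at least `p²`. Climbing from level `n` to
level `n + v` bounds `#M[pⁿ]` above; climbing from level `0` bounds it below. -/
theorem card_nTorsion_pow (n : ℕ) : Nat.card (nTorsion M (p ^ n)) = p ^ (2 * n) := by
  have hp0 := hp.out.pos
  let D : ℕ → AddSubgroup M := fun i =>
    (nTorsion M (p ^ i * p)).map (nsmulAddMonoidHom (p ^ i) : M →+ M)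
  have hD : ∀ i, Nat.card (nTorsion M (p ^ i)) * Nat.card (D i) =
      Nat.card (nTorsion M (p ^ (i + 1))) := fun i => by
    rw [pow_succ]; exact card_nTorsion_mul _ _
  have hfin : ∀ i, Finite (D i) := fun i => by
    have := finite_nTorsion_pow h (i + 1)
    rw [pow_succ] at this
    exact Finite.Set.finite_image _ _
  have hDle : ∀ i, D (i + 1) ≤ D i := by
    rintro i _ ⟨x, hx, rfl⟩
    refine ⟨p • x, ?_, ?_⟩
    · change (p ^ i * p) • p • x = 0
      rw [← mul_nsmul']
      exact hx
    · change p ^ i • p • x = p ^ (i + 1) • x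
      rw [pow_succ, mul_nsmul']
  have hDanti : Antitone D := antitone_nat_of_succ_le hDle
  have hDv : ∀ i, v ≤ i → Nat.card (D i) = p ^ 2 := fun i hi => by
    have := hD i
    rw [h i hi, h (i + 1) (by omega), show 2 * (i + 1) = 2 * i + 2 by ring, pow_add] at this
    exact Nat.eq_of_mul_eq_mul_left (by positivity) this
  have hDge : ∀ i, p ^ 2 ≤ Nat.card (D i) := fun i => by
    rw [← hDv (i + v) (by omega)]
    have := hfin i
    exact Nat.card_le_card_of_injective _
      (AddSubgroup.inclusion_injective (hDanti (Nat.le_add_right i v)))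
  have hup : ∀ j n, Nat.card (nTorsion M (p ^ n)) * p ^ (2 * j) ≤
      Nat.card (nTorsion M (p ^ (n + j))) := by
    intro j n
    induction j with
    | zero => simp
    | succ j ih =>
      rw [← add_assoc, ← hD, show 2 * (j + 1) = 2 * j + 2 by ring, pow_add, ← mul_assoc]
      exact Nat.mul_le_mul ih (hDge _)
  refine le_antisymm ?_ ?_
  · have := hup v n
    rw [h _ (Nat.le_add_left v n), mul_add, pow_add] at this
    exact Nat.le_of_mul_le_mul_right this (by positivity)
  · have := hup n 0
    simpa [nTorsion] using this

/-- `pM[p^(n+1)]` lies in `M[pⁿ]` and has the same order. -/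
theorem exists_nsmul_eq_of_mem_nTorsion_pow {n : ℕ} {P : M} (hP : P ∈ nTorsion M (p ^ n)) :
    ∃ Q ∈ nTorsion M (p ^ (n + 1)), p • Q = P := by
  have hp0 := hp.out.pos
  have hc := card_nTorsion_pow h
  have := finite_nTorsion_pow h n
  have e := card_nTorsion_mul (M := M) p (p ^ n)
  have hc1 := hc 1
  rw [pow_one] at hc1
  rw [← pow_succ', hc1, hc (n + 1), show 2 * (n + 1) = 2 * 1 + 2 * n by ring,
    pow_add p (2 * 1)] at e
  have e' := Nat.eq_of_mul_eq_mul_left (by positivity) e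
  rw [← hc n] at e'
  have hle : (nTorsion M (p ^ (n + 1))).map (nsmulAddMonoidHom p : M →+ M) ≤
      nTorsion M (p ^ n) := by
    rintro _ ⟨x, hx, rfl⟩
    change p ^ n • p • x = 0
    rw [← mul_nsmul', ← pow_succ]
    exact hx
  have := AddSubgroup.eq_of_le_of_card_ge hle e'.ge
  rw [← this] at hP
  exact hP

/-- If `M` is in addition a torsion group then it is `p`-divisible. -/
theorem nsmul_surjective_of_torsion (htor : ∀ P : M, ∃ n : ℕ, n ≠ 0 ∧ n • P = 0) (P : M) :
    ∃ Q : M, p • Q = P := by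
  obtain ⟨n, hn, hP⟩ := htor P
  obtain ⟨a, b, hb, rfl⟩ := Nat.exists_eq_pow_mul_and_not_dvd hn p hp.out.ne_one
  -- With `αp^(a+1) + βb = 1`, the point `P` is `p(αpᵃP)` plus `βbP`; the second summand is killed
  -- by `pᵃ`, where division by `p` is already known.
  have hcop : IsCoprime ((p ^ (a + 1) : ℕ) : ℤ) (b : ℤ) :=
    Nat.isCoprime_iff_coprime.2 (Nat.Coprime.pow_left _ ((hp.out.coprime_iff_not_dvd).2 hb))
  obtain ⟨α, β, e⟩ := hcop
  have h2 : β • b • P ∈ nTorsion M (p ^ a) := by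
    rw [mem_nTorsion, smul_comm, ← mul_nsmul', hP, smul_zero]
  obtain ⟨Q, -, hQ⟩ := exists_nsmul_eq_of_mem_nTorsion_pow h h2
  refine ⟨α • p ^ a • P + Q, ?_⟩
  rw [smul_add, hQ]
  have : P = (α * (p ^ (a + 1) : ℕ) + β * b) • P := by rw [e, one_smul]
  conv_rhs => rw [this]
  rw [add_smul, mul_smul, mul_smul, natCast_zsmul, natCast_zsmul, pow_succ, smul_comm, mul_nsmul']
  rw [← mul_nsmul', ← mul_nsmul', mul_comm]

/-- Two elements of `M[p]`, the second outside the span of the first, generate a subgroup whose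
order exceeds `p` and divides `p²`. -/
theorem exists_nTorsion_generators :
    ∃ T₁ T₂ : M, p • T₁ = 0 ∧ p • T₂ = 0 ∧
      ∀ X : M, p • X = 0 → ∃ a b : ℤ, X = a • T₁ + b • T₂ := by
  have hc := card_nTorsion_pow h 1
  rw [pow_one, mul_one] at hc
  have := finite_nTorsion_pow h 1
  rw [pow_one] at this
  let A := nTorsion M p
  have hA : ∀ x : A, p • x = 0 := fun x => Subtype.ext x.2
  have hp2 := hp.out.two_le
  have h1 : ∃ T₁ : A, T₁ ≠ 0 := by
    have : Nontrivial A := (Finite.one_lt_card_iff_nontrivial).1 (by rw [hc]; nlinarith)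
    exact exists_ne 0
  obtain ⟨T₁, hT₁⟩ := h1
  have ho : ∀ x : A, x ≠ 0 → addOrderOf x = p := fun x hx =>
    addOrderOf_eq_prime (hA x) hx
  have h2 : ∃ T₂ : A, T₂ ∉ AddSubgroup.zmultiples T₁ := by
    by_contra! hcon
    have : AddSubgroup.zmultiples T₁ = ⊤ := by ext x; simpa using hcon x
    have := congrArg (fun H : AddSubgroup A => Nat.card H) this
    simp only [Nat.card_zmultiples, ho _ hT₁, AddSubgroup.card_top] at this
    rw [hc] at this
    nlinarith
  obtain ⟨T₂, hT₂⟩ := h2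
  have htop : AddSubgroup.zmultiples T₁ ⊔ AddSubgroup.zmultiples T₂ = ⊤ := by
    set H := AddSubgroup.zmultiples T₁ ⊔ AddSubgroup.zmultiples T₂
    have hd : Nat.card H ∣ p ^ 2 := hc ▸ AddSubgroup.card_addSubgroup_dvd_card H
    obtain ⟨i, hi, e⟩ := (Nat.dvd_prime_pow hp.out).1 hd
    have hlt : p < Nat.card H := by
      rw [← ho _ hT₁, ← Nat.card_zmultiples]
      refine lt_of_le_of_ne (Nat.card_le_card_of_injective _
        (AddSubgroup.inclusion_injective (le_sup_left : _ ≤ H))) fun heq => hT₂ ?_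
      have := AddSubgroup.eq_of_le_of_card_ge (le_sup_left : AddSubgroup.zmultiples T₁ ≤ H) heq.ge
      rw [this]
      exact (le_sup_right : _ ≤ H) (AddSubgroup.mem_zmultiples T₂)
    have hi2 : i = 2 := by
      by_contra hne
      have : i ≤ 1 := by omega
      have := Nat.pow_le_pow_right hp.out.pos this
      rw [← e, pow_one] at this
      omega
    refine AddSubgroup.eq_top_of_card_eq _ ?_
    rw [e, hi2, ← hc]
  refine ⟨T₁.1, T₂.1, T₁.2, T₂.2, fun X hX => ?_⟩
  have : (⟨X, hX⟩ : A) ∈ AddSubgroup.zmultiples T₁ ⊔ AddSubgroup.zmultiples T₂ := by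
    rw [htop]; trivial
  obtain ⟨_, ⟨a, rfl⟩, _, ⟨b, rfl⟩, e⟩ := AddSubgroup.mem_sup.1 this
  exact ⟨a, b, (congrArg Subtype.val e).symm⟩

/-- `M[pⁿ] ≅ (ℤ/pⁿ)²`. -/
theorem nonempty_nTorsion_addEquiv (n : ℕ) :
    Nonempty (nTorsion M (p ^ n) ≃+ ZMod (p ^ n) × ZMod (p ^ n)) := by
  have hdiv : ∀ n (P : M), p • P = 0 → ∃ Q : M, p ^ n • Q = P ∧ p ^ (n + 1) • Q = 0 := by
    intro n P hP
    induction n with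
    | zero => exact ⟨P, by simp, by simpa using hP⟩
    | succ n ih =>
      obtain ⟨Q, hQ, hQ'⟩ := ih
      obtain ⟨R, hR, hR'⟩ := exists_nsmul_eq_of_mem_nTorsion_pow h hQ'
      exact ⟨R, by rw [pow_succ, mul_nsmul', hR', hQ], hR⟩
  -- Points whose `pⁿ`-multiples generate `M[p]` generate `M[p^(n+1)]`: after subtraction of a
  -- combination, `X` is killed by `p^(n+1)`, where the induction applies to `pP₁` and `pP₂`.
  have hgen : ∀ n (P₁ P₂ : M),
      (∀ X : M, p • X = 0 → ∃ a b : ℤ, X = a • p ^ n • P₁ + b • p ^ n • P₂) →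
      ∀ X : M, p ^ (n + 1) • X = 0 → ∃ a b : ℤ, X = a • P₁ + b • P₂ := by
    intro n
    induction n with
    | zero => intro P₁ P₂ hg X hX; simpa using hg X (by simpa using hX)
    | succ n ih =>
      intro P₁ P₂ hg X hX
      obtain ⟨a, b, e⟩ := hg (p ^ (n + 1) • X) (by rw [← mul_nsmul', ← pow_succ']; exact hX)
      obtain ⟨c, d, e'⟩ := ih (p • P₁) (p • P₂)
        (by simpa only [← mul_nsmul', ← pow_succ] using hg) (X - a • P₁ - b • P₂) (by
          rw [smul_sub, smul_sub, smul_comm _ a, smul_comm _ b, e]; abel)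
      refine ⟨a + c * p, b + d * p, ?_⟩
      rw [add_smul, add_smul, mul_smul, mul_smul, natCast_zsmul, natCast_zsmul,
        ← sub_eq_zero, ← sub_eq_zero.2 e']
      abel
  have hp0 := hp.out.pos
  have : NeZero (p ^ n) := ⟨by positivity⟩
  have := finite_nTorsion_pow h n
  obtain ⟨P₁, P₂, h₁, h₂, hg⟩ : ∃ P₁ P₂ : M, p ^ n • P₁ = 0 ∧ p ^ n • P₂ = 0 ∧
      ∀ X : M, p ^ n • X = 0 → ∃ a b : ℤ, X = a • P₁ + b • P₂ := by
    rcases n with _ | n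
    · exact ⟨0, 0, by simp, by simp, fun X hX => ⟨0, 0, by simpa using hX⟩⟩
    · obtain ⟨T₁, T₂, hT₁, hT₂, hg⟩ := exists_nTorsion_generators h
      obtain ⟨P₁, e₁, h₁⟩ := hdiv n T₁ hT₁
      obtain ⟨P₂, e₂, h₂⟩ := hdiv n T₂ hT₂
      exact ⟨P₁, P₂, h₁, h₂, hgen n P₁ P₂ (by rwa [e₁, e₂])⟩
  let f₁ : ZMod (p ^ n) →+ nTorsion M (p ^ n) := ZMod.lift _
    ⟨zmultiplesHom (nTorsion M (p ^ n)) ⟨P₁, h₁⟩, by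
      refine Subtype.ext ?_
      change ((p ^ n : ℕ) : ℤ) • P₁ = 0
      rwa [natCast_zsmul]⟩
  let f₂ : ZMod (p ^ n) →+ nTorsion M (p ^ n) := ZMod.lift _
    ⟨zmultiplesHom (nTorsion M (p ^ n)) ⟨P₂, h₂⟩, by
      refine Subtype.ext ?_
      change ((p ^ n : ℕ) : ℤ) • P₂ = 0
      rwa [natCast_zsmul]⟩
  let f : ZMod (p ^ n) × ZMod (p ^ n) →+ nTorsion M (p ^ n) := f₁.coprod f₂
  have hs : Function.Surjective f := by
    rintro ⟨X, hX⟩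
    obtain ⟨a, b, e⟩ := hg X hX
    refine ⟨(a, b), Subtype.ext ?_⟩
    simp [f, f₁, f₂, e]
  -- Injectivity is free: both sides have order `p^(2n)`.
  have hb : Function.Bijective f := (Nat.bijective_iff_surjective_and_card f).2 ⟨hs, by
    rw [card_nTorsion_pow h, Nat.card_prod, Nat.card_zmod]; ring⟩
  exact ⟨(AddEquiv.ofBijective f hb).symm⟩

end

end TorsionCounting

/-! ### Powers of `1 + pᵏu` for odd `p` -/

section PrincipalUnits

variable {p : ℕ} [hp : Fact p.Prime]

/-- Lifting the exponent: for odd `p` the valuation of `sʲ - 1` is `k` plus that of `j`. This single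
fact controls both the growth of `A(F)` in extensions and the order of the Galois image. -/
theorem pow_dvd_pow_sub_one_iff (hp2 : Odd p) {s u : ℤ} {k : ℕ} (hk : 1 ≤ k)
    (hs : s = 1 + p ^ k * u) (hu : ¬ (p : ℤ) ∣ u) (m j : ℕ) :
    (p : ℤ) ^ (k + m) ∣ s ^ j - 1 ↔ p ^ m ∣ j := by
  have hpp : Prime (p : ℤ) := Nat.prime_iff_prime_int.1 hp.out
  have hd : (p : ℤ) ∣ s - 1 := by
    rw [hs, add_sub_cancel_left]
    exact Dvd.dvd.mul_right (dvd_pow_self _ (by omega)) _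
  have hns : ¬ (p : ℤ) ∣ s := fun hc => hpp.not_isUnit (isUnit_of_dvd_one (by
    simpa using dvd_sub hc hd))
  have e := Int.emultiplicity_pow_sub_pow hp.out hp2 (x := s) (y := 1) (by simpa using hd) hns j
  have e1 : emultiplicity (p : ℤ) (s - 1) = k := by
    rw [hs, add_sub_cancel_left, emultiplicity_mul hpp,
      emultiplicity_pow_self hpp.ne_zero hpp.not_isUnit,
      emultiplicity_eq_zero.2 hu, add_zero]
  rw [one_pow, e1] at e
  rw [pow_dvd_iff_le_emultiplicity, pow_dvd_iff_le_emultiplicity, e, Nat.cast_add]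
  exact ENat.add_le_add_iff_left (ENat.natCast_ne_top k)

theorem pow_modEq_pow (hp2 : Odd p) {s u : ℤ} {k : ℕ} (hk : 1 ≤ k)
    (hs : s = 1 + p ^ k * u) (hu : ¬ (p : ℤ) ∣ u) {m i j : ℕ} (hij : i ≡ j [MOD p ^ m]) :
    (p : ℤ) ^ (k + m) ∣ s ^ i - s ^ j := by
  wlog hle : j ≤ i generalizing i j
  · rw [← dvd_neg, neg_sub]
    exact this hij.symm (by omega)
  obtain ⟨d, rfl⟩ := Nat.exists_eq_add_of_le hle
  have : s ^ (j + d) - s ^ j = s ^ j * (s ^ d - 1) := by ring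
  rw [this]
  refine Dvd.dvd.mul_left ((pow_dvd_pow_sub_one_iff hp2 hk hs hu m d).2 ?_) _
  simpa using (Nat.modEq_iff_dvd' hle).1 hij.symm

/-- A power of a topological generator of `1 + pᵏ ℤ_p` with exponent prime to `p` is again a
topological generator. -/
theorem exists_pow_pow_congr (hp2 : Odd p) {s u : ℤ} {k : ℕ} (hk : 1 ≤ k)
    (hs : s = 1 + p ^ k * u) (hu : ¬ (p : ℤ) ∣ u) {i₀ : ℕ} (hi₀ : ¬ p ∣ i₀) (m i : ℕ) :
    ∃ j : ℕ, (p : ℤ) ^ (k + m) ∣ (s ^ i₀) ^ j - s ^ i := by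
  have hc : Nat.Coprime i₀ (p ^ m) :=
    (Nat.Coprime.pow_left m ((hp.out.coprime_iff_not_dvd).2 hi₀)).symm
  -- `c` inverts `i₀` modulo `pᵐ`. The trivial modulus `m = 0` is split off because the existence
  -- lemma for inverses requires a modulus greater than one.
  obtain ⟨c, hc⟩ : ∃ c, i₀ * c ≡ 1 [MOD p ^ m] := by
    rcases Nat.eq_zero_or_pos m with rfl | hm
    · exact ⟨0, by rw [pow_zero]; exact Nat.modEq_one⟩
    · obtain ⟨c, hc⟩ := Nat.exists_mul_mod_eq_one_of_coprime hc
        (Nat.one_lt_pow hm.ne' hp.out.one_lt)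
      exact ⟨c, by rw [Nat.ModEq, hc.2, Nat.mod_eq_of_lt (Nat.one_lt_pow hm.ne' hp.out.one_lt)]⟩
  refine ⟨c * i, ?_⟩
  rw [← pow_mul]
  refine pow_modEq_pow hp2 hk hs hu ?_
  rw [← mul_assoc]
  simpa using hc.mul_right i

/-- The valuation is exactly `k + m`: one more factor `p` would force `p ∣ j` by the divisibility
criterion at level `m + 1`. -/
theorem pow_eq_one_add (hp2 : Odd p) {s u : ℤ} {k : ℕ} (hk : 1 ≤ k)
    (hs : s = 1 + p ^ k * u) (hu : ¬ (p : ℤ) ∣ u) {m j : ℕ} (hj : ¬ p ∣ j) :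
    ∃ u', s ^ (j * p ^ m) = 1 + p ^ (k + m) * u' ∧ ¬ (p : ℤ) ∣ u' := by
  have hp0 := hp.out.pos
  obtain ⟨u', h⟩ := (pow_dvd_pow_sub_one_iff hp2 hk hs hu m (j * p ^ m)).2 (Dvd.intro_left _ rfl)
  refine ⟨u', by linarith, ?_⟩
  rintro ⟨w, rfl⟩
  have := (pow_dvd_pow_sub_one_iff hp2 hk hs hu (m + 1) (j * p ^ m)).1
    ⟨w, by rw [h]; ring⟩
  rw [pow_succ'] at this
  exact hj (Nat.dvd_of_mul_dvd_mul_right (by positivity) this)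

end PrincipalUnits

/-! ### Artin–Schreier character and the number of points of `A` -/

section ArtinSchreier

variable (F : Type*) [Field F] [CharP F 2]

/-- The additive map `y ↦ y² + y` in characteristic two. -/
def artinSchreier : F →+ F where
  toFun y := y ^ 2 + y
  map_zero' := by simp
  map_add' x y := by
    rw [CharTwo.add_sq]
    ring

variable {F}

theorem artinSchreier_apply (y : F) : artinSchreier F y = y ^ 2 + y := rfl

theorem artinSchreier_eq_iff (y z : F) :
    artinSchreier F y = artinSchreier F z ↔ y = z ∨ y = z + 1 := by
  rw [← sub_eq_zero, ← map_sub, artinSchreier_apply]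
  have : (y - z) ^ 2 + (y - z) = (y - z) * (y - (z + 1)) := by
    have := CharTwo.two_eq_zero (R := F)
    linear_combination (y - z) * this
  rw [this, mul_eq_zero, sub_eq_zero, sub_eq_zero]

variable [Finite F]

/-- The kernel is `{0, 1}`, and index of the image equals order of the kernel. -/
theorem index_range_artinSchreier : (artinSchreier F).range.index = 2 := by
  have hk : Nat.card (artinSchreier F).ker = 2 := by
    rw [Nat.card_eq_two_iff' 0]
    refine ⟨⟨1, ?_⟩, ?_, ?_⟩
    · rw [AddMonoidHom.mem_ker, ← map_zero (artinSchreier F), artinSchreier_eq_iff]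
      simp
    · exact fun h => one_ne_zero (congrArg Subtype.val h)
    · rintro ⟨y, hy⟩ hne
      rw [AddMonoidHom.mem_ker, ← map_zero (artinSchreier F), artinSchreier_eq_iff, zero_add] at hy
      rcases hy with rfl | rfl
      · exact absurd rfl hne
      · rfl
  have h1 := (artinSchreier F).card_ker_mul_card_range
  have h2 := (artinSchreier F).range.card_mul_index
  rw [← h2, hk, mul_comm] at h1
  exact (Nat.eq_of_mul_eq_mul_left Nat.card_pos h1).symm

open scoped Classical in
/-- The nontrivial character of `F` with values `± 1` trivial on `{y² + y}`. -/
noncomputable def quadChar (a : F) : ℤ := if a ∈ (artinSchreier F).range then 1 else -1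

theorem quadChar_add (a b : F) : quadChar (a + b) = quadChar a * quadChar b := by
  unfold quadChar
  rw [AddSubgroup.add_mem_iff_of_index_two index_range_artinSchreier]
  by_cases ha : a ∈ (artinSchreier F).range <;> by_cases hb : b ∈ (artinSchreier F).range <;>
    simp [ha, hb]

omit [Finite F] in
theorem quadChar_artinSchreier (y : F) : quadChar (y ^ 2 + y) = 1 :=
  if_pos ⟨y, rfl⟩

omit [Finite F] in
theorem quadChar_zero : quadChar (0 : F) = 1 := by
  simpa using quadChar_artinSchreier (0 : F)

theorem quadChar_mul_self (a : F) : quadChar a * quadChar a = 1 := by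
  rw [← quadChar_add, CharTwo.add_self_eq_zero, quadChar_zero]

/-- `a² + a` is in the kernel of the character. This is what allows squares to be linearised in the
cubic sum. -/
theorem quadChar_sq (a : F) : quadChar (a ^ 2) = quadChar a := by
  have h := quadChar_artinSchreier a
  rw [quadChar_add] at h
  calc quadChar (a ^ 2) = quadChar (a ^ 2) * (quadChar a * quadChar a) := by
        rw [quadChar_mul_self, mul_one]
    _ = quadChar a := by rw [← mul_assoc, h, one_mul]

open scoped Classical in
omit [Finite F] in
theorem card_artinSchreier_fiber [Fintype F] (a : F) :
    ((Finset.univ.filter fun y : F => y ^ 2 + y = a).card : ℤ) = 1 + quadChar a := by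
  by_cases ha : a ∈ (artinSchreier F).range
  · obtain ⟨y, rfl⟩ := ha
    rw [artinSchreier_apply, quadChar_artinSchreier]
    have : (Finset.univ.filter fun z : F => z ^ 2 + z = y ^ 2 + y) = {y, y + 1} := by
      ext z
      simpa [artinSchreier_apply] using artinSchreier_eq_iff z y
    rw [this, Finset.card_pair (by simp)]
    norm_num
  · have : (Finset.univ.filter fun z : F => z ^ 2 + z = a) = ∅ := by
      refine Finset.filter_eq_empty_iff.2 fun z _ hz => ha ⟨z, hz⟩
    rw [this, quadChar, if_neg ha]
    simp

/-- Orthogonality: for `c ≠ 0`, translating `x` by `a / c` with `a` outside the image changes the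
sign of every term. -/
theorem sum_quadChar_mul [Fintype F] (c : F) :
    ∑ x : F, quadChar (x * c) = if c = 0 then (Fintype.card F : ℤ) else 0 := by
  split_ifs with hc
  · simp [hc, quadChar_zero]
  · obtain ⟨a, ha⟩ : ∃ a : F, a ∉ (artinSchreier F).range := by
      by_contra! hcon
      have : (artinSchreier F).range = ⊤ := by ext x; simpa using hcon x
      have h := index_range_artinSchreier (F := F)
      rw [this, AddSubgroup.index_top] at h
      omega
    have h1 : ∑ x : F, quadChar (x * c) = ∑ x : F, quadChar ((x + a / c) * c) :=
      (Equiv.sum_comp (Equiv.addRight (a / c)) fun x => quadChar (x * c)).symm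
    have h2 : ∀ x : F, quadChar ((x + a / c) * c) = -quadChar (x * c) := fun x => by
      rw [add_mul, div_mul_cancel₀ _ hc, quadChar_add]
      have : quadChar a = -1 := if_neg ha
      rw [this]; ring
    simp only [h2, Finset.sum_neg_distrib] at h1
    linarith

variable {r : ℕ}

omit [CharP F 2] in
theorem card_cube_eq_one [Fintype F] (hF : Fintype.card F = 4 ^ r) :
    Nat.card (powMonoidHom 3 : Fˣ →* Fˣ).ker = 3 := by
  rw [IsCyclic.card_powMonoidHom_ker, Nat.gcd_eq_right]
  rw [Nat.card_units, Nat.card_eq_fintype_card, hF]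
  have := Nat.sub_dvd_pow_sub_pow 4 1 r
  simpa using this

/-- A primitive cube root of unity `w` lies in `F` since `3 ∣ 4ʳ - 1`, and `w² + w = 1`. -/
theorem quadChar_one [Fintype F] (hF : Fintype.card F = 4 ^ r) : quadChar (1 : F) = 1 := by
  have : Nontrivial (powMonoidHom 3 : Fˣ →* Fˣ).ker :=
    Finite.one_lt_card_iff_nontrivial.1 (by rw [card_cube_eq_one hF]; norm_num)
  obtain ⟨⟨w, hw⟩, hne⟩ := exists_ne (1 : (powMonoidHom 3 : Fˣ →* Fˣ).ker)
  have hw3 : (w : F) ^ 3 = 1 := by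
    have := congrArg Units.val (MonoidHom.mem_ker.1 hw)
    simpa using this
  have hw1 : (w : F) - 1 ≠ 0 := by
    rw [sub_ne_zero]
    exact fun h => hne (Subtype.ext (Units.ext h))
  have h : (w : F) ^ 2 + w + 1 = 0 := by
    refine (mul_eq_zero.1 (?_ : ((w : F) - 1) * _ = 0)).resolve_left hw1
    linear_combination hw3
  have h' : (w : F) ^ 2 + w = 1 := by
    have := CharTwo.two_eq_zero (R := F)
    linear_combination h - this
  rw [← h', quadChar_artinSchreier]

omit [CharP F 2] in
theorem card_pow_four_eq_self [Fintype F] (hF : Fintype.card F = 4 ^ r) :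
    (Finset.univ.filter fun d : F => d ^ 4 = d).card = 4 := by
  have e : (Finset.univ.filter fun d : F => d ^ 4 = d) = insert 0
      ((Finset.univ.filter fun d : Fˣ => d ^ 3 = 1).map ⟨Units.val, Units.val_injective⟩) := by
    ext d
    simp only [Finset.mem_filter, Finset.mem_univ, true_and, Finset.mem_insert, Finset.mem_map,
      Function.Embedding.coeFn_mk]
    constructor
    · intro h
      rcases eq_or_ne d 0 with rfl | hd
      · exact Or.inl rfl
      · refine Or.inr ⟨Units.mk0 d hd, ?_, rfl⟩
        ext
        simp only [Units.val_pow_eq_pow_val, Units.val_mk0, Units.val_one]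
        exact mul_left_cancel₀ hd (by rw [← pow_succ', h, mul_one])
    · rintro (rfl | ⟨u, hu, rfl⟩)
      · simp
      · have := congrArg Units.val hu
        simp only [Units.val_pow_eq_pow_val, Units.val_one] at this
        rw [pow_succ, this, one_mul]
  rw [e, Finset.card_insert_of_notMem (by simp), Finset.card_map]
  have := card_cube_eq_one hF
  rw [Nat.card_eq_fintype_card, Fintype.card_subtype] at this
  simpa [MonoidHom.mem_ker] using this

/-- The cubic exponential sum. -/
theorem sum_quadChar_cube [Fintype F] (hF : Fintype.card F = 4 ^ r) :
    ∑ x : F, quadChar (x ^ 3) = (-2) ^ (r + 1) := by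
  set S := ∑ x : F, quadChar (x ^ 3) with hS
  have two := CharTwo.two_eq_zero (R := F)
  -- The product of the two values is the character of `d³ + x²d + xd²`. With `d = e²`, the term
  -- `x²d = (xe)²` may be replaced by `xe`, leaving `x(e + e⁴)`, which is linear in `x`;
  -- orthogonality then selects `d⁴ = d`.
  have inner : ∀ d : F, ∑ x : F, quadChar (x ^ 3) * quadChar ((x + d) ^ 3) =
      quadChar (d ^ 3) * if d ^ 4 = d then (Fintype.card F : ℤ) else 0 := by
    intro d
    obtain ⟨e, rfl⟩ : ∃ e : F, e ^ 2 = d := by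
      obtain ⟨e, he⟩ := (PerfectRing.bijective_frobenius (R := F) (p := 2)).2 d
      exact ⟨e, he⟩
    have h1 : ∀ x : F, quadChar (x ^ 3) * quadChar ((x + e ^ 2) ^ 3) =
        quadChar ((e ^ 2) ^ 3) * quadChar (x * (e + e ^ 4)) := by
      intro x
      rw [mul_add, quadChar_add, ← quadChar_sq (x * e), ← quadChar_add, ← quadChar_add,
        ← quadChar_add]
      congr 1
      linear_combination (x ^ 3 + x ^ 2 * e ^ 2 + x * e ^ 4) * two
    simp only [h1, ← Finset.mul_sum, sum_quadChar_mul]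
    congr 2
    rw [eq_iff_iff]
    constructor
    · intro h
      have h' : e ^ 4 = e := by linear_combination h - e * two
      rw [← pow_mul, mul_comm, pow_mul, h']
    · intro h
      have : (e ^ 4 + e) ^ 2 = 0 := by
        rw [CharTwo.add_sq]
        linear_combination h + e ^ 2 * two
      linear_combination pow_eq_zero_iff (two_ne_zero) |>.1 this
  have hsq : S ^ 2 = 4 * 4 ^ r := by
    have : S ^ 2 = ∑ d : F, ∑ x : F, quadChar (x ^ 3) * quadChar ((x + d) ^ 3) := by
      rw [Finset.sum_comm, sq, hS, Finset.sum_mul]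
      refine Finset.sum_congr rfl fun x _ => ?_
      rw [← Finset.mul_sum]
      congr 1
      exact (Equiv.sum_comp (Equiv.addLeft x) fun y => quadChar (y ^ 3)).symm
    rw [this]
    simp only [inner]
    have h2 : ∀ d : F, (quadChar (d ^ 3) * if d ^ 4 = d then (Fintype.card F : ℤ) else 0) =
        if d ^ 4 = d then (4 ^ r : ℤ) else 0 := by
      intro d
      split_ifs with h
      · have : quadChar (d ^ 3) = 1 := by
          rcases eq_or_ne d 0 with rfl | hd
          · simpa using quadChar_zero
          · have : d ^ 3 = 1 := mul_left_cancel₀ hd (by rw [← pow_succ', h, mul_one])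
            rw [this, quadChar_one hF]
        rw [this, hF]; simp
      · simp
    simp only [h2]
    rw [← Finset.sum_filter, Finset.sum_const, card_pow_four_eq_self hF]
    simp
  -- The square determines `S` up to sign, and the sign is read modulo `3`: cubing is three-to-one
  -- on `Fˣ`, so only `x = 0` contributes, while `(-2)^(r+1) ≡ 1`.
  have hmod : (3 : ℤ) ∣ S - 1 := by
    have h3 : ∀ y : Fˣ, (3 : ℤ) ∣ (Finset.univ.filter fun x : Fˣ => x ^ 3 = y).card •
        quadChar (y : F) := by
      intro y
      by_cases hy : y ∈ Set.range (powMonoidHom 3 : Fˣ →* Fˣ)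
      · have := MonoidHom.card_fiber_eq_of_mem_range (powMonoidHom 3 : Fˣ →* Fˣ) hy
          ⟨1, map_one _⟩
        have h1 := card_cube_eq_one hF
        rw [Nat.card_eq_fintype_card, Fintype.card_subtype] at h1
        simp only [MonoidHom.mem_ker] at h1
        rw [h1] at this
        simp only [powMonoidHom_apply] at this
        rw [this]
        simp
      · have : (Finset.univ.filter fun x : Fˣ => x ^ 3 = y) = ∅ :=
          Finset.filter_eq_empty_iff.2 fun x _ hx => hy ⟨x, hx⟩
        rw [this]
        simp
    have e : S = 1 + ∑ x : Fˣ, quadChar ((x ^ 3 : Fˣ) : F) := by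
      rw [hS, ← Finset.add_sum_erase _ _ (Finset.mem_univ (0 : F))]
      congr 1
      · simpa using quadChar_zero
      · have : (Finset.univ.erase (0 : F)) =
            (Finset.univ : Finset Fˣ).map ⟨Units.val, Units.val_injective⟩ := by
          ext x
          simp only [Finset.mem_erase, Finset.mem_univ, and_true, Finset.mem_map, true_and,
            Function.Embedding.coeFn_mk]
          exact ⟨fun h => ⟨Units.mk0 x h, rfl⟩, by rintro ⟨u, rfl⟩; exact u.ne_zero⟩
        rw [this, Finset.sum_map]
        simp
    rw [e, add_sub_cancel_left,
      Finset.sum_comp (fun y : Fˣ => quadChar (y : F)) (fun x : Fˣ => x ^ 3)]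
    exact Finset.dvd_sum fun y _ => h3 y
  have h3' : (3 : ℤ) ∣ (-2) ^ (r + 1) - 1 := by
    have := sub_dvd_pow_sub_pow (-2 : ℤ) 1 (r + 1)
    rw [one_pow] at this
    exact (by norm_num : (3 : ℤ) ∣ -2 - 1).trans this
  have hsq' : S ^ 2 = ((-2) ^ (r + 1)) ^ 2 := by
    rw [hsq, ← pow_mul, mul_comm (r + 1), pow_mul]
    norm_num [pow_succ]
    ring
  rcases sq_eq_sq_iff_eq_or_eq_neg.1 hsq' with h | h
  · exact h
  · rw [h] at hmod
    omega

open WeierstrassCurve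

/-- The derivative in `y` is `2y + 1 = 1`, so no affine point is singular. -/
theorem curveA_nonsingular_iff {k : Type*} [Field k] [CharP k 2] (x y : k) :
    (curveA k).toAffine.Nonsingular x y ↔ y ^ 2 + y = x ^ 3 + x ^ 2 + x + 1 := by
  rw [Affine.nonsingular_iff, Affine.equation_iff]
  simp only [curveA]
  have two := CharTwo.two_eq_zero (R := k)
  constructor
  · rintro ⟨h, -⟩
    linear_combination h
  · intro h
    refine ⟨by linear_combination h, Or.inr fun h' => one_ne_zero (α := k) ?_⟩
    linear_combination h' - y * two

open scoped Classical in
/-- The number of points of the curve `y² + y = x³ + x² + x + 1` over the field with `4ʳ`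
elements. -/
theorem card_curveA [Fintype F] (hF : Fintype.card F = 4 ^ r) :
    (Nat.card (curveA F).toAffine.Point : ℤ) = ((-2) ^ r - 1) ^ 2 := by
  let e : (curveA F).toAffine.Point ≃
      Option {xy : F × F // xy.2 ^ 2 + xy.2 = xy.1 ^ 3 + xy.1 ^ 2 + xy.1 + 1} :=
    (Affine.nonsingularPointEquiv (curveA F).toAffine).trans
      (Equiv.optionCongr (Equiv.subtypeEquivRight fun xy => curveA_nonsingular_iff xy.1 xy.2))
  rw [Nat.card_congr e, Nat.card_eq_fintype_card, Fintype.card_option, Fintype.card_subtype]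
  have h1 : ((Finset.univ.filter fun xy : F × F =>
      xy.2 ^ 2 + xy.2 = xy.1 ^ 3 + xy.1 ^ 2 + xy.1 + 1).card : ℤ) =
      ∑ x : F, (1 + quadChar (x ^ 3 + x ^ 2 + x + 1)) := by
    simp only [← card_artinSchreier_fiber]
    rw [Finset.card_filter, ← Finset.univ_product_univ, Finset.sum_product]
    push_cast
    refine Finset.sum_congr rfl fun x _ => ?_
    rw [Finset.card_filter]
    push_cast
    rfl
  -- The term `x² + x` is in the kernel of the character and so is `1`; only the cube survives.
  have h2 : ∀ x : F, quadChar (x ^ 3 + x ^ 2 + x + 1) = quadChar (x ^ 3) := fun x => by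
    rw [quadChar_add, quadChar_one hF, mul_one, add_assoc, quadChar_add, quadChar_artinSchreier,
      mul_one]
  push_cast
  rw [h1, Finset.sum_add_distrib]
  simp only [h2, sum_quadChar_cube hF]
  have h4 : (4 : ℤ) ^ r = ((-2) ^ r) ^ 2 := by
    rw [← pow_mul, mul_comm r, pow_mul]; norm_num
  simp only [Finset.sum_const, Finset.card_univ, hF, nsmul_eq_mul, mul_one]
  push_cast
  rw [h4, pow_succ]
  ring

end ArtinSchreier

/-! ### Chords, tangents and changes of variables -/

namespace WeierstrassCurve

section Slope

variable {k : Type*} [Field k] {W : WeierstrassCurve k}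

/-- The two equations characterizing the slope of the line through two points. -/
theorem slope_spec {x₁ x₂ y₁ y₂ : k} (h₁ : W.toAffine.Equation x₁ y₁)
    (h₂ : W.toAffine.Equation x₂ y₂) (hxy : ¬(x₁ = x₂ ∧ y₁ = W.toAffine.negY x₂ y₂)) :
    W.toAffine.slope x₁ x₂ y₁ y₂ * (x₁ - x₂) = y₁ - y₂ ∧
    W.toAffine.slope x₁ x₂ y₁ y₂ * (y₁ + y₂ + W.a₁ * x₂ + W.a₃) =
      x₁ ^ 2 + x₁ * x₂ + x₂ ^ 2 + W.a₂ * (x₁ + x₂) + W.a₄ - W.a₁ * y₁ := by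
  by_cases hx : x₁ = x₂
  · have hy : y₁ ≠ W.toAffine.negY x₂ y₂ := fun h => hxy ⟨hx, h⟩
    obtain rfl := hx
    obtain rfl := Affine.Y_eq_of_Y_ne h₁ h₂ rfl hy
    rw [Affine.slope_of_Y_ne rfl hy]
    refine ⟨by ring, ?_⟩
    have hd : y₁ - W.toAffine.negY x₁ y₁ ≠ 0 := sub_ne_zero.2 hy
    have e : y₁ + y₁ + W.a₁ * x₁ + W.a₃ = y₁ - W.toAffine.negY x₁ y₁ := by
      rw [Affine.negY]; ring
    rw [e, div_mul_cancel₀ _ hd]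
    ring
  · rw [Affine.slope_of_X_ne hx]
    have hd : x₁ - x₂ ≠ 0 := sub_ne_zero.2 hx
    refine ⟨div_mul_cancel₀ _ hd, ?_⟩
    rw [Affine.equation_iff] at h₁ h₂
    rw [div_mul_eq_mul_div, div_eq_iff hd]
    linear_combination h₁ - h₂

/-- Unless the points are opposite, one of the two equations has a nonzero coefficient at `ℓ`. Using
both treats chords and tangents uniformly, which matters for reduction: distinct points may become
equal there. -/
theorem eq_slope {x₁ x₂ y₁ y₂ ℓ : k} (h₁ : W.toAffine.Equation x₁ y₁)
    (h₂ : W.toAffine.Equation x₂ y₂) (hxy : ¬(x₁ = x₂ ∧ y₁ = W.toAffine.negY x₂ y₂))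
    (e₁ : ℓ * (x₁ - x₂) = y₁ - y₂)
    (e₂ : ℓ * (y₁ + y₂ + W.a₁ * x₂ + W.a₃) =
      x₁ ^ 2 + x₁ * x₂ + x₂ ^ 2 + W.a₂ * (x₁ + x₂) + W.a₄ - W.a₁ * y₁) :
    W.toAffine.slope x₁ x₂ y₁ y₂ = ℓ := by
  obtain ⟨s₁, s₂⟩ := slope_spec h₁ h₂ hxy
  by_cases hx : x₁ = x₂
  · have hd : y₁ + y₂ + W.a₁ * x₂ + W.a₃ ≠ 0 := fun h => hxy ⟨hx, by
      rw [Affine.negY]; linear_combination h⟩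
    exact mul_right_cancel₀ hd (s₂.trans e₂.symm)
  · exact mul_right_cancel₀ (sub_ne_zero.2 hx) (s₁.trans e₁.symm)

/-- The sum of two points in terms of any solution of the slope equations. -/
theorem add_some_of_slope {x₁ x₂ y₁ y₂ ℓ : k} (h₁ : W.toAffine.Nonsingular x₁ y₁)
    (h₂ : W.toAffine.Nonsingular x₂ y₂) (hxy : ¬(x₁ = x₂ ∧ y₁ = W.toAffine.negY x₂ y₂))
    (e₁ : ℓ * (x₁ - x₂) = y₁ - y₂)
    (e₂ : ℓ * (y₁ + y₂ + W.a₁ * x₂ + W.a₃) =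
      x₁ ^ 2 + x₁ * x₂ + x₂ ^ 2 + W.a₂ * (x₁ + x₂) + W.a₄ - W.a₁ * y₁) :
    ∃ h, (Affine.Point.some x₁ y₁ h₁ + Affine.Point.some x₂ y₂ h₂ : W.toAffine.Point) =
      Affine.Point.some (W.toAffine.addX x₁ x₂ ℓ) (W.toAffine.addY x₁ x₂ y₁ ℓ) h := by
  obtain rfl := eq_slope h₁.1 h₂.1 hxy e₁ e₂
  exact ⟨_, Affine.Point.add_some hxy⟩

/-- Viète's formulas for the line through two points. -/
theorem viete_slope {x₁ x₂ y₁ y₂ : k} (h₁ : W.toAffine.Equation x₁ y₁)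
    (h₂ : W.toAffine.Equation x₂ y₂) (hxy : ¬(x₁ = x₂ ∧ y₁ = W.toAffine.negY x₂ y₂)) :
    ∃ ℓ ν : k, W.toAffine.slope x₁ x₂ y₁ y₂ = ℓ ∧ y₁ = ℓ * x₁ + ν ∧ y₂ = ℓ * x₂ + ν ∧
      x₁ + x₂ + W.toAffine.addX x₁ x₂ ℓ = ℓ ^ 2 + W.a₁ * ℓ - W.a₂ ∧
      x₁ * x₂ + (x₁ + x₂) * W.toAffine.addX x₁ x₂ ℓ =
        W.a₄ - 2 * ℓ * ν - W.a₁ * ν - W.a₃ * ℓ ∧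
      x₁ * x₂ * W.toAffine.addX x₁ x₂ ℓ = ν ^ 2 + W.a₃ * ν - W.a₆ := by
  have hs := slope_spec h₁ h₂ hxy
  have h := Affine.addPolynomial_slope h₁ h₂ hxy
  set ℓ := W.toAffine.slope x₁ x₂ y₁ y₂
  rw [Affine.addPolynomial_eq, neg_inj, Cubic.prod_X_sub_C_eq, Cubic.toPoly_injective] at h
  have hc := congrArg Cubic.c h
  have hd := congrArg Cubic.d h
  simp only at hc hd
  refine ⟨ℓ, y₁ - ℓ * x₁, rfl, by ring, by linear_combination hs.1, ?_, ?_, ?_⟩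
  · rw [Affine.addX]; ring
  · linear_combination -hc
  · linear_combination hd

end Slope

section Transport

variable {k : Type*} [Field k]

/-- Points of equal curves. -/
noncomputable def pointCongr {W W' : WeierstrassCurve k} (h : W = W') :
    W.toAffine.Point ≃+ W'.toAffine.Point := by
  subst h; exact AddEquiv.refl _

theorem nonsingular_congr {W W' : WeierstrassCurve k} (h : W = W') {x y : k}
    (hxy : W.toAffine.Nonsingular x y) : W'.toAffine.Nonsingular x y :=
  h ▸ hxy

theorem pointCongr_some {W W' : WeierstrassCurve k} (h : W = W') {x y : k}
    (hxy : W.toAffine.Nonsingular x y) :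
    pointCongr h (.some x y hxy) = .some x y (h ▸ hxy) := by
  subst h; rfl

end Transport

section VariableChange

variable {k : Type*} [Field k] (W : WeierstrassCurve k) (C : VariableChange k)

/-- Solved for the old coefficients, the transformation rules are polynomial in `u`; no inverse
appears in later ring identities. -/
theorem coeffs_eq_of_variableChange :
    W.a₁ = C.u * (C • W).a₁ - 2 * C.s ∧
    W.a₂ = C.u ^ 2 * (C • W).a₂ + C.s * W.a₁ - 3 * C.r + C.s ^ 2 ∧
    W.a₃ = C.u ^ 3 * (C • W).a₃ - C.r * W.a₁ - 2 * C.t ∧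
    W.a₄ = C.u ^ 4 * (C • W).a₄ + C.s * W.a₃ - 2 * C.r * W.a₂ + (C.t + C.r * C.s) * W.a₁
      - 3 * C.r ^ 2 + 2 * C.s * C.t ∧
    W.a₆ = C.u ^ 6 * (C • W).a₆ - C.r * W.a₄ - C.r ^ 2 * W.a₂ - C.r ^ 3 + C.t * W.a₃ + C.t ^ 2
      + C.r * C.t * W.a₁ := by
  have h : ∀ (n : ℕ) (a : k), (C.u : k) ^ n * ((C.u⁻¹ : kˣ) ^ n * a) = a := fun n a => by
    rw [← mul_assoc, ← mul_pow, Units.mul_inv, one_pow, one_mul]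
  refine ⟨?_, ?_, ?_, ?_, ?_⟩
  · rw [variableChange_a₁]
    have := h 1 (W.a₁ + 2 * C.s)
    rw [pow_one, pow_one] at this
    rw [this]; ring
  · rw [variableChange_a₂, h]; ring
  · rw [variableChange_a₃, h]; ring
  · rw [variableChange_a₄, h]; ring
  · rw [variableChange_a₆, h]; ring

theorem equation_variableChange_iff (x y : k) :
    (C • W).toAffine.Equation x y ↔
      W.toAffine.Equation (C.u ^ 2 * x + C.r) (C.u ^ 3 * y + C.u ^ 2 * C.s * x + C.t) := by
  obtain ⟨h₁, h₂, h₃, h₄, h₆⟩ := coeffs_eq_of_variableChange W C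
  rw [Affine.equation_iff', Affine.equation_iff',
    ← mul_eq_zero_iff_left (pow_ne_zero 6 C.u.ne_zero)]
  simp only [toAffine]
  generalize (C • W).a₁ = b₁ at *
  generalize (C • W).a₂ = b₂ at *
  generalize (C • W).a₃ = b₃ at *
  generalize (C • W).a₄ = b₄ at *
  generalize (C • W).a₆ = b₆ at *
  rw [h₆, h₄, h₃, h₂, h₁]
  refine eq_iff_eq_cancel_right.2 ?_ |>.trans Iff.rfl
  ring

variable [W.IsElliptic]

theorem nonsingular_variableChange_iff (x y : k) :
    (C • W).toAffine.Nonsingular x y ↔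
      W.toAffine.Nonsingular (C.u ^ 2 * x + C.r) (C.u ^ 3 * y + C.u ^ 2 * C.s * x + C.t) := by
  rw [← Affine.equation_iff_nonsingular, ← Affine.equation_iff_nonsingular,
    equation_variableChange_iff]

/-- The isomorphism on points given by an admissible change of variables. -/
noncomputable def pointOfVariableChange : (C • W).toAffine.Point →+ W.toAffine.Point where
  toFun P := match P with
    | .zero => 0
    | .some x y h => .some _ _ ((nonsingular_variableChange_iff W C x y).1 h)
  map_zero' := rfl
  map_add' := by
    rintro (_ | ⟨x₁, y₁, h₁⟩) (_ | ⟨x₂, y₂, h₂⟩)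
    any_goals rfl
    obtain ⟨c₁, c₂, c₃, c₄, -⟩ := coeffs_eq_of_variableChange W C
    have hu := C.u.ne_zero
    have hn : ∀ x y : k, W.toAffine.negY (C.u ^ 2 * x + C.r)
        (C.u ^ 3 * y + C.u ^ 2 * C.s * x + C.t) =
        C.u ^ 3 * (C • W).toAffine.negY x y + C.u ^ 2 * C.s * x + C.t := fun x y => by
      simp only [Affine.negY]
      rw [c₃, c₁]; ring
    have hiff : (C.u ^ 2 * x₁ + C.r = C.u ^ 2 * x₂ + C.r ∧
        C.u ^ 3 * y₁ + C.u ^ 2 * C.s * x₁ + C.t =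
          W.toAffine.negY (C.u ^ 2 * x₂ + C.r) (C.u ^ 3 * y₂ + C.u ^ 2 * C.s * x₂ + C.t)) ↔
        (x₁ = x₂ ∧ y₁ = (C • W).toAffine.negY x₂ y₂) := by
      rw [hn]
      constructor
      · rintro ⟨e, e'⟩
        have hx : x₁ = x₂ := mul_left_cancel₀ (pow_ne_zero 2 hu) (by linear_combination e)
        subst hx
        exact ⟨rfl, mul_left_cancel₀ (pow_ne_zero 3 hu) (by linear_combination e')⟩
      · rintro ⟨rfl, rfl⟩
        exact ⟨rfl, rfl⟩
    by_cases hxy : x₁ = x₂ ∧ y₁ = (C • W).toAffine.negY x₂ y₂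
    · rw [Affine.Point.add_of_Y_eq hxy.1 hxy.2]
      exact (Affine.Point.add_of_Y_eq (hiff.2 hxy).1 (hiff.2 hxy).2).symm
    · obtain ⟨s₁, s₂⟩ := slope_spec h₁.1 h₂.1 hxy
      set ℓ := (C • W).toAffine.slope x₁ x₂ y₁ y₂ with hℓ
      obtain ⟨h₃, e⟩ := add_some_of_slope h₁ h₂ hxy s₁ s₂
      -- The line of slope `ℓ` goes to slope `(u³ℓ + u²s) / u² = uℓ + s`.
      obtain ⟨h₄, e'⟩ := add_some_of_slope (ℓ := C.u * ℓ + C.s)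
        ((nonsingular_variableChange_iff W C x₁ y₁).1 h₁)
        ((nonsingular_variableChange_iff W C x₂ y₂).1 h₂) (fun h => hxy (hiff.1 h))
        (by linear_combination C.u ^ 3 * s₁) (by
          rw [c₄, c₃, c₂, c₁]
          linear_combination C.u ^ 4 * s₂ + C.u ^ 3 * C.s * s₁)
      rw [e]
      refine Eq.trans ?_ e'.symm
      simp only [Affine.Point.some.injEq]
      refine ⟨?_, ?_⟩
      · simp only [Affine.addX]
        rw [c₂, c₁]; ring
      · simp only [Affine.addY, Affine.negAddY, Affine.addX, Affine.negY]
        rw [c₃, c₂, c₁]; ring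

theorem pointOfVariableChange_some {x y : k} (h : (C • W).toAffine.Nonsingular x y) :
    pointOfVariableChange W C (.some x y h) =
      .some _ _ ((nonsingular_variableChange_iff W C x y).1 h) := rfl

theorem pointOfVariableChange_bijective : Function.Bijective (pointOfVariableChange W C) := by
  have hu := C.u.ne_zero
  constructor
  · rw [injective_iff_map_eq_zero]
    rintro (_ | ⟨x, y, h⟩) hP
    · rfl
    · exact absurd hP (Affine.Point.some_ne_zero _)
  · rintro (_ | ⟨x, y, h⟩)
    · exact ⟨0, map_zero _⟩
    · have hx : C.u ^ 2 * ((x - C.r) / C.u ^ 2) + C.r = x := by field_simp; ring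
      have hy : C.u ^ 3 * ((y - C.t - C.s * (x - C.r)) / C.u ^ 3) +
          C.u ^ 2 * C.s * ((x - C.r) / C.u ^ 2) + C.t = y := by field_simp; ring
      refine ⟨.some ((x - C.r) / C.u ^ 2) ((y - C.t - C.s * (x - C.r)) / C.u ^ 3) ?_, ?_⟩
      · rw [nonsingular_variableChange_iff, hx, hy]; exact h
      · rw [pointOfVariableChange_some]
        simp only [Affine.Point.some.injEq]
        exact ⟨hx, hy⟩

end VariableChange

end WeierstrassCurve

/-! ### Frobenius on finite sets of algebraic elements -/

section FrobeniusPowers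

variable {F Ω : Type*} [Field F] [Field Ω] [Finite F]

theorem exists_pow_card_pow_eq_self [Algebra F Ω] [Algebra.IsAlgebraic F Ω] (S : Set Ω) [Finite S] :
    ∃ d : ℕ, d ≠ 0 ∧ ∀ x ∈ S, x ^ Nat.card F ^ d = x := by
  have := IntermediateField.finiteDimensional_adjoin (K := F) (S := S)
    (fun x _ => Algebra.IsIntegral.isIntegral x)
  let E := IntermediateField.adjoin F S
  have hfin : Finite E := Module.finite_of_finite F
  have := Fintype.ofFinite E
  refine ⟨Module.finrank F E, Module.finrank_pos.ne', fun x hx => ?_⟩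
  have h := FiniteField.pow_card (⟨x, IntermediateField.subset_adjoin F S hx⟩ : E)
  rw [← Nat.card_eq_fintype_card, Module.natCard_eq_pow_finrank (K := F)] at h
  exact congrArg Subtype.val h

/-- A finite set generates a finite extension, whose Galois group consists of the powers of
Frobenius. -/
theorem exists_algEquiv_eq_pow [Algebra F Ω] [Algebra.IsAlgebraic F Ω] (S : Set Ω) [Finite S]
    (σ : Gal(Ω/F)) : ∃ i : ℕ, ∀ x ∈ S, σ x = x ^ Nat.card F ^ i := by
  have := IntermediateField.finiteDimensional_adjoin (K := F) (S := S)
    (fun x _ => Algebra.IsIntegral.isIntegral x)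
  let E := IntermediateField.adjoin F S
  have hfin : Finite E := Module.finite_of_finite F
  have := Fintype.ofFinite F
  obtain ⟨i, hi⟩ := (FiniteField.bijective_frobeniusAlgEquivOfAlgebraic_pow F E).2
    (σ.restrictNormal E)
  refine ⟨i, fun x hx => ?_⟩
  have h2 := AlgEquiv.restrictNormal_commutes σ E ⟨x, IntermediateField.subset_adjoin F S hx⟩
  rw [← hi, AlgEquiv.coe_pow, FiniteField.coe_frobeniusAlgEquivOfAlgebraic_iterate,
    ← Nat.card_eq_fintype_card] at h2
  exact h2.symm

/-- The polynomial `X^q - X` has at most `q` roots, and the image of `f` already supplies `q` of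
them. -/
theorem mem_range_of_pow_card_eq_self (f : F →+* Ω) {x : Ω}
    (hx : x ^ Nat.card F = x) : x ∈ Set.range f := by
  classical
  have := Fintype.ofFinite F
  have hq : 1 < Nat.card F := Finite.one_lt_card
  by_contra hne
  have hdeg := FiniteField.X_pow_card_sub_X_natDegree_eq Ω hq
  have h0 := FiniteField.X_pow_card_sub_X_ne_zero Ω hq
  have hsub : (insert x (Finset.univ.image f)).val ⊆
      (Polynomial.X ^ Nat.card F - Polynomial.X : Polynomial Ω).roots := by
    intro z hz
    rw [Polynomial.mem_roots h0, Polynomial.IsRoot.def, Polynomial.eval_sub, Polynomial.eval_pow,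
      Polynomial.eval_X, sub_eq_zero]
    rcases Finset.mem_insert.1 hz with rfl | hz
    · exact hx
    · obtain ⟨a, -, rfl⟩ := Finset.mem_image.1 hz
      rw [← map_pow, Nat.card_eq_fintype_card, FiniteField.pow_card]
  have := Polynomial.card_le_degree_of_subset_roots hsub
  rw [hdeg, Finset.card_insert_of_notMem (by simpa using hne),
    Finset.card_image_of_injective _ f.injective, Finset.card_univ, Nat.card_eq_fintype_card] at this
  omega

end FrobeniusPowers

/-! ### Frobenius as multiplication by `-2`, and the torsion of `A` -/

namespace WeierstrassCurve

section Endomorphism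

variable {k : Type*} [Field k] [CharP k 2]

theorem curveA_nonsingular_pow_four {x y : k} (h : (curveA k).toAffine.Nonsingular x y) :
    (curveA k).toAffine.Nonsingular (x ^ 4) (y ^ 4) := by
  rw [curveA_nonsingular_iff] at h ⊢
  have h4 : ∀ a b : k, (a + b) ^ 4 = a ^ 4 + b ^ 4 := fun a b => by
    rw [show 4 = 2 ^ 2 by norm_num, add_pow_char_pow]
  have := congrArg (· ^ 4) h
  simp only [h4] at this
  linear_combination this

/-- On the curve `y² + y = x³ + x² + x + 1` the Frobenius of `𝔽₄` is multiplication by `-2`. -/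
theorem curveA_neg_two_zsmul {x y : k} (h : (curveA k).toAffine.Nonsingular x y) :
    (-2 : ℤ) • (Affine.Point.some x y h : (curveA k).toAffine.Point) =
      .some (x ^ 4) (y ^ 4) (curveA_nonsingular_pow_four h) := by
  have two := CharTwo.two_eq_zero (R := k)
  have he := (curveA_nonsingular_iff x y).1 h
  have hxy : ¬(x = x ∧ y = (curveA k).toAffine.negY x y) := by
    rintro ⟨-, h⟩
    simp only [Affine.negY, curveA] at h
    exact one_ne_zero (α := k) (by linear_combination h - y * two)
  -- The tangent slope is `(3x² + 2x + 1) / (2y + 1)`, which is `x² + 1` in characteristic two.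
  obtain ⟨h', e⟩ := add_some_of_slope (ℓ := x ^ 2 + 1) h h hxy (by ring) (by
    simp only [curveA]
    linear_combination (x ^ 2 * y + y - x ^ 2 - x) * two)
  rw [neg_smul, two_smul, e, neg_eq_iff_eq_neg, Affine.Point.neg_some, Affine.Point.some.injEq]
  simp only [Affine.addX, Affine.addY, Affine.negAddY, Affine.negY, curveA]
  refine ⟨by linear_combination (x ^ 2 - x) * two, ?_⟩
  -- The square of the curve equation eliminates `y⁴` from the comparison of second coordinates.
  have h2 : y ^ 4 + y ^ 2 = x ^ 6 + x ^ 4 + x ^ 2 + 1 := by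
    have := congrArg (· ^ 2) he
    simp only [CharTwo.add_sq] at this
    linear_combination this
  linear_combination h2 - he + (x - x ^ 2 + x ^ 3 - x ^ 4) * two

theorem curveA_neg_two_pow_zsmul (r : ℕ) {x y : k} (h : (curveA k).toAffine.Nonsingular x y) :
    ∃ h', ((-2 : ℤ) ^ r) • (Affine.Point.some x y h : (curveA k).toAffine.Point) =
      .some (x ^ 4 ^ r) (y ^ 4 ^ r) h' := by
  induction r with
  | zero => exact ⟨by simpa using h, by simp⟩
  | succ r ih =>
    obtain ⟨h', e⟩ := ih
    refine ⟨by simpa only [← pow_mul, ← pow_succ] using curveA_nonsingular_pow_four h', ?_⟩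
    rw [pow_succ', mul_smul, e, curveA_neg_two_zsmul]
    simp only [← pow_mul, ← pow_succ]

theorem curveA_sub_one_zsmul_eq_zero_iff (r : ℕ) {x y : k}
    (h : (curveA k).toAffine.Nonsingular x y) :
    ((-2 : ℤ) ^ r - 1) • (Affine.Point.some x y h : (curveA k).toAffine.Point) = 0 ↔
      x ^ 4 ^ r = x ∧ y ^ 4 ^ r = y := by
  obtain ⟨h', e⟩ := curveA_neg_two_pow_zsmul r h
  rw [sub_smul, one_smul, e, sub_eq_zero, Affine.Point.some.injEq]

end Endomorphism

section Map

variable {k L : Type*} [Field k] [Field L]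

/-- The map on points of `y² + y = x³ + x² + x + 1` induced by a field homomorphism. -/
noncomputable def curveAMap (f : k →+* L) :
    (curveA k).toAffine.Point →+ (curveA L).toAffine.Point :=
  letI := f.toAlgebra
  (pointCongr (curveA_map f)).toAddMonoidHom.comp ((curveA k).ptsIncl L)

theorem curveAMap_some (f : k →+* L) {x y : k} (h : (curveA k).toAffine.Nonsingular x y) :
    ∃ h', curveAMap f (.some x y h) = .some (f x) (f y) h' := by
  let := f.toAlgebra
  exact ⟨_, pointCongr_some (curveA_map f) _⟩

theorem curveAMap_injective (f : k →+* L) : Function.Injective (curveAMap f) := by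
  rw [injective_iff_map_eq_zero]
  rintro (_ | ⟨x, y, h⟩) hP
  · rfl
  · obtain ⟨h', e⟩ := curveAMap_some f h
    rw [e] at hP
    exact absurd hP (Affine.Point.some_ne_zero _)

theorem mem_range_curveAMap [CharP k 2] [CharP L 2] (f : k →+* L) {x y : L}
    (h : (curveA L).toAffine.Nonsingular x y) (hx : x ∈ Set.range f) (hy : y ∈ Set.range f) :
    ∃ P, curveAMap f P = .some x y h := by
  obtain ⟨x, rfl⟩ := hx
  obtain ⟨y, rfl⟩ := hy
  have h' : (curveA k).toAffine.Nonsingular x y := by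
    rw [curveA_nonsingular_iff] at h ⊢
    refine f.injective ?_
    simpa using h
  obtain ⟨_, e⟩ := curveAMap_some f h'
  exact ⟨_, e⟩

variable [CharP k 2] [CharP L 2]

theorem curveA_finite_zsmul_eq_zero [Finite k] {r : ℕ} (hk : Nat.card k = 4 ^ r)
    (P : (curveA k).toAffine.Point) : ((-2 : ℤ) ^ r - 1) • P = 0 := by
  have := Fintype.ofFinite k
  rcases P with _ | ⟨x, y, h⟩
  · exact smul_zero _
  · rw [curveA_sub_one_zsmul_eq_zero_iff, ← hk, Nat.card_eq_fintype_card]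
    exact ⟨FiniteField.pow_card x, FiniteField.pow_card y⟩

/-- Both sides say that the `4ʳ`-power Frobenius, which is `(-2)ʳ`, fixes `Q`. -/
theorem mem_range_curveAMap_iff [Finite k] {r : ℕ} (hk : Nat.card k = 4 ^ r) (f : k →+* L)
    (Q : (curveA L).toAffine.Point) :
    (∃ P, curveAMap f P = Q) ↔ ((-2 : ℤ) ^ r - 1) • Q = 0 := by
  constructor
  · rintro ⟨P, rfl⟩
    rw [← map_zsmul, curveA_finite_zsmul_eq_zero hk, map_zero]
  · rcases Q with _ | ⟨x, y, h⟩
    · exact fun _ => ⟨0, map_zero _⟩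
    · rw [curveA_sub_one_zsmul_eq_zero_iff, ← hk]
      rintro ⟨hx, hy⟩
      exact mem_range_curveAMap f h (mem_range_of_pow_card_eq_self f hx)
        (mem_range_of_pow_card_eq_self f hy)

end Map

section Torsion

variable (Ω : Type*) [Field Ω] [IsAlgClosed Ω] [CharP Ω 2]

/-- The torsion in question is the group of points over the field with `4ʳ = 2^(2r)` elements,
embedded in `Ω`, and that group has been counted. -/
theorem curveA_card_nTorsion {r : ℕ} (hr : r ≠ 0) :
    Nat.card (nTorsion (curveA Ω).toAffine.Point ((-2 : ℤ) ^ r - 1).natAbs) =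
      ((-2 : ℤ) ^ r - 1).natAbs ^ 2 := by
  let F := GaloisField 2 (2 * r)
  have hF : Nat.card F = 4 ^ r := by
    rw [GaloisField.card 2 (2 * r) (by omega), pow_mul]; norm_num
  have : Finite F := Nat.finite_of_card_ne_zero (by rw [hF]; positivity)
  have := Fintype.ofFinite F
  let := ZMod.algebra Ω 2
  let f : F →+* Ω := (IsAlgClosed.lift : F →ₐ[ZMod 2] Ω).toRingHom
  have e : Nat.card (nTorsion (curveA Ω).toAffine.Point ((-2 : ℤ) ^ r - 1).natAbs) =
      Nat.card (curveA F).toAffine.Point := by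
    refine (Nat.card_congr (Equiv.ofBijective (fun P : (curveA F).toAffine.Point =>
      (⟨curveAMap f P, ?_⟩ :
        nTorsion (curveA Ω).toAffine.Point ((-2 : ℤ) ^ r - 1).natAbs)) ⟨?_, ?_⟩)).symm
    · rw [mem_nTorsion, ← natCast_zsmul, Int.natCast_natAbs, abs_zsmul_eq_zero]
      exact (mem_range_curveAMap_iff hF f _).1 ⟨P, rfl⟩
    · exact fun P Q h => curveAMap_injective f (congrArg Subtype.val h)
    · rintro ⟨Q, hQ⟩
      rw [mem_nTorsion, ← natCast_zsmul, Int.natCast_natAbs, abs_zsmul_eq_zero] at hQ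
      obtain ⟨P, hP⟩ := (mem_range_curveAMap_iff hF f _).2 hQ
      exact ⟨P, Subtype.ext hP⟩
  rw [e]
  zify
  rw [sq_abs, card_curveA (by rw [← Nat.card_eq_fintype_card, hF])]

variable (p : ℕ) [hp : Fact p.Prime]

theorem exists_neg_two_pow_eq {r : ℕ} (hr : r ≠ 0) (hd : (p : ℤ) ∣ (-2) ^ r - 1) :
    ∃ (k : ℕ) (u : ℤ), 1 ≤ k ∧ (-2) ^ r = 1 + p ^ k * u ∧ ¬ (p : ℤ) ∣ u := by
  have hne : (-2 : ℤ) ^ r - 1 ≠ 0 := by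
    intro h
    have h1 : (-2 : ℤ) ^ r = 1 := by linarith
    have h2 := congrArg Int.natAbs h1
    rw [Int.natAbs_pow] at h2
    have : 2 ≤ 2 ^ r := Nat.le_self_pow hr 2
    have h3 : (2 : ℕ) ^ r = 1 := h2
    omega
  have hfin : FiniteMultiplicity (p : ℤ) ((-2) ^ r - 1) :=
    Int.finiteMultiplicity_iff.2 ⟨by simpa using hp.out.ne_one, hne⟩
  obtain ⟨u, hu, hnu⟩ := hfin.exists_eq_pow_mul_and_not_dvd
  refine ⟨_, u, ?_, by linarith, hnu⟩
  by_contra hk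
  rw [not_le, Nat.lt_one_iff] at hk
  rw [hk, pow_zero, one_mul] at hu
  exact hnu (hu ▸ hd)

theorem curveA_card_nTorsion_pow_of_eq {r k : ℕ} {u : ℤ} (hr : r ≠ 0)
    (h : (-2 : ℤ) ^ r = 1 + p ^ k * u) (hu : ¬ (p : ℤ) ∣ u) :
    Nat.card (nTorsion (curveA Ω).toAffine.Point (p ^ k)) = p ^ (2 * k) := by
  have hc := curveA_card_nTorsion Ω hr
  have e : ((-2 : ℤ) ^ r - 1).natAbs = p ^ k * u.natAbs := by
    rw [h, add_sub_cancel_left, Int.natAbs_mul, Int.natAbs_pow, Int.natAbs_natCast]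
  rw [e] at hc
  have hpu : ¬ p ∣ u.natAbs := fun hd => hu (Int.natCast_dvd.2 hd)
  rw [card_nTorsion_of_coprime_mul (by have := hp.out.pos; positivity)
    (fun h0 => hpu (by rw [h0]; exact dvd_zero p))
    (Nat.Coprime.pow_left _ ((hp.out.coprime_iff_not_dvd).2 hpu)) hc]
  ring

/-- Fermat gives `p ∣ (-2)^(p-1) - 1`, say with valuation `k`. The exponent `(p - 1)pᵐ` then has
valuation exactly `k + m`, so every power of `p` from `pᵏ` on is reached. -/
theorem exists_curveA_card_nTorsion_pow (hp2 : Odd p) :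
    ∃ v, ∀ n, v ≤ n → Nat.card (nTorsion (curveA Ω).toAffine.Point (p ^ n)) = p ^ (2 * n) := by
  have hr : p - 1 ≠ 0 := by have := hp.out.two_le; omega
  have hcop : IsCoprime (-2 : ℤ) p := by
    rw [IsCoprime.neg_left_iff]
    exact Nat.isCoprime_iff_coprime.2 (Nat.coprime_two_left.2 hp2)
  obtain ⟨k, u, hk, hs, hu⟩ := exists_neg_two_pow_eq p hr (Int.prime_dvd_pow_sub_one hp.out hcop)
  refine ⟨k, fun n hn => ?_⟩
  obtain ⟨m, rfl⟩ := Nat.exists_eq_add_of_le hn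
  obtain ⟨u', h', hu'⟩ := pow_eq_one_add hp2 hk hs hu (m := m) (j := 1)
    (fun h => hp.out.one_lt.ne' (Nat.dvd_one.1 h))
  rw [one_mul, ← pow_mul] at h'
  exact curveA_card_nTorsion_pow_of_eq Ω p
    (mul_ne_zero hr (by have := hp.out.pos; positivity)) h' hu'

theorem curveA_nsmul_surjective (hp2 : Odd p) (F : Type*) [Field F] [Finite F]
    [Algebra F Ω] [Algebra.IsAlgebraic F Ω] (P : (curveA Ω).toAffine.Point) :
    ∃ Q : (curveA Ω).toAffine.Point, p • Q = P := by
  obtain ⟨v, hv⟩ := exists_curveA_card_nTorsion_pow Ω p hp2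
  refine nsmul_surjective_of_torsion hv (fun P => ?_) P
  rcases P with _ | ⟨x, y, h⟩
  · exact ⟨1, one_ne_zero, smul_zero _⟩
  · have : CharP F 2 := (algebraMap F Ω).charP (algebraMap F Ω).injective 2
    have := Fintype.ofFinite F
    obtain ⟨d, hd, hxy⟩ := exists_pow_card_pow_eq_self (F := F) ({x, y} : Set Ω)
    obtain ⟨n, -, hn⟩ := FiniteField.card F 2
    rw [← Nat.card_eq_fintype_card] at hn
    -- Here `#F = 2ⁿ` need not be a power of `4`; applying the `2^(nd)`-power map twice gives the
    -- `4^(nd)`-power map, of which `-2` has control. Hence every point is torsion.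
    have hpow : ∀ z : Ω, z ^ Nat.card F ^ d = z → z ^ 4 ^ ((n : ℕ) * d) = z := by
      intro z hz
      rw [hn, ← pow_mul] at hz
      have : 4 ^ ((n : ℕ) * d) = 2 ^ ((n : ℕ) * d) * 2 ^ ((n : ℕ) * d) := by
        rw [← mul_pow]; norm_num
      rw [this, pow_mul, hz, hz]
    have hnd : (n : ℕ) * d ≠ 0 := mul_ne_zero n.ne_zero hd
    refine ⟨((-2 : ℤ) ^ ((n : ℕ) * d) - 1).natAbs, ?_, ?_⟩
    · have hc := curveA_card_nTorsion Ω hnd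
      intro h0
      have h1 : (-2 : ℤ) ^ ((n : ℕ) * d) = 1 := by
        have := Int.natAbs_eq_zero.1 h0
        linarith
      have h2 := congrArg Int.natAbs h1
      rw [Int.natAbs_pow] at h2
      have : 2 ≤ 2 ^ ((n : ℕ) * d) := Nat.le_self_pow hnd 2
      have h3 : (2 : ℕ) ^ ((n : ℕ) * d) = 1 := h2
      omega
    · rw [← natCast_zsmul, Int.natCast_natAbs, abs_zsmul_eq_zero,
        curveA_sub_one_zsmul_eq_zero_iff]
      exact ⟨hpow x (hxy x (by simp)), hpow y (hxy y (by simp))⟩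

end Torsion

end WeierstrassCurve

/-! ### Rational points over finite fields -/

namespace WeierstrassCurve

section FiniteFields

variable (p : ℕ) [hp : Fact p.Prime] {F : Type*} [Field F] [Finite F] [CharP F 2] {r : ℕ}

omit [CharP F 2] in
theorem ne_zero_of_card_eq_four_pow (hF : Nat.card F = 4 ^ r) : r ≠ 0 := by
  rintro rfl
  have : 1 < Nat.card F := Finite.one_lt_card
  rw [hF, pow_zero] at this
  exact lt_irrefl 1 this

/-- The `p`-primary subgroup of the group of rational points over the field with `4ʳ` elements
is governed by the `p`-adic valuation of `(-2)ʳ - 1`. -/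
theorem nonempty_primaryComponent_equiv (hp2 : Odd p) (hF : Nat.card F = 4 ^ r) {k : ℕ} {u : ℤ}
    (hs : (-2 : ℤ) ^ r = 1 + p ^ k * u) (hu : ¬ (p : ℤ) ∣ u) :
    Nonempty (AddCommGroup.primaryComponent (curveA F).toAffine.Point p ≃+
      ZMod (p ^ k) × ZMod (p ^ k)) := by
  let Ω := AlgebraicClosure F
  have : CharP Ω 2 := charP_of_injective_algebraMap (algebraMap F Ω).injective 2
  obtain ⟨v, hv⟩ := exists_curveA_card_nTorsion_pow Ω p hp2
  obtain ⟨e⟩ := nonempty_nTorsion_addEquiv hv k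
  let f : (curveA F).toAffine.Point →+ (curveA Ω).toAffine.Point := curveAMap (algebraMap F Ω)
  have hf : Function.Injective f := curveAMap_injective _
  -- `P` is killed by `pᵏu` and by a power of `p`; since `u` is prime to `p`, already `pᵏ` kills it.
  have hkill : ∀ P ∈ AddCommGroup.primaryComponent (curveA F).toAffine.Point p,
      p ^ k • P = 0 := by
    intro P hP
    obtain ⟨n, hn⟩ := AddCommGroup.mem_primaryComponent.1 hP
    have h1 := curveA_finite_zsmul_eq_zero hF P
    rw [hs, add_sub_cancel_left, mul_comm, mul_smul] at h1
    have hcop : IsCoprime u ((p : ℤ) ^ n) :=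
      ((Nat.prime_iff_prime_int.1 hp.out).coprime_iff_not_dvd.2 hu).symm.pow_right
    obtain ⟨a, b, hab⟩ := hcop
    have h2 : (p : ℤ) ^ n • ((p : ℤ) ^ k • P) = 0 := by
      rw [smul_comm]
      have : ((p : ℤ) ^ n) • P = 0 := by
        rw [← Nat.cast_pow, natCast_zsmul]; exact hn
      rw [this, smul_zero]
    have h3 : (p : ℤ) ^ k • P = 0 := by
      rw [← one_smul ℤ ((p : ℤ) ^ k • P), ← hab, add_smul, mul_smul, mul_smul, h1, h2]
      simp
    rwa [← Nat.cast_pow, natCast_zsmul] at h3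
  let g : AddCommGroup.primaryComponent (curveA F).toAffine.Point p →+
      nTorsion (curveA Ω).toAffine.Point (p ^ k) :=
    (f.comp (AddSubgroup.subtype _)).codRestrict _ (fun P => by
      rw [mem_nTorsion, AddMonoidHom.comp_apply, ← map_nsmul, AddSubgroup.subtype_apply,
        hkill _ P.2, map_zero])
  have hg : Function.Bijective g := by
    constructor
    · intro P Q h
      exact Subtype.ext (hf (congrArg Subtype.val h))
    · rintro ⟨Q, hQ⟩
      -- `pᵏ` divides `s - 1`, so all `pᵏ`-torsion over the closure is rational.
      have hQ' : ((-2 : ℤ) ^ r - 1) • Q = 0 := by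
        rw [hs, add_sub_cancel_left, mul_comm, mul_smul, ← Nat.cast_pow, natCast_zsmul,
          mem_nTorsion.1 hQ, smul_zero]
      obtain ⟨P, rfl⟩ := (mem_range_curveAMap_iff hF (algebraMap F Ω) Q).2 hQ'
      refine ⟨⟨P, AddCommGroup.mem_primaryComponent.2 ⟨k, hf ?_⟩⟩, rfl⟩
      rw [map_nsmul, map_zero]
      exact hQ
  exact ⟨(AddEquiv.ofBijective g hg).trans e⟩

theorem exists_neg_two_pow_eq_one_add {r : ℕ} (hr : r ≠ 0) :
    ∃ (k : ℕ) (u : ℤ), (-2) ^ r = 1 + p ^ k * u ∧ ¬ (p : ℤ) ∣ u := by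
  by_cases hd : (p : ℤ) ∣ (-2) ^ r - 1
  · obtain ⟨k, u, -, h⟩ := exists_neg_two_pow_eq p hr hd
    exact ⟨k, u, h⟩
  · exact ⟨0, (-2) ^ r - 1, by ring, hd⟩

/-- The group structure is also known from the valuation of `s - 1`, and orders determine the
exponent. This turns the hypothesis on `A(F)` into arithmetic of `s`. -/
theorem neg_two_pow_eq_of_primaryComponent_equiv (hp2 : Odd p) (hF : Nat.card F = 4 ^ r) {k : ℕ}
    (e : Nonempty (AddCommGroup.primaryComponent (curveA F).toAffine.Point p ≃+
      ZMod (p ^ k) × ZMod (p ^ k))) :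
    ∃ u : ℤ, (-2 : ℤ) ^ r = 1 + p ^ k * u ∧ ¬ (p : ℤ) ∣ u := by
  obtain ⟨v, u, hs, hu⟩ := exists_neg_two_pow_eq_one_add p (ne_zero_of_card_eq_four_pow hF)
  obtain ⟨e'⟩ := nonempty_primaryComponent_equiv p hp2 hF hs hu
  obtain ⟨e⟩ := e
  have h := Nat.card_congr (e.symm.trans e').toEquiv
  rw [Nat.card_prod, Nat.card_prod, Nat.card_zmod, Nat.card_zmod, ← pow_add, ← pow_add] at h
  have := Nat.pow_right_injective hp.out.two_le h
  obtain rfl : k = v := by omega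
  exact ⟨u, hs, hu⟩

/-- Over an extension of degree `p` the exponent grows by one. -/
theorem nonempty_primaryComponent_equiv_of_finrank (hp2 : Odd p) (hF : Nat.card F = 4 ^ r) {k : ℕ}
    (hk : 1 ≤ k)
    (e : Nonempty (AddCommGroup.primaryComponent (curveA F).toAffine.Point p ≃+
      ZMod (p ^ k) × ZMod (p ^ k)))
    {L : Type*} [Field L] [Algebra F L] (hL : Module.finrank F L = p) :
    Nonempty (AddCommGroup.primaryComponent (curveA L).toAffine.Point p ≃+
      ZMod (p ^ (k + 1)) × ZMod (p ^ (k + 1))) := by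
  have : Module.Finite F L := Module.finite_of_finrank_pos (hL ▸ hp.out.pos)
  have : Finite L := Module.finite_of_finite F
  have : CharP L 2 := charP_of_injective_algebraMap (algebraMap F L).injective 2
  obtain ⟨u, hs, hu⟩ := neg_two_pow_eq_of_primaryComponent_equiv p hp2 hF e
  -- Passing to `L` replaces `r` by `rp`, that is, `s` by `sᵖ`.
  obtain ⟨u', hs', hu'⟩ := pow_eq_one_add hp2 hk hs hu (m := 1) (j := 1)
    (fun h => hp.out.one_lt.ne' (Nat.dvd_one.1 h))
  rw [one_mul, pow_one, ← pow_mul] at hs'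
  refine nonempty_primaryComponent_equiv p hp2 (r := r * p) ?_ hs' hu'
  rw [Module.natCard_eq_pow_finrank (K := F), hF, hL, pow_mul]

/-- Modulo `pᵐ`, every rational point is killed by `pᵏ`. -/
theorem exists_coprime_multiplier {M : Type*} [AddCommGroup M] {s u : ℤ} {k : ℕ}
    (hs : s = 1 + p ^ k * u) (hu : ¬ (p : ℤ) ∣ u) (m : ℕ) :
    ∃ e c : ℤ, 1 - e = p ^ m * c ∧ ∀ P : M, (s - 1) • P = 0 → (p : ℤ) ^ k • e • P = 0 := by
  have hcop : IsCoprime ((p : ℤ) ^ m) u :=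
    ((Nat.prime_iff_prime_int.1 hp.out).coprime_iff_not_dvd.2 hu).pow_left
  obtain ⟨a, b, hab⟩ := hcop
  -- With `apᵐ + bu = 1`, the multiplier `e = bu` is `1` modulo `pᵐ`, and `pᵏe` is a multiple of `s
  -- - 1`.
  refine ⟨b * u, a, by linear_combination -hab, fun P hP => ?_⟩
  rw [← mul_smul]
  have : (p : ℤ) ^ k * (b * u) = b * (s - 1) := by rw [hs]; ring
  rw [this, mul_smul, hP, smul_zero]

end FiniteFields

end WeierstrassCurve

/-! ### Galois descent for points and the Kummer map -/

namespace WeierstrassCurve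

section Galois

variable {k : Type*} [Field k] (W : WeierstrassCurve k)

theorem pts_some_congr {L : Type*} [Field L] [Algebra k L] {x x' y y' : L}
    {h : (W.baseChange L).toAffine.Nonsingular x y}
    {h' : (W.baseChange L).toAffine.Nonsingular x' y'} (hx : x = x') (hy : y = y') :
    (Affine.Point.some x y h : W.Pts L) = (Affine.Point.some x' y' h' : W.Pts L) := by
  subst hx hy; rfl

theorem galSMul_ptsIncl {L : Type*} [Field L] [Algebra k L] (σ : Gal(L/k))
    (P : W.toAffine.Point) : σ • W.ptsIncl L P = W.ptsIncl L P := by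
  rcases P with _ | ⟨x, y, h⟩
  · rfl
  · exact W.pts_some_congr (σ.commutes x) (σ.commutes y)

theorem ptsIncl_injective (L : Type*) [Field L] [Algebra k L] :
    Function.Injective (W.ptsIncl L) :=
  Affine.Point.map_injective (W' := W.toAffine) (Algebra.ofId k L)

theorem exists_ptsIncl_eq {L : Type*} [Field L] [Algebra k L] {x y : k}
    (h : (W.baseChange L).toAffine.Nonsingular (algebraMap k L x) (algebraMap k L y)) :
    ∃ P, W.ptsIncl L P = (Affine.Point.some _ _ h : W.Pts L) :=
  ⟨.some x y ((W.toAffine.map_nonsingular (algebraMap k L).injective x y).1 h), rfl⟩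

theorem mem_range_ptsIncl_of_fixed {L : Type*} [Field L] [Algebra k L] [IsGalois k L]
    (P : W.Pts L) (hP : ∀ σ : Gal(L/k), σ • P = P) : ∃ P₀, W.ptsIncl L P₀ = P := by
  rcases P with _ | ⟨x, y, h⟩
  · exact ⟨0, rfl⟩
  · obtain ⟨x, rfl⟩ := (InfiniteGalois.mem_range_algebraMap_iff_fixed (k := k) x).2
      fun σ => (Affine.Point.some.inj (hP σ)).1
    obtain ⟨y, rfl⟩ := (InfiniteGalois.mem_range_algebraMap_iff_fixed (k := k) y).2
      fun σ => (Affine.Point.some.inj (hP σ)).2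
    exact W.exists_ptsIncl_eq h

/-- The coordinates generate a finite extension, whose fixing subgroup is open and stabilises `P`.
-/
theorem isLocallyConstant_galSMul {L : Type*} [Field L] [Algebra k L] [Algebra.IsAlgebraic k L]
    (P : W.Pts L) : IsLocallyConstant fun σ : Gal(L/k) => σ • P := by
  rcases P with _ | ⟨x, y, h⟩
  · exact IsLocallyConstant.const (0 : W.Pts L)
  · rw [IsLocallyConstant.iff_exists_open]
    intro σ
    let E := IntermediateField.adjoin k ({x, y} : Set L)
    have : FiniteDimensional k E := IntermediateField.finiteDimensional_adjoin
      fun x _ => Algebra.IsIntegral.isIntegral x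
    refine ⟨(fun τ => σ⁻¹ * τ) ⁻¹' (E.fixingSubgroup : Set Gal(L/k)),
      E.fixingSubgroup_isOpen.preimage (continuous_const_mul σ⁻¹), ?_, ?_⟩
    · simp [E.fixingSubgroup.one_mem]
    · intro τ hτ
      have hz : ∀ z ∈ ({x, y} : Set L), τ z = σ z := by
        intro z hz
        have := (IntermediateField.mem_fixingSubgroup_iff E (σ⁻¹ * τ)).1 hτ z
          (IntermediateField.subset_adjoin k _ hz)
        have h2 := congrArg σ this
        change σ (σ⁻¹ (τ z)) = σ z at h2
        rwa [show ∀ w, σ (σ⁻¹ w) = w from σ.apply_symm_apply] at h2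
      exact W.pts_some_congr (hz x (by simp)) (hz y (by simp))

/-- The cocycle `σ ↦ σ Q - Q` of a point `Q` rational modulo `n`-torsion. -/
noncomputable def kummerCocycle {L : Type*} [Field L] [Algebra k L] [Algebra.IsAlgebraic k L]
    (n : ℕ) (Q : W.Pts L) (hQ : ∀ σ : Gal(L/k), n • (σ • Q - Q) = 0) :
    GalCoh.Z1 Gal(L/k) (W.Tors L n) :=
  ⟨fun σ => ⟨σ • Q - Q, (W.mem_tors _).2 (hQ σ)⟩, by
    refine (IsLocallyConstant.iff_exists_open _).2 fun σ => ?_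
    obtain ⟨U, hU, hσ, h⟩ := (W.isLocallyConstant_galSMul Q).exists_open σ
    exact ⟨U, hU, hσ, fun τ hτ => Subtype.ext (congrArg (· - Q) (h τ hτ))⟩,
    fun σ τ => Subtype.ext (by
      change (σ * τ) • Q - Q = σ • Q - Q + σ • (τ • Q - Q)
      rw [mul_smul, smul_sub]; abel)⟩

section Kummer

variable {L : Type*} [Field L] [Algebra k L] [Algebra.IsAlgebraic k L] {n : ℕ}

omit [Algebra.IsAlgebraic k L] in
theorem kummerCocycle_hyp {P : W.toAffine.Point} {Q : W.Pts L} (h : n • Q = W.ptsIncl L P)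
    (σ : Gal(L/k)) : n • (σ • Q - Q) = 0 := by
  rw [smul_sub, smul_comm, h, galSMul_ptsIncl, sub_self]

/-- Rational points contribute nothing to `σQ - Q`, so the two cocycles differ by the coboundary of
the torsion point `Q' - Q - R`. With `R = 0` this is independence of the chosen `n`-th part. -/
theorem mk_kummerCocycle_eq {Q Q' : W.Pts L} (hQ : ∀ σ : Gal(L/k), n • (σ • Q - Q) = 0)
    (hQ' : ∀ σ : Gal(L/k), n • (σ • Q' - Q') = 0) (R : W.toAffine.Point)
    (h : n • (Q' - Q - W.ptsIncl L R) = 0) :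
    (QuotientAddGroup.mk (W.kummerCocycle n Q hQ) : GalCoh.H1 Gal(L/k) (W.Tors L n)) =
      QuotientAddGroup.mk (W.kummerCocycle n Q' hQ') := by
  rw [QuotientAddGroup.eq]
  refine ⟨⟨_, (W.mem_tors _).2 h⟩, fun σ => Subtype.ext ?_⟩
  change -(σ • Q - Q) + (σ • Q' - Q') =
    σ • (Q' - Q - W.ptsIncl L R) - (Q' - Q - W.ptsIncl L R)
  rw [smul_sub, smul_sub, galSMul_ptsIncl]
  abel

/-- The connecting homomorphism `W(k) → H¹(k, W[n])`. -/
noncomputable def kummerHom (hdiv : ∀ P : W.Pts L, ∃ Q : W.Pts L, n • Q = P) :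
    W.toAffine.Point →+ GalCoh.H1 Gal(L/k) (W.Tors L n) where
  toFun P := QuotientAddGroup.mk (W.kummerCocycle n _
    (W.kummerCocycle_hyp (hdiv (W.ptsIncl L P)).choose_spec))
  map_zero' := by
    have h0 : ∀ σ : Gal(L/k), n • (σ • (0 : W.Pts L) - 0) = 0 := fun σ => by simp
    have hQ := (hdiv (W.ptsIncl L 0)).choose_spec
    set Q := (hdiv (W.ptsIncl L 0)).choose
    rw [W.mk_kummerCocycle_eq _ h0 0 (by
      rw [zero_sub, smul_sub, smul_neg, hQ, map_zero, smul_zero, sub_zero, neg_zero])]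
    have : W.kummerCocycle n (0 : W.Pts L) h0 = 0 := by
      refine Subtype.ext (funext fun σ => Subtype.ext ?_)
      change σ • (0 : W.Pts L) - 0 = 0
      simp
    rw [this]; rfl
  map_add' P P' := by
    have h₁ := (hdiv (W.ptsIncl L P)).choose_spec
    have h₂ := (hdiv (W.ptsIncl L P')).choose_spec
    have h₃ := (hdiv (W.ptsIncl L (P + P'))).choose_spec
    set Q₁ := (hdiv (W.ptsIncl L P)).choose
    set Q₂ := (hdiv (W.ptsIncl L P')).choose
    have h₄ : n • (Q₁ + Q₂) = W.ptsIncl L (P + P') := by rw [smul_add, h₁, h₂, map_add]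
    rw [W.mk_kummerCocycle_eq _ (W.kummerCocycle_hyp h₄) 0 (by
      rw [map_zero, sub_zero, smul_sub, h₃, h₄, sub_self]), ← QuotientAddGroup.mk_add]
    congr 1
    refine Subtype.ext (funext fun σ => Subtype.ext ?_)
    change σ • (Q₁ + Q₂) - (Q₁ + Q₂) = σ • Q₁ - Q₁ + (σ • Q₂ - Q₂)
    rw [smul_add]; abel

theorem kummerHom_apply (hdiv : ∀ P : W.Pts L, ∃ Q : W.Pts L, n • Q = P) (P : W.toAffine.Point)
    (Q : W.Pts L) (hQ : n • Q = W.ptsIncl L P) :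
    W.kummerHom hdiv P = QuotientAddGroup.mk (W.kummerCocycle n Q (W.kummerCocycle_hyp hQ)) :=
  W.mk_kummerCocycle_eq _ _ 0 (by
    rw [map_zero, sub_zero, smul_sub, hQ, (hdiv (W.ptsIncl L P)).choose_spec, sub_self])

theorem kummerHom_nsmul (hdiv : ∀ P : W.Pts L, ∃ Q : W.Pts L, n • Q = P) (P : W.toAffine.Point) :
    W.kummerHom hdiv (n • P) = 0 := by
  rw [W.kummerHom_apply hdiv (n • P) (W.ptsIncl L P) (map_nsmul _ _ _).symm]
  have : W.kummerCocycle n (W.ptsIncl L P) (W.kummerCocycle_hyp (map_nsmul _ _ _).symm) = 0 := by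
    refine Subtype.ext (funext fun σ => Subtype.ext ?_)
    change σ • W.ptsIncl L P - W.ptsIncl L P = 0
    rw [galSMul_ptsIncl, sub_self]
  rw [this]; rfl

end Kummer

/-- The Kummer map. -/
noncomputable def kummerMap {n : ℕ}
    (hdiv : ∀ P : W.Pts (AlgebraicClosure k), ∃ Q : W.Pts (AlgebraicClosure k), n • Q = P) :
    W.PtsMod n →+ W.H1Abs n :=
  QuotientAddGroup.lift _ (W.kummerHom hdiv) (by
    rintro _ ⟨P, rfl⟩
    exact W.kummerHom_nsmul hdiv P)

theorem isKummerMap_kummerMap {n : ℕ}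
    (hdiv : ∀ P : W.Pts (AlgebraicClosure k), ∃ Q : W.Pts (AlgebraicClosure k), n • Q = P) :
    W.IsKummerMap n (W.kummerMap hdiv) := fun P =>
  ⟨hdiv _, fun Q hQ => ⟨W.kummerCocycle n Q (W.kummerCocycle_hyp hQ), fun _ => rfl,
    W.kummerHom_apply hdiv P Q hQ⟩⟩

end Galois

end WeierstrassCurve

/-! ### Consequences of a scalar Galois action on `p`-power torsion -/

namespace WeierstrassCurve

section ScalarAction

variable {M : Type*} [AddCommGroup M] {p : ℕ}

theorem zsmul_eq_zsmul_of_dvd_sub {n : ℕ} {a b : ℤ} (h : (p : ℤ) ^ n ∣ a - b) {P : M}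
    (hP : p ^ n • P = 0) : a • P = b • P := by
  obtain ⟨c, hc⟩ := h
  rw [← sub_eq_zero, ← sub_smul, hc, mul_comm, mul_smul, ← Nat.cast_pow, natCast_zsmul, hP,
    smul_zero]

theorem exists_pow_nsmul_eq (hdiv : ∀ P : M, ∃ Q : M, p • Q = P) (n : ℕ) (P : M) :
    ∃ Q : M, p ^ n • Q = P := by
  induction n with
  | zero => exact ⟨P, by simp⟩
  | succ n ih =>
    obtain ⟨Q, hQ⟩ := ih
    obtain ⟨R, hR⟩ := hdiv Q
    exact ⟨R, by rw [pow_succ, mul_nsmul', hR, hQ]⟩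

theorem smul_eq_pow_zsmul {G : Type*} [Group G] [DistribMulAction G M] {σ : G} {s : ℤ}
    {P : M} (h : σ • P = s • P) (j : ℕ) : σ ^ j • P = s ^ j • P := by
  induction j with
  | zero => simp
  | succ j ih => rw [pow_succ, mul_smul, h, smul_comm, ih, ← mul_smul, pow_succ']

end ScalarAction

variable {k : Type*} [Field k] (W : WeierstrassCurve k)
  (p : ℕ) [hp : Fact p.Prime] {s u : ℤ} {a : ℕ}

section TorsionField

theorem smul_eq_self_of_galRes_eq_one {N : ℕ} {σ : Gal(AlgebraicClosure k/k)}
    (hσ : W.galRes N σ = 1) {P : W.Pts (AlgebraicClosure k)} (hP : N • P = 0) : σ • P = P := by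
  obtain ⟨Q, hQ⟩ := (W.torsIncl_bijective (dvd_refl N)).2 ⟨P, (W.mem_tors P).2 hP⟩
  have h := W.torsIncl_galRes N N σ Q
  rw [hσ, one_smul, hQ] at h
  exact (congrArg Subtype.val h).symm

/-- An automorphism trivial on `W[N]` lies in the kernel defining the torsion field, hence fixes
that field; with the preceding lemma, the Galois group of the torsion field acts faithfully on
`W[N]`. -/
theorem galRes_eq_one_of_smul_eq_self {N : ℕ} {σ : Gal(AlgebraicClosure k/k)}
    (hσ : ∀ P : W.Pts (AlgebraicClosure k), N • P = 0 → σ • P = P) : W.galRes N σ = 1 := by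
  have hker : σ ∈ (DistribMulAction.toAddAut Gal(AlgebraicClosure k/k)
      (W.Tors (AlgebraicClosure k) N)).ker := by
    rw [MonoidHom.mem_ker]
    refine AddEquiv.ext fun P => Subtype.ext ?_
    exact hσ P.1 ((W.mem_tors P.1).1 P.2)
  refine AlgEquiv.ext fun x => Subtype.ext ?_
  have h1 : ((W.galRes N σ x : W.torsionField N) : AlgebraicClosure k) =
      σ (x : AlgebraicClosure k) := AlgEquiv.restrictNormal_commutes σ _ x
  rw [h1]
  exact x.2 ⟨σ, hker⟩

end TorsionField

variable (hp2 : Odd p) (ha : 1 ≤ a) (hs : s = 1 + p ^ a * u) (hu : ¬ (p : ℤ) ∣ u)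
  (hdiv : ∀ P : W.Pts (AlgebraicClosure k), ∃ Q : W.Pts (AlgebraicClosure k), p • Q = P)
  (hscal : ∀ (N : ℕ) (σ : Gal(AlgebraicClosure k/k)), ∃ i : ℕ,
    ∀ P : W.Pts (AlgebraicClosure k), p ^ N • P = 0 → σ • P = (s ^ i) • P)
  (htor : ∃ P : W.Pts (AlgebraicClosure k), p ^ (a + 1) • P = 0 ∧
    ∃ σ : Gal(AlgebraicClosure k/k), σ • P ≠ P)
  (hmod : ∀ (m : ℕ) (P : W.toAffine.Point), ∃ T R : W.toAffine.Point,
    P = T + p ^ m • R ∧ p ^ a • T = 0)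

-- An automorphism that moves some `p^(a+1)`-torsion point acts as `s^i₀` with `p ∤ i₀`, for
-- otherwise `s^i₀ ≡ 1` modulo `p^(a+1)`. Such a power is again a topological generator of `1 +
-- pᵃℤ_p`, so it reaches the action of every other automorphism.
include hp2 ha hs hu hscal htor in
theorem exists_topological_generator (m : ℕ) :
    ∃ (σ₀ : Gal(AlgebraicClosure k/k)) (s' u' : ℤ), s' = 1 + p ^ a * u' ∧ ¬ (p : ℤ) ∣ u' ∧
      (∀ P : W.Pts (AlgebraicClosure k), p ^ (a + m) • P = 0 → σ₀ • P = s' • P) ∧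
      ∀ σ : Gal(AlgebraicClosure k/k), ∃ j : ℕ, ∀ P : W.Pts (AlgebraicClosure k),
        p ^ (a + m) • P = 0 → σ • P = (σ₀ ^ j) • P := by
  obtain ⟨P₀, hP₀, σ₀, hσ₀⟩ := htor
  have hup : ∀ {b c : ℕ} {P : W.Pts (AlgebraicClosure k)}, b ≤ c → p ^ b • P = 0 →
      p ^ c • P = 0 := fun hbc h => by
    obtain ⟨d, rfl⟩ := Nat.exists_eq_add_of_le hbc
    rw [pow_add, mul_comm, mul_nsmul', h, smul_zero]
  -- Level `a + m + 1` contains both the `p^(a+m)`-torsion and, even for `m = 0`, the point `P₀`.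
  obtain ⟨i₀, hi₀⟩ := hscal (a + m + 1) σ₀
  have hpi : ¬ p ∣ i₀ := by
    intro hd
    refine hσ₀ ?_
    rw [hi₀ P₀ (hup (by omega) hP₀), zsmul_eq_zsmul_of_dvd_sub (b := 1)
      ((pow_dvd_pow_sub_one_iff hp2 ha hs hu 1 i₀).2 (by rwa [pow_one])) hP₀, one_smul]
  obtain ⟨u', hs', hu'⟩ := pow_eq_one_add hp2 ha hs hu (m := 0) hpi
  rw [pow_zero, mul_one, add_zero] at hs'
  refine ⟨σ₀, s ^ i₀, u', hs', hu', fun P hP => hi₀ P (hup (by omega) hP), fun σ => ?_⟩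
  obtain ⟨i, hi⟩ := hscal (a + m) σ
  obtain ⟨j, hj⟩ := exists_pow_pow_congr hp2 ha hs hu hpi m i
  refine ⟨j, fun P hP => ?_⟩
  rw [hi P hP, smul_eq_pow_zsmul (hi₀ P (hup (by omega) hP)), zsmul_eq_zsmul_of_dvd_sub hj hP]

-- The `pᵃ`-torsion is fixed by Galois, so a moved `p^(a+1)`-torsion point `P` has `pᵃP` of order
-- `p`; dividing this by `p^(a+m-1)` gives the required order.
include ha hs hscal hdiv htor in
theorem exists_addOrderOf_eq (m : ℕ) :
    ∃ R : W.Pts (AlgebraicClosure k), addOrderOf R = p ^ (a + m) := by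
  obtain ⟨P, hP, σ, hσ⟩ := htor
  have hne : p ^ a • P ≠ 0 := by
    intro h
    refine hσ ?_
    obtain ⟨i, hi⟩ := hscal a σ
    rw [hi P h]
    have hd : (p : ℤ) ^ a ∣ s ^ i - 1 := by
      have := sub_dvd_pow_sub_pow s 1 i
      rw [one_pow] at this
      exact (Dvd.intro u (by rw [hs]; ring)).trans this
    rw [zsmul_eq_zsmul_of_dvd_sub hd h, one_smul]
  obtain ⟨b, hb⟩ : ∃ b, a + m = b + 1 := ⟨a + m - 1, by omega⟩
  obtain ⟨R, hR⟩ := exists_pow_nsmul_eq hdiv b (p ^ a • P)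
  refine ⟨R, ?_⟩
  rw [hb]
  refine addOrderOf_eq_prime_pow (by rwa [hR]) ?_
  rw [pow_succ', mul_nsmul', hR, ← mul_nsmul', ← pow_succ']
  exact hP

-- Tested on a point of order `p^(a+m)`, triviality of `σ₀ʲ` means `s'ʲ ≡ 1` modulo `p^(a+m)`, which
-- by lifting the exponent is `pᵐ ∣ j`.
include hp2 ha hs hu hdiv hscal htor in
theorem exists_generator_gal_torsionField (m : ℕ) :
    ∃ (σ₀ : Gal(AlgebraicClosure k/k)) (s' u' : ℤ), s' = 1 + p ^ a * u' ∧ ¬ (p : ℤ) ∣ u' ∧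
      (∀ P : W.Pts (AlgebraicClosure k), p ^ (a + m) • P = 0 → σ₀ • P = s' • P) ∧
      (∀ g : Gal(W.torsionField (p ^ (a + m))/k), ∃ j : ℕ,
        g = W.galRes (p ^ (a + m)) σ₀ ^ j) ∧
      orderOf (W.galRes (p ^ (a + m)) σ₀) = p ^ m := by
  obtain ⟨σ₀, s', u', hs', hu', hσ₀, hgen⟩ :=
    W.exists_topological_generator p hp2 ha hs hu hscal htor m
  obtain ⟨R, hR⟩ := W.exists_addOrderOf_eq p ha hs hdiv hscal htor m
  refine ⟨σ₀, s', u', hs', hu', hσ₀, fun g => ?_, ?_⟩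
  · obtain ⟨σ, rfl⟩ := W.galRes_surjective (p ^ (a + m)) g
    obtain ⟨j, hj⟩ := hgen σ
    refine ⟨j, ?_⟩
    rw [← map_pow, ← mul_inv_eq_one, ← map_inv, ← map_mul]
    refine W.galRes_eq_one_of_smul_eq_self fun P hP => ?_
    rw [mul_smul, hj _ (by rw [smul_comm, hP, smul_zero]), smul_inv_smul]
  · have hRN : p ^ (a + m) • R = 0 := hR ▸ addOrderOf_nsmul_eq_zero R
    have key : ∀ j : ℕ, W.galRes (p ^ (a + m)) σ₀ ^ j = 1 ↔ p ^ m ∣ j := by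
      intro j
      rw [← map_pow, ← pow_dvd_pow_sub_one_iff hp2 ha hs' hu' m j]
      constructor
      · intro h
        have h1 := W.smul_eq_self_of_galRes_eq_one h hRN
        rw [smul_eq_pow_zsmul (hσ₀ R hRN), ← sub_eq_zero] at h1
        have h2 : (s' ^ j - 1) • R = 0 := by rw [sub_smul, one_smul]; exact h1
        have h3 := addOrderOf_dvd_iff_zsmul_eq_zero.2 h2
        rw [hR] at h3
        exact_mod_cast h3
      · intro h
        refine W.galRes_eq_one_of_smul_eq_self fun P hP => ?_
        rw [smul_eq_pow_zsmul (hσ₀ P hP), zsmul_eq_zsmul_of_dvd_sub h hP, one_smul]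
    refine Nat.dvd_antisymm (orderOf_dvd_of_pow_eq_one ((key _).2 dvd_rfl))
      ((key _).1 (pow_orderOf_eq_one _))

include hp2 ha hs hu hdiv hscal htor in
/-- The Galois group of the field cut out by the `p^(a+m)`-torsion is cyclic of order `pᵐ`. -/
theorem nonempty_gal_torsionField_mulEquiv (m : ℕ) :
    Nonempty (Gal(W.torsionField (p ^ (a + m))/k) ≃* Multiplicative (ZMod (p ^ m))) := by
  obtain ⟨σ₀, -, -, -, -, -, hgen, hord⟩ :=
    W.exists_generator_gal_torsionField p hp2 ha hs hu hdiv hscal htor m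
  have hg : ∀ x, x ∈ Subgroup.zpowers (W.galRes (p ^ (a + m)) σ₀) := fun x => by
    obtain ⟨j, rfl⟩ := hgen x
    exact Subgroup.npow_mem_zpowers _ j
  have : IsCyclic Gal(W.torsionField (p ^ (a + m))/k) := ⟨_, hg⟩
  exact ⟨mulEquivOfCyclicCardEq (by
    rw [← orderOf_eq_card_of_forall_mem_zpowers hg, hord,
      Nat.card_congr Multiplicative.toAdd, Nat.card_zmod])⟩

variable [PerfectField k]

include hp2 ha hs hu hdiv hscal htor in
theorem finrank_torsionField (m : ℕ) :
    Module.finrank k (W.torsionField (p ^ (a + m))) = p ^ m := by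
  obtain ⟨e⟩ := W.nonempty_gal_torsionField_mulEquiv p hp2 ha hs hu hdiv hscal htor m
  have : IsGalois k (W.torsionField (p ^ (a + m))) := {}
  rw [← IsGaloisGroup.card_eq_finrank Gal(W.torsionField (p ^ (a + m))/k), Nat.card_congr e.toEquiv,
    Nat.card_congr Multiplicative.toAdd, Nat.card_zmod]

omit [PerfectField k] in
/-- The Kummer class of a point with a torsion `n`-th part is inflated from the torsion field. -/
theorem mk_kummerCocycle_mem_range_inflation {N n : ℕ} {Q : W.Pts (AlgebraicClosure k)}
    (hQN : N • Q = 0) (hQ : ∀ σ : Gal(AlgebraicClosure k/k), n • (σ • Q - Q) = 0) :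
    (QuotientAddGroup.mk (W.kummerCocycle n Q hQ) : W.H1Abs n) ∈ (W.inflation N n).range := by
  obtain ⟨Q', hQ'⟩ := (W.torsIncl_bijective (dvd_refl N)).2 ⟨Q, (W.mem_tors Q).2 hQN⟩
  have hval : W.ptsMap (W.torsionField N).val Q'.1 = Q := congrArg Subtype.val hQ'
  have hact : ∀ σ : Gal(AlgebraicClosure k/k),
      W.ptsMap (W.torsionField N).val (W.galRes N σ • Q'.1) = σ • Q := fun σ => by
    have := congrArg Subtype.val (W.torsIncl_galRes N N σ Q')
    rw [hQ'] at this
    exact this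
  have hc : ∀ g : Gal(W.torsionField N/k), n • (g • Q'.1 - Q'.1) = 0 := fun g => by
    obtain ⟨σ, rfl⟩ := W.galRes_surjective N g
    refine W.ptsMap_injective (W.torsionField N).val ?_
    rw [map_nsmul, map_sub, hact, hval, hQ σ, map_zero]
  refine ⟨QuotientAddGroup.mk (W.kummerCocycle n Q'.1 hc), ?_⟩
  refine congrArg QuotientAddGroup.mk (Subtype.ext (funext fun σ => Subtype.ext ?_))
  change W.ptsMap (W.torsionField N).val (W.galRes N σ • Q'.1 - Q'.1) = σ • Q - Q
  rw [map_sub, hact, hval]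

-- On the powers of a generator a cocycle is determined by its value there.
omit [PerfectField k] in
theorem cocycle_pow_eq {G M : Type*} [Group G] [TopologicalSpace G] [AddCommGroup M]
    [DistribMulAction G M] (c c' : GalCoh.Z1 G M) {g : G} (h : c.1 g = c'.1 g) (j : ℕ) :
    c.1 (g ^ j) = c'.1 (g ^ j) := by
  induction j with
  | zero =>
    have h1 : ∀ c : GalCoh.Z1 G M, c.1 1 = 0 := fun c => by
      have := c.2.2 1 1
      rw [mul_one, one_smul] at this
      simpa using this
    rw [pow_zero, h1, h1]
  | succ j ih => rw [pow_succ, c.2.2, c'.2.2, ih, h]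

include hp2 ha hs hu hdiv hscal htor hmod in
/-- The image of the Kummer map is the whole image of inflation. -/
theorem kummerStable_of_scalar_action (m : ℕ) :
    W.KummerStable (pow_dvd_pow p (Nat.le_add_left m a)) := by
  have hdivm := exists_pow_nsmul_eq hdiv m
  obtain ⟨σ₀, s', u', hs', hu', hσ₀, hgen, -⟩ :=
    W.exists_generator_gal_torsionField p hp2 ha hs hu hdiv hscal htor m
  -- `s ≡ 1` modulo `pᵃ`, so Galois fixes the `pᵃ`-torsion pointwise.
  have hfix : ∀ P : W.Pts (AlgebraicClosure k), p ^ a • P = 0 →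
      ∀ σ : Gal(AlgebraicClosure k/k), σ • P = P := by
    intro P hP σ
    obtain ⟨i, hi⟩ := hscal a σ
    have hd : (p : ℤ) ^ a ∣ s ^ i - 1 := by
      have := sub_dvd_pow_sub_pow s 1 i
      rw [one_pow] at this
      exact (Dvd.intro u (by rw [hs]; ring)).trans this
    rw [hi P hP, zsmul_eq_zsmul_of_dvd_sub hd hP, one_smul]
  refine ⟨W.kummerMap hdivm, W.isKummerMap_kummerMap hdivm, ?_, ?_⟩
  · rintro _ ⟨⟨P⟩, rfl⟩
    -- Only `T` matters for the Kummer class, and a `pᵐ`-th part of `T` is `p^(a+m)`-torsion.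
    obtain ⟨T, R, rfl, hT⟩ := hmod m P
    obtain ⟨Q, hQ⟩ := hdivm (W.ptsIncl (AlgebraicClosure k) T)
    change W.kummerHom hdivm (T + p ^ m • R) ∈ _
    rw [map_add, W.kummerHom_nsmul, add_zero, W.kummerHom_apply hdivm T Q hQ]
    refine W.mk_kummerCocycle_mem_range_inflation ?_ _
    rw [pow_add, mul_nsmul', hQ, ← map_nsmul, hT, map_zero]
  · suffices h : (W.kummerMap hdivm).range.comap (W.inflation (p ^ (a + m)) (p ^ m)) = ⊤ by
      intro φ
      rw [h]
      exact le_top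
    rw [eq_top_iff]
    rintro ⟨c⟩ -
    let c' : GalCoh.Z1 Gal(AlgebraicClosure k/k) (W.Tors (AlgebraicClosure k) (p ^ m)) :=
      GalCoh.mapZ1 (W.galRes (p ^ (a + m))) (W.galRes_continuous _) (W.torsIncl _ _)
        (W.torsIncl_galRes _ _) c
    obtain ⟨Q₀, hQ₀⟩ := exists_pow_nsmul_eq hdiv a (c'.1 σ₀).1
    have hcm : p ^ m • (c'.1 σ₀).1 = 0 := (W.mem_tors _).1 (c'.1 σ₀).2
    have hQ₀N : p ^ (a + m) • Q₀ = 0 := by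
      rw [pow_add, mul_comm, mul_nsmul', hQ₀, hcm]
    -- `b` inverts `u'` modulo `p^(a+m)`, so `(s' - 1)(bQ₀) = pᵃu'bQ₀ = pᵃQ₀`, the value of the
    -- cocycle at `σ₀`.
    obtain ⟨b, d, hbd⟩ : IsCoprime u' ((p : ℤ) ^ (a + m)) :=
      ((Nat.prime_iff_prime_int.1 hp.out).coprime_iff_not_dvd.2 hu').symm.pow_right
    have hQ : σ₀ • (b • Q₀) - b • Q₀ = (c'.1 σ₀).1 := by
      rw [smul_comm, hσ₀ Q₀ hQ₀N, hs', ← hQ₀, ← mul_smul, ← sub_smul, ← natCast_zsmul,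
        Nat.cast_pow]
      refine zsmul_eq_zsmul_of_dvd_sub (n := a + m) ⟨-d * p ^ a, ?_⟩ hQ₀N
      linear_combination (p : ℤ) ^ a * hbd
    have hQN : p ^ (a + m) • b • Q₀ = 0 := by rw [smul_comm, hQ₀N, smul_zero]
    -- `pᵐbQ₀` is killed by `pᵃ`, hence rational; its Kummer class is the candidate preimage.
    have hfixed := hfix (p ^ m • b • Q₀) (by rw [← mul_nsmul', ← pow_add]; exact hQN)
    obtain ⟨P, hP⟩ := W.mem_range_ptsIncl_of_fixed _ hfixed
    refine ⟨QuotientAddGroup.mk P, ?_⟩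
    change W.kummerHom hdivm P = QuotientAddGroup.mk c'
    rw [W.kummerHom_apply hdivm P (b • Q₀) hP.symm]
    refine congrArg QuotientAddGroup.mk (Subtype.ext (funext fun σ => ?_))
    set c'' := W.kummerCocycle (p ^ m) (b • Q₀) (W.kummerCocycle_hyp hP.symm)
    -- Both cocycles depend only on the restriction to the torsion field, so it suffices to compare
    -- them on powers of `σ₀`, where they agree at the generator.
    obtain ⟨j, hj⟩ := hgen (W.galRes _ σ)
    have e1 : c'.1 σ = c'.1 (σ₀ ^ j) := by
      change W.torsIncl _ _ (c.1 (W.galRes _ σ)) = W.torsIncl _ _ (c.1 (W.galRes _ (σ₀ ^ j)))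
      rw [hj, map_pow]
    have e2 : c''.1 σ = c''.1 (σ₀ ^ j) := by
      refine Subtype.ext ?_
      change σ • (b • Q₀) - b • Q₀ = σ₀ ^ j • (b • Q₀) - b • Q₀
      congr 1
      have h1 : W.galRes (p ^ (a + m)) ((σ₀ ^ j)⁻¹ * σ) = 1 := by
        rw [map_mul, map_inv, map_pow, hj, inv_mul_cancel]
      have h2 := W.smul_eq_self_of_galRes_eq_one h1 hQN
      rwa [mul_smul, inv_smul_eq_iff] at h2
    rw [e1, e2]
    exact cocycle_pow_eq c'' c' (Subtype.ext hQ) j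

end WeierstrassCurve

/-! ### The finite field case -/

namespace WeierstrassCurve

section FrobeniusScalar

variable (Ω : Type*) [Field Ω] [IsAlgClosed Ω] [CharP Ω 2] (p : ℕ) [hp : Fact p.Prime]
  (hp2 : Odd p)

-- If `s - 1` killed all `p^(a+1)`-torsion, then so would `pᵃ`, a combination of `s - 1` and
-- `p^(a+1)`; the orders `p^(2a)` and `p^(2a+2)` forbid this.
include hp2 in
theorem exists_mem_nTorsion_sub_one_zsmul_ne_zero {s u : ℤ} {a : ℕ} (hs : s = 1 + p ^ a * u)
    (hu : ¬ (p : ℤ) ∣ u) :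
    ∃ P : (curveA Ω).toAffine.Point, p ^ (a + 1) • P = 0 ∧ (s - 1) • P ≠ 0 := by
  obtain ⟨v, hv⟩ := exists_curveA_card_nTorsion_pow Ω p hp2
  by_contra! hcon
  have hle : nTorsion (curveA Ω).toAffine.Point (p ^ (a + 1)) ≤
      nTorsion (curveA Ω).toAffine.Point (p ^ a) := by
    intro P hP
    have h1 := hcon P hP
    obtain ⟨b, d, hbd⟩ := ((Nat.prime_iff_prime_int.1 hp.out).coprime_iff_not_dvd.2 hu).symm
    have h2 : (p : ℤ) ^ (a + 1) • P = 0 := by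
      rw [← Nat.cast_pow, natCast_zsmul]; exact hP
    have : (p : ℤ) ^ a = b * (s - 1) + d * (p : ℤ) ^ (a + 1) := by
      rw [hs]; linear_combination -(p : ℤ) ^ a * hbd
    rw [mem_nTorsion, ← natCast_zsmul, Nat.cast_pow, this, add_smul, mul_smul, mul_smul, h1, h2]
    simp
  have := finite_nTorsion_pow hv a
  have hc := Nat.card_le_card_of_injective _ (AddSubgroup.inclusion_injective hle)
  rw [card_nTorsion_pow hv, card_nTorsion_pow hv] at hc
  have := Nat.pow_lt_pow_right hp.out.one_lt (show 2 * a < 2 * (a + 1) by omega)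
  omega

include hp2 in
/-- Automorphisms over the field with `4ʳ` elements act on the `p`-power torsion through powers
of `(-2)ʳ`. -/
theorem exists_curveAMap_eq_pow_zsmul {F : Type*} [Field F] [Finite F] [Algebra F Ω]
    [Algebra.IsAlgebraic F Ω] {r : ℕ} (hF : Nat.card F = 4 ^ r) (N : ℕ) (σ : Gal(Ω/F)) :
    ∃ i : ℕ, ∀ P : (curveA Ω).toAffine.Point, p ^ N • P = 0 →
      curveAMap (σ : Ω →+* Ω) P = (((-2 : ℤ) ^ r) ^ i) • P := by
  obtain ⟨v, hv⟩ := exists_curveA_card_nTorsion_pow Ω p hp2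
  have hfin : Finite (nTorsion (curveA Ω).toAffine.Point (p ^ N)) := finite_nTorsion_pow hv N
  -- Coordinates of the finitely many torsion points; the value `0` at infinity is a harmless
  -- filler. A single exponent of Frobenius then serves for all of them.
  let X : (curveA Ω).toAffine.Point → Ω := fun P => match P with
    | .zero => 0
    | .some x _ _ => x
  let Y : (curveA Ω).toAffine.Point → Ω := fun P => match P with
    | .zero => 0
    | .some _ y _ => y
  let T : Set (curveA Ω).toAffine.Point := nTorsion (curveA Ω).toAffine.Point (p ^ N)
  have hT : T.Finite := Set.toFinite T
  have : Finite ↑(X '' T ∪ Y '' T) := ((hT.image X).union (hT.image Y)).to_subtype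
  obtain ⟨i, hi⟩ := exists_algEquiv_eq_pow (F := F) (X '' T ∪ Y '' T) σ
  refine ⟨i, fun P hP => ?_⟩
  rcases P with _ | ⟨x, y, h⟩
  · exact (map_zero _).trans (smul_zero _).symm
  · obtain ⟨h', e⟩ := curveAMap_some (σ : Ω →+* Ω) h
    obtain ⟨h'', e'⟩ := curveA_neg_two_pow_zsmul (r * i) h
    rw [e, ← pow_mul, e', Affine.Point.some.injEq, pow_mul, ← hF]
    exact ⟨hi x (Or.inl ⟨_, hP, rfl⟩), hi y (Or.inr ⟨_, hP, rfl⟩)⟩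

end FrobeniusScalar

section FiniteField

variable (p : ℕ) [hp : Fact p.Prime] (hp2 : Odd p) {F : Type*} [Field F] [Finite F] [CharP F 2]
  {r : ℕ} (hF : Nat.card F = 4 ^ r) {a : ℕ} (ha : 1 ≤ a)
  (e : Nonempty (AddCommGroup.primaryComponent (curveA F).toAffine.Point p ≃+
    ZMod (p ^ a) × ZMod (p ^ a)))

include hp2 hF ha e in
theorem curveA_torsionField_and_kummerStable (m : ℕ) :
    Module.finrank F ((curveA F).torsionField (p ^ (a + m))) = p ^ m ∧
    Nonempty (Gal((curveA F).torsionField (p ^ (a + m))/F) ≃* Multiplicative (ZMod (p ^ m))) ∧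
    (curveA F).KummerStable (pow_dvd_pow p (Nat.le_add_left m a)) := by
  let Ω := AlgebraicClosure F
  have : CharP Ω 2 := charP_of_injective_algebraMap (algebraMap F Ω).injective 2
  obtain ⟨u, hs, hu⟩ := neg_two_pow_eq_of_primaryComponent_equiv p hp2 hF e
  let f : (curveA F).Pts Ω ≃+ (curveA Ω).toAffine.Point := pointCongr (curveA_map (algebraMap F Ω))
  have hf : ∀ (σ : Gal(Ω/F)) (P : (curveA F).Pts Ω), f (σ • P) = curveAMap (σ : Ω →+* Ω) (f P) := by
    intro σ P
    rcases P with _ | ⟨x, y, h⟩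
    · change f 0 = curveAMap (σ : Ω →+* Ω) (f 0)
      rw [map_zero, map_zero]
    · have h1 : f (Affine.Point.some x y h) = .some x y _ :=
        pointCongr_some (curveA_map (algebraMap F Ω)) h
      obtain ⟨h', e'⟩ := curveAMap_some (σ : Ω →+* Ω)
        (nonsingular_congr (curveA_map (algebraMap F Ω)) h)
      exact (pointCongr_some (curveA_map (algebraMap F Ω)) _).trans
        ((congrArg (curveAMap (σ : Ω →+* Ω)) h1).trans e').symm
  have hdiv : ∀ P : (curveA F).Pts Ω, ∃ Q : (curveA F).Pts Ω, p • Q = P := fun P => by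
    obtain ⟨Q, hQ⟩ := curveA_nsmul_surjective Ω p hp2 F (f P)
    exact ⟨f.symm Q, f.injective (by rw [map_nsmul, f.apply_symm_apply, hQ])⟩
  have hscal : ∀ (N : ℕ) (σ : Gal(Ω/F)), ∃ i : ℕ,
      ∀ P : (curveA F).Pts Ω, p ^ N • P = 0 → σ • P = (((-2 : ℤ) ^ r) ^ i) • P := fun N σ => by
    obtain ⟨i, hi⟩ := exists_curveAMap_eq_pow_zsmul Ω p hp2 hF N σ
    refine ⟨i, fun P hP => f.injective ?_⟩
    rw [hf, hi _ (by rw [← map_nsmul, hP, map_zero]), map_zsmul]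
  have htor : ∃ P : (curveA F).Pts Ω, p ^ (a + 1) • P = 0 ∧ ∃ σ : Gal(Ω/F), σ • P ≠ P := by
    obtain ⟨P, hP, hne⟩ := exists_mem_nTorsion_sub_one_zsmul_ne_zero Ω p hp2 hs hu
    refine ⟨f.symm P, by rw [← map_nsmul, hP, map_zero], ?_⟩
    -- A point fixed by all of Galois would be rational, hence killed by `s - 1`.
    by_contra! hcon
    obtain ⟨P₀, hP₀⟩ := (curveA F).mem_range_ptsIncl_of_fixed _ hcon
    refine hne ?_
    rw [← f.apply_symm_apply P, ← map_zsmul, ← hP₀, ← map_zsmul,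
      curveA_finite_zsmul_eq_zero hF, map_zero, map_zero]
  have hmod : ∀ (m : ℕ) (P : (curveA F).toAffine.Point), ∃ T R : (curveA F).toAffine.Point,
      P = T + p ^ m • R ∧ p ^ a • T = 0 := by
    intro m P
    obtain ⟨e, c, hec, h⟩ := exists_coprime_multiplier (M := (curveA F).toAffine.Point) p hs hu m
    -- `P = eP + (1 - e)P`: the first summand is `pᵃ`-torsion and the second is `pᵐcP`.
    refine ⟨e • P, c • P, ?_, ?_⟩
    · rw [← natCast_zsmul, ← mul_smul, ← add_smul, Nat.cast_pow, ← hec, add_sub_cancel, one_smul]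
    · rw [← natCast_zsmul, Nat.cast_pow]
      exact h P (curveA_finite_zsmul_eq_zero hF P)
  exact ⟨finrank_torsionField _ p hp2 ha hs hu hdiv hscal htor m,
    nonempty_gal_torsionField_mulEquiv _ p hp2 ha hs hu hdiv hscal htor m,
    kummerStable_of_scalar_action _ p hp2 ha hs hu hdiv hscal htor hmod m⟩

end FiniteField

end WeierstrassCurve

/-! ### Reduction of points over an ultrametric field -/

namespace WeierstrassCurve

section Reduction

variable {L : Type*} [NormedField L] [IsUltrametricDist L]

theorem norm_add_le_of_le {x y : L} {c : ℝ} (hx : ‖x‖ ≤ c) (hy : ‖y‖ ≤ c) : ‖x + y‖ ≤ c :=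
  (IsUltrametricDist.norm_add_le_max x y).trans (max_le hx hy)

theorem norm_sub_le_of_le {x y : L} {c : ℝ} (hx : ‖x‖ ≤ c) (hy : ‖y‖ ≤ c) : ‖x - y‖ ≤ c :=
  (sub_eq_add_neg x y ▸ norm_neg y ▸ IsUltrametricDist.norm_add_le_max x (-y)).trans (max_le hx hy)

theorem norm_add_lt_of_lt {x y : L} {c : ℝ} (hx : ‖x‖ < c) (hy : ‖y‖ < c) : ‖x + y‖ < c :=
  (IsUltrametricDist.norm_add_le_max x y).trans_lt (max_lt hx hy)

theorem norm_sub_lt_of_lt {x y : L} {c : ℝ} (hx : ‖x‖ < c) (hy : ‖y‖ < c) : ‖x - y‖ < c :=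
  (sub_eq_add_neg x y ▸ norm_neg y ▸ IsUltrametricDist.norm_add_le_max x (-y)).trans_lt (max_lt hx hy)

theorem norm_eq_of_norm_sub_lt {x y : L} (h : ‖x - y‖ < ‖y‖) : ‖x‖ = ‖y‖ := by
  have h1 := IsUltrametricDist.norm_add_eq_max_of_norm_ne_norm h.ne
  rw [sub_add_cancel, max_eq_right h.le] at h1
  exact h1

variable {V : Subring L} (hV : ∀ x, x ∈ V ↔ ‖x‖ ≤ 1) (W : WeierstrassCurve V)

include hV

omit [IsUltrametricDist L] in
theorem norm_coe_le_one (a : V) : ‖(a : L)‖ ≤ 1 := (hV a).1 a.2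

/-- When `‖x‖ > 1` the square dominates the linear term. -/
theorem mem_of_sq_add_mul_mem {x : L} (a : V) (h : x ^ 2 + a * x ∈ V) : x ∈ V := by
  by_contra hx
  rw [hV, not_le] at hx
  rw [hV] at h
  have ha := norm_coe_le_one hV a
  have h1 : ‖x ^ 2 + a * x - x ^ 2‖ < ‖x ^ 2‖ := by
    rw [add_sub_cancel_left, norm_mul, norm_pow, sq]
    nlinarith [norm_nonneg (a : L)]
  have h2 := norm_eq_of_norm_sub_lt h1
  rw [norm_pow] at h2
  nlinarith

theorem y_mem_of_x_mem {x y : L} (h : (W.map V.subtype).toAffine.Equation x y) (hx : x ∈ V) :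
    y ∈ V := by
  rw [Affine.equation_iff] at h
  simp only [map_a₁, map_a₂, map_a₃, map_a₄, map_a₆, Subring.subtype_apply] at h
  lift x to V using hx
  refine mem_of_sq_add_mul_mem hV (W.a₁ * x + W.a₃)
    (?_ : y ^ 2 + ((W.a₁ * x + W.a₃ : V) : L) * y ∈ V)
  have e : y ^ 2 + ((W.a₁ * x + W.a₃ : V) : L) * y =
      ((x ^ 3 + W.a₂ * x ^ 2 + W.a₄ * x + W.a₆ : V) : L) := by
    push_cast
    linear_combination h
  rw [e]
  exact Subtype.coe_prop _

/-- Size of the `y`-coordinate of a point near infinity. -/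
theorem norm_y_sq_of_one_lt_norm_x {x y : L} (h : (W.map V.subtype).toAffine.Equation x y)
    (hx : 1 < ‖x‖) : ‖y‖ ^ 2 = ‖x‖ ^ 3 := by
  rw [Affine.equation_iff] at h
  simp only [map_a₁, map_a₂, map_a₃, map_a₄, map_a₆, Subring.subtype_apply] at h
  have h1 := norm_coe_le_one hV W.a₁
  have h2 := norm_coe_le_one hV W.a₂
  have h3 := norm_coe_le_one hV W.a₃
  have h4 := norm_coe_le_one hV W.a₄
  have h6 := norm_coe_le_one hV W.a₆
  have hR : ‖x ^ 3 + W.a₂ * x ^ 2 + W.a₄ * x + W.a₆‖ = ‖x ^ 3‖ := by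
    refine norm_eq_of_norm_sub_lt ?_
    have e : x ^ 3 + W.a₂ * x ^ 2 + W.a₄ * x + W.a₆ - x ^ 3 = W.a₂ * x ^ 2 + W.a₄ * x + W.a₆ := by
      ring
    have hx2 : ‖x‖ ^ 2 < ‖x‖ ^ 3 := pow_lt_pow_right₀ hx (by norm_num)
    have hx1 : ‖x‖ < ‖x‖ ^ 2 := by nlinarith
    rw [e]
    simp only [norm_pow]
    refine norm_add_lt_of_lt (norm_add_lt_of_lt ?_ ?_) (by linarith)
    · rw [norm_mul, norm_pow]
      nlinarith [norm_nonneg (W.a₂ : L)]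
    · rw [norm_mul]
      nlinarith [norm_nonneg (W.a₄ : L)]
  -- If `‖y‖ ≤ ‖x‖`, the left side of the equation has norm at most `‖x‖²`, while the right side has
  -- norm `‖x‖³`.
  have hyx : ‖x‖ < ‖y‖ := by
    by_contra! hle
    have : ‖y ^ 2 + W.a₁ * x * y + W.a₃ * y‖ ≤ ‖x‖ ^ 2 := by
      refine norm_add_le_of_le (norm_add_le_of_le ?_ ?_) ?_
      · rw [norm_pow]; gcongr
      · rw [norm_mul, norm_mul, sq]
        calc ‖(W.a₁ : L)‖ * ‖x‖ * ‖y‖ ≤ 1 * ‖x‖ * ‖x‖ := by gcongr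
          _ = _ := by ring
      · rw [norm_mul, sq]
        calc ‖(W.a₃ : L)‖ * ‖y‖ ≤ 1 * ‖x‖ := by gcongr
          _ ≤ _ := by nlinarith
    rw [h, hR, norm_pow] at this
    have hx2 : ‖x‖ ^ 2 < ‖x‖ ^ 3 := pow_lt_pow_right₀ hx (by norm_num)
    linarith
  rw [← norm_pow x, ← hR, ← h, ← norm_pow]
  refine (norm_eq_of_norm_sub_lt ?_).symm
  have e : y ^ 2 + W.a₁ * x * y + W.a₃ * y - y ^ 2 = W.a₁ * x * y + W.a₃ * y := by ring
  rw [e, norm_pow]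
  refine norm_add_lt_of_lt ?_ ?_
  · rw [norm_mul, norm_mul, sq]
    calc ‖(W.a₁ : L)‖ * ‖x‖ * ‖y‖ ≤ 1 * ‖x‖ * ‖y‖ := by gcongr
      _ < ‖y‖ * ‖y‖ := by nlinarith [norm_nonneg x]
  · rw [norm_mul, sq]
    calc ‖(W.a₃ : L)‖ * ‖y‖ ≤ 1 * ‖y‖ := by gcongr
      _ < ‖y‖ * ‖y‖ := by nlinarith [norm_nonneg x]

/-- The slope of the line through two points near infinity whose third intersection with the
curve is integral cannot exist. -/
theorem addX_notMem {x₁ x₂ y₁ y₂ : L} (h₁ : (W.map V.subtype).toAffine.Nonsingular x₁ y₁)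
    (h₂ : (W.map V.subtype).toAffine.Nonsingular x₂ y₂)
    (hxy : ¬(x₁ = x₂ ∧ y₁ = (W.map V.subtype).toAffine.negY x₂ y₂))
    (hx₁ : x₁ ∉ V) (hx₂ : x₂ ∉ V) :
    (W.map V.subtype).toAffine.addX x₁ x₂
      ((W.map V.subtype).toAffine.slope x₁ x₂ y₁ y₂) ∉ V := by
  intro hx₃
  obtain ⟨ℓ, ν, hℓ, hy₁, hy₂, e₁, e₂, -⟩ := viete_slope h₁.1 h₂.1 hxy
  have hneg := (Affine.nonsingular_negAdd h₁ h₂ hxy).1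
  rw [hℓ] at hneg hx₃
  have hy₃ := y_mem_of_x_mem hV W hneg hx₃
  rw [Affine.negAddY] at hy₃
  set x₃ := (W.map V.subtype).toAffine.addX x₁ x₂ ℓ
  rw [hV] at hx₃ hy₃
  rw [hV, not_le] at hx₁ hx₂
  simp only [map_a₁, map_a₂, map_a₃, map_a₄, Subring.subtype_apply] at e₁ e₂
  have h1 := norm_coe_le_one hV W.a₁
  have h2 := norm_coe_le_one hV W.a₂
  have h3 := norm_coe_le_one hV W.a₃
  have h4 := norm_coe_le_one hV W.a₄
  set M := max ‖x₁‖ ‖x₂‖ with hM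
  have hM₁ : ‖x₁‖ ≤ M := le_max_left _ _
  have hM₂ : ‖x₂‖ ≤ M := le_max_right _ _
  have hM1 : 1 < M := hx₁.trans_le hM₁
  set t := max 1 ‖ℓ‖
  have ht : 1 ≤ t := le_max_left _ _
  have htℓ : ‖ℓ‖ ≤ t := le_max_right _ _
  -- The sum of the three abscissae is `ℓ² + a₁ℓ - a₂` and has norm at most `M`, the third abscissa
  -- being integral by assumption.
  have htM : t ^ 2 ≤ M := by
    rcases le_total ‖ℓ‖ 1 with hl | hl
    · rw [show t = 1 from max_eq_left hl]; linarith
    · have htt : t = ‖ℓ‖ := max_eq_right hl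
      by_contra! hlt
      have hl1 : 1 < ‖ℓ‖ := by
        by_contra! h
        rw [le_antisymm h hl] at htt
        rw [htt] at hlt; linarith
      have e : ‖ℓ ^ 2 + W.a₁ * ℓ - W.a₂‖ = ‖ℓ ^ 2‖ := by
        refine norm_eq_of_norm_sub_lt ?_
        rw [show ℓ ^ 2 + W.a₁ * ℓ - W.a₂ - ℓ ^ 2 = W.a₁ * ℓ - W.a₂ by ring, norm_pow]
        refine norm_sub_lt_of_lt ?_ (by nlinarith)
        rw [norm_mul]
        nlinarith [norm_nonneg (W.a₁ : L)]
      rw [← e₁, norm_pow, ← htt] at e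
      have : ‖x₁ + x₂ + x₃‖ ≤ M :=
        norm_add_le_of_le (norm_add_le_of_le hM₁ hM₂) (by linarith)
      linarith
  -- The intercept is read off at the third point, whose coordinates are integral.
  have hν : ‖ν‖ ≤ t := by
    have hy : ν = (ℓ * (x₃ - x₁) + y₁) - ℓ * x₃ := by rw [hy₁]; ring
    rw [hy]
    refine norm_sub_le_of_le (by linarith) ?_
    rw [norm_mul]
    nlinarith [norm_nonneg ℓ, norm_nonneg x₃]
  have hprod : M < ‖x₁ * x₂‖ := by
    rw [norm_mul, hM]
    exact max_lt (by nlinarith) (by nlinarith)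
  -- The second Viète formula bounds `x₁x₂` by `max(t², M) ≤ M`, against the strict inequality just
  -- found.
  have hle : ‖x₁ * x₂‖ ≤ M := by
    have e : x₁ * x₂ = W.a₄ - 2 * ℓ * ν - W.a₁ * ν - W.a₃ * ℓ - (x₁ + x₂) * x₃ := by
      linear_combination e₂
    rw [e]
    have htt : t ≤ t ^ 2 := by nlinarith
    have hn2 : ‖(2 : L)‖ ≤ 1 := by
      have := IsUltrametricDist.norm_natCast_le_one L 2
      exact_mod_cast this
    refine norm_sub_le_of_le (norm_sub_le_of_le (norm_sub_le_of_le (norm_sub_le_of_le ?_ ?_) ?_) ?_)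
      ?_
    · linarith
    · rw [norm_mul, norm_mul]
      calc ‖(2 : L)‖ * ‖ℓ‖ * ‖ν‖ ≤ 1 * t * t := by gcongr
        _ ≤ M := by nlinarith
    · rw [norm_mul]
      calc ‖(W.a₁ : L)‖ * ‖ν‖ ≤ 1 * t := by gcongr
        _ ≤ M := by nlinarith
    · rw [norm_mul]
      calc ‖(W.a₃ : L)‖ * ‖ℓ‖ ≤ 1 * t := by gcongr
        _ ≤ M := by nlinarith
    · rw [norm_mul]
      calc ‖x₁ + x₂‖ * ‖x₃‖ ≤ M * 1 := by
            gcongr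
            exact norm_add_le_of_le hM₁ hM₂
        _ = M := mul_one _
  linarith

end Reduction

end WeierstrassCurve

namespace WeierstrassCurve

section Reduction

variable {L κ : Type*} [NormedField L] [IsUltrametricDist L] [Field κ]
  {V : Subring L} (hV : ∀ x, x ∈ V ↔ ‖x‖ ≤ 1) (W : WeierstrassCurve V)
  (ρ : V →+* κ) [(W.map ρ).IsElliptic]

open Classical in
/-- Reduction of points, `(x, y) ↦ (x̄, ȳ)` for integral `x`, all other points going to `0`. -/
noncomputable def reducePt :
    (W.map V.subtype).toAffine.Point → (W.map ρ).toAffine.Point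
  | .zero => 0
  | .some x y h => if hx : x ∈ V then
      .some (ρ ⟨x, hx⟩) (ρ ⟨y, y_mem_of_x_mem hV W h.1 hx⟩) (Affine.equation_iff_nonsingular.1
        (Affine.Equation.map ρ ((Affine.map_equation
          (W := W.toAffine) (f := V.subtype) V.subtype_injective ⟨x, hx⟩ ⟨y, _⟩).1 h.1)))
    else 0

theorem reducePt_zero : reducePt hV W ρ 0 = 0 := rfl

theorem reducePt_of_notMem {x y : L} (h : (W.map V.subtype).toAffine.Nonsingular x y)
    (hx : x ∉ V) : reducePt hV W ρ (.some x y h) = 0 := dif_neg hx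

theorem reducePt_coe (x y : V) (h : (W.map V.subtype).toAffine.Nonsingular (x : L) (y : L)) :
    ∃ h', reducePt hV W ρ (.some x y h) = .some (ρ x) (ρ y) h' :=
  ⟨_, dif_pos x.2⟩

theorem reducePt_neg (P : (W.map V.subtype).toAffine.Point) :
    reducePt hV W ρ (-P) = -reducePt hV W ρ P := by
  rcases P with _ | ⟨x, y, h⟩
  · rfl
  · rw [Affine.Point.neg_some]
    by_cases hx : x ∈ V
    · have hy := y_mem_of_x_mem hV W h.1 hx
      lift x to V using hx
      lift y to V using hy
      have e : (W.map V.subtype).toAffine.negY (x : L) (y : L) = (W.toAffine.negY x y : V) :=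
        Affine.map_negY V.subtype x y
      obtain ⟨h', e'⟩ := reducePt_coe hV W ρ x y h
      have h2 := (Affine.nonsingular_neg (x := (x : L)) (y := (y : L))).2 h
      obtain ⟨h'', e''⟩ := reducePt_coe hV W ρ x (W.toAffine.negY x y) (e ▸ h2)
      have e3 : (Affine.Point.some (x : L) _ h2 : (W.map V.subtype).toAffine.Point) =
          .some (x : L) ((W.toAffine.negY x y : V) : L) (e ▸ h2) := by
        simp only [Affine.Point.some.injEq]; exact ⟨trivial, e⟩
      rw [e', Affine.Point.neg_some]
      refine (congrArg _ e3).trans (e''.trans ?_)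
      simp only [Affine.Point.some.injEq]
      exact ⟨trivial, (Affine.map_negY ρ x y).symm⟩
    · rw [reducePt_of_notMem hV W ρ _ hx, reducePt_of_notMem hV W ρ _ hx, neg_zero]

variable (hρ : ∀ x, ρ x = 0 ↔ ‖(x : L)‖ < 1)

omit [IsUltrametricDist L] in
include hV hρ in
theorem mem_of_mul_coe_mem {ℓ : L} {d : V} (hd : ρ d ≠ 0) (h : ℓ * d ∈ V) : ℓ ∈ V := by
  rw [hV] at h ⊢
  have hd1 : ‖(d : L)‖ = 1 := le_antisymm (norm_coe_le_one hV d)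
    (not_lt.1 fun h => hd ((hρ d).2 h))
  rwa [norm_mul, hd1, mul_one] at h

-- If the reductions are not opposite, one of the two slope equations has a unit coefficient, so the
-- slope is integral and the addition formulas reduce. If they are opposite, the sum must not be
-- integral: otherwise the slope would be integral and its reduced equations would make both partial
-- derivatives vanish, contradicting smoothness.
include hρ in
theorem reducePt_add_coe (x₁ y₁ x₂ y₂ : V)
    (h₁ : (W.map V.subtype).toAffine.Nonsingular (x₁ : L) (y₁ : L))
    (h₂ : (W.map V.subtype).toAffine.Nonsingular (x₂ : L) (y₂ : L)) :
    reducePt hV W ρ (.some x₁ y₁ h₁ + .some x₂ y₂ h₂) =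
      reducePt hV W ρ (.some x₁ y₁ h₁) + reducePt hV W ρ (.some x₂ y₂ h₂) := by
  obtain ⟨h₁', e₁⟩ := reducePt_coe hV W ρ x₁ y₁ h₁
  obtain ⟨h₂', e₂⟩ := reducePt_coe hV W ρ x₂ y₂ h₂
  rw [e₁, e₂]
  have en : (W.map V.subtype).toAffine.negY (x₂ : L) (y₂ : L) = (W.toAffine.negY x₂ y₂ : V) :=
    Affine.map_negY V.subtype x₂ y₂
  have en' : (W.map ρ).toAffine.negY (ρ x₂) (ρ y₂) = ρ (W.toAffine.negY x₂ y₂) :=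
    Affine.map_negY ρ x₂ y₂
  by_cases hxy : (x₁ : L) = x₂ ∧ (y₁ : L) = (W.map V.subtype).toAffine.negY x₂ y₂
  · rw [Affine.Point.add_of_Y_eq hxy.1 hxy.2, reducePt_zero]
    rw [en] at hxy
    refine (Affine.Point.add_of_Y_eq ?_ ?_).symm
    · rw [Subtype.ext hxy.1]
    · rw [en', Subtype.ext hxy.2]
  obtain ⟨s₁, s₂⟩ := slope_spec h₁.1 h₂.1 hxy
  have hadd := add_some_of_slope h₁ h₂ hxy s₁ s₂
  generalize (W.map V.subtype).toAffine.slope (x₁ : L) x₂ y₁ y₂ = ℓ at s₁ s₂ hadd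
  obtain ⟨h₃, e₃⟩ := hadd
  rw [e₃]
  simp only [map_a₁, map_a₂, map_a₃, map_a₄, Subring.subtype_apply] at s₂
  set d : V := y₁ + y₂ + W.a₁ * x₂ + W.a₃ with hd
  set n : V := x₁ ^ 2 + x₁ * x₂ + x₂ ^ 2 + W.a₂ * (x₁ + x₂) + W.a₄ - W.a₁ * y₁ with hn
  have s₂' : ℓ * d = n := by
    rw [hd, hn]; push_cast; exact s₂
  have s₁' : ℓ * ((x₁ - x₂ : V) : L) = ((y₁ - y₂ : V) : L) := by push_cast; exact s₁
  have hneg : ρ y₁ = ρ (W.toAffine.negY x₂ y₂) ↔ ρ d = 0 := by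
    rw [← sub_eq_zero, ← map_sub, hd, Affine.negY]
    ring_nf
  by_cases hxy' : ρ x₁ = ρ x₂ ∧ ρ y₁ = (W.map ρ).toAffine.negY (ρ x₂) (ρ y₂)
  · rw [Affine.Point.add_of_Y_eq hxy'.1 hxy'.2]
    refine reducePt_of_notMem hV W ρ _ fun hmem => ?_
    rw [en', hneg] at hxy'
    -- `ℓ² + a₁ℓ` is the abscissa of the sum plus `a₂ + x₁ + x₂`, hence integral.
    have hℓV : ℓ ∈ V := by
      refine mem_of_sq_add_mul_mem hV W.a₁ ?_
      rw [Affine.addX] at hmem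
      simp only [map_a₁, map_a₂, Subring.subtype_apply] at hmem
      have := V.add_mem hmem (W.a₂ + x₁ + x₂ : V).2
      convert this using 1
      push_cast
      ring
    lift ℓ to V using hℓV
    have t₁ := congrArg ρ (Subtype.ext s₁' : ℓ * (x₁ - x₂) = y₁ - y₂)
    have t₂ := congrArg ρ (Subtype.ext s₂' : ℓ * d = n)
    rw [map_mul, map_sub, hxy'.1, sub_self, mul_zero, map_sub, eq_comm, sub_eq_zero] at t₁
    rw [map_mul, hxy'.2, mul_zero, hn] at t₂
    have t₃ := hxy'.2
    rw [hd] at t₃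
    simp only [map_add, map_sub, map_mul, map_pow, ← hxy'.1, ← t₁] at t₂ t₃
    rcases ((Affine.nonsingular_iff' _ _).1 h₁').2 with h | h
    · refine h ?_
      simp only [map_a₁, map_a₂, map_a₄]
      linear_combination t₂
    · refine h ?_
      simp only [map_a₁, map_a₃]
      linear_combination t₃
  · have hℓV : ℓ ∈ V := by
      by_cases hx : ρ x₁ = ρ x₂
      · have hd0 : ρ d ≠ 0 := fun h => hxy' ⟨hx, by rw [en', hneg]; exact h⟩
        refine mem_of_mul_coe_mem hV ρ hρ hd0 ?_
        rw [s₂']; exact n.2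
      · refine mem_of_mul_coe_mem hV ρ hρ (d := x₁ - x₂) (by rwa [map_sub, sub_ne_zero]) ?_
        rw [s₁']; exact Subtype.coe_prop _
    lift ℓ to V using hℓV
    have t₁ := congrArg ρ (Subtype.ext s₁' : ℓ * (x₁ - x₂) = y₁ - y₂)
    have t₂ := congrArg ρ (Subtype.ext s₂' : ℓ * d = n)
    rw [hd, hn] at t₂
    simp only [map_add, map_sub, map_mul, map_pow] at t₁ t₂
    obtain ⟨h₄, e₄⟩ := add_some_of_slope (ℓ := ρ ℓ) h₁' h₂' hxy' t₁ t₂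
    rw [e₄]
    have ex : (W.map V.subtype).toAffine.addX (x₁ : L) x₂ ℓ = (W.toAffine.addX x₁ x₂ ℓ : V) :=
      Affine.map_addX V.subtype x₁ x₂ ℓ
    have ey : (W.map V.subtype).toAffine.addY (x₁ : L) x₂ y₁ ℓ =
        (W.toAffine.addY x₁ x₂ y₁ ℓ : V) := Affine.map_addY V.subtype x₁ y₁ x₂ ℓ
    have ex' : (W.map ρ).toAffine.addX (ρ x₁) (ρ x₂) (ρ ℓ) = ρ (W.toAffine.addX x₁ x₂ ℓ) :=
      Affine.map_addX ρ x₁ x₂ ℓ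
    have ey' : (W.map ρ).toAffine.addY (ρ x₁) (ρ x₂) (ρ y₁) (ρ ℓ) =
        ρ (W.toAffine.addY x₁ x₂ y₁ ℓ) := Affine.map_addY ρ x₁ y₁ x₂ ℓ
    have h₅ : (W.map V.subtype).toAffine.Nonsingular ((W.toAffine.addX x₁ x₂ ℓ : V) : L)
        ((W.toAffine.addY x₁ x₂ y₁ ℓ : V) : L) := ex ▸ ey ▸ h₃
    obtain ⟨h₆, e₆⟩ := reducePt_coe hV W ρ _ _ h₅
    have e7 : (Affine.Point.some _ _ h₃ : (W.map V.subtype).toAffine.Point) = .some _ _ h₅ := by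
      simp only [Affine.Point.some.injEq]; exact ⟨ex, ey⟩
    rw [e7, e₆]
    simp only [Affine.Point.some.injEq]
    exact ⟨ex'.symm, ey'.symm⟩

theorem reducePt_eq_zero_iff_of_some {x y : L}
    (h : (W.map V.subtype).toAffine.Nonsingular x y) :
    reducePt hV W ρ (.some x y h) = 0 ↔ x ∉ V := by
  refine ⟨fun h0 hx => ?_, reducePt_of_notMem hV W ρ h⟩
  have hy := y_mem_of_x_mem hV W h.1 hx
  lift x to V using hx
  lift y to V using hy
  obtain ⟨h', e'⟩ := reducePt_coe hV W ρ x y h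
  exact Affine.Point.some_ne_zero _ (e'.symm.trans h0)

theorem reducePt_add_eq_zero {P Q : (W.map V.subtype).toAffine.Point}
    (hP : reducePt hV W ρ P = 0) (hQ : reducePt hV W ρ Q = 0) :
    reducePt hV W ρ (P + Q) = 0 := by
  by_cases hP0 : P = 0
  · rw [hP0, zero_add, hQ]
  by_cases hQ0 : Q = 0
  · rw [hQ0, add_zero, hP]
  rcases P with _ | ⟨x₁, y₁, h₁⟩
  · exact absurd rfl hP0
  rcases Q with _ | ⟨x₂, y₂, h₂⟩
  · exact absurd rfl hQ0
  rw [reducePt_eq_zero_iff_of_some] at hP hQ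
  by_cases hxy : x₁ = x₂ ∧ y₁ = (W.map V.subtype).toAffine.negY x₂ y₂
  · rw [Affine.Point.add_of_Y_eq hxy.1 hxy.2, reducePt_zero]
  · rw [Affine.Point.add_some hxy]
    exact reducePt_of_notMem hV W ρ _ (addX_notMem hV W h₁ h₂ hxy hP hQ)

include hρ in
theorem reducePt_add_of_ne_zero {P Q : (W.map V.subtype).toAffine.Point}
    (hP : reducePt hV W ρ P ≠ 0) (hQ : reducePt hV W ρ Q ≠ 0) :
    reducePt hV W ρ (P + Q) = reducePt hV W ρ P + reducePt hV W ρ Q := by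
  rcases P with _ | ⟨x₁, y₁, h₁⟩
  · exact absurd rfl hP
  rcases Q with _ | ⟨x₂, y₂, h₂⟩
  · exact absurd rfl hQ
  rw [Ne, reducePt_eq_zero_iff_of_some, not_not] at hP hQ
  have hy₁ := y_mem_of_x_mem hV W h₁.1 hP
  have hy₂ := y_mem_of_x_mem hV W h₂.1 hQ
  lift x₁ to V using hP
  lift y₁ to V using hy₁
  lift x₂ to V using hQ
  lift y₂ to V using hy₂
  exact reducePt_add_coe hV W ρ hρ x₁ y₁ x₂ y₂ h₁ h₂

-- No computation is needed when only `Q` has nonzero reduction: `P + Q` then has nonzero reduction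
-- too, and the nonzero case applies to `(P + Q) + (-Q) = P`.
include hρ in
theorem reducePt_add_of_eq_zero {P Q : (W.map V.subtype).toAffine.Point}
    (hP : reducePt hV W ρ P = 0) : reducePt hV W ρ (P + Q) = reducePt hV W ρ Q := by
  by_cases hQ : reducePt hV W ρ Q = 0
  · rw [reducePt_add_eq_zero hV W ρ hP hQ, hQ]
  · have hR : reducePt hV W ρ (P + Q) ≠ 0 := fun hR => hQ (by
      have := reducePt_add_eq_zero hV W ρ (P := -P) (by rw [reducePt_neg, hP, neg_zero]) hR
      rwa [neg_add_cancel_left] at this)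
    have := reducePt_add_of_ne_zero hV W ρ hρ hR (Q := -Q) (by rwa [reducePt_neg, neg_ne_zero])
    rw [add_neg_cancel_right, hP, reducePt_neg, ← sub_eq_add_neg, eq_comm, sub_eq_zero] at this
    exact this

/-- The reduction homomorphism. -/
noncomputable def reduceHom :
    (W.map V.subtype).toAffine.Point →+ (W.map ρ).toAffine.Point where
  toFun := reducePt hV W ρ
  map_zero' := reducePt_zero hV W ρ
  map_add' P Q := by
    by_cases hP : reducePt hV W ρ P = 0
    · rw [reducePt_add_of_eq_zero hV W ρ hρ hP, hP, zero_add]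
    by_cases hQ : reducePt hV W ρ Q = 0
    · rw [add_comm, reducePt_add_of_eq_zero hV W ρ hρ hQ, hQ, add_zero]
    · exact reducePt_add_of_ne_zero hV W ρ hρ hP hQ

theorem reduceHom_apply (P : (W.map V.subtype).toAffine.Point) :
    reduceHom hV W ρ hρ P = reducePt hV W ρ P := rfl

omit [IsUltrametricDist L] in
include ρ in
theorem isElliptic_map_subtype : (W.map V.subtype).IsElliptic := by
  rw [isElliptic_iff, isUnit_iff_ne_zero, map_Δ]
  intro h
  have h1 : W.Δ = 0 := Subtype.ext h
  have h2 := (W.map ρ).isUnit_Δ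
  rw [map_Δ, h1, map_zero] at h2
  exact not_isUnit_zero h2

/-- Lift `x` and solve the monic quadratic for `y`. The reduced point and the target share their
abscissa, so they are equal or opposite. -/
theorem reduceHom_surjective [IsAlgClosed L] (hsurj : Function.Surjective ρ) :
    Function.Surjective (reduceHom hV W ρ hρ) := by
  rintro (_ | ⟨x, y, h⟩)
  · exact ⟨0, map_zero _⟩
  have := isElliptic_map_subtype W ρ
  obtain ⟨X, rfl⟩ := hsurj x
  obtain ⟨Y, hY⟩ := IsAlgClosed.exists_root
    (Polynomial.X ^ 2 + Polynomial.C ((W.a₁ : L) * X + W.a₃) * Polynomial.X +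
      Polynomial.C (-((X : L) ^ 3 + W.a₂ * X ^ 2 + W.a₄ * X + W.a₆)))
    (by
      have : (Polynomial.X ^ 2 + Polynomial.C ((W.a₁ : L) * X + W.a₃) * Polynomial.X +
        Polynomial.C (-((X : L) ^ 3 + W.a₂ * X ^ 2 + W.a₄ * X + W.a₆))).degree = 2 := by
          compute_degree!
      rw [this]
      norm_num)
  have hE : (W.map V.subtype).toAffine.Equation (X : L) Y := by
    rw [Affine.equation_iff]
    simp only [map_a₁, map_a₂, map_a₃, map_a₄, map_a₆, Subring.subtype_apply]
    simp only [Polynomial.IsRoot, Polynomial.eval_add, Polynomial.eval_mul, Polynomial.eval_pow,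
      Polynomial.eval_X, Polynomial.eval_C] at hY
    linear_combination hY
  have hYV := y_mem_of_x_mem hV W hE X.2
  lift Y to V using hYV
  have hN := Affine.equation_iff_nonsingular.1 hE
  obtain ⟨h', e⟩ := reducePt_coe hV W ρ X Y hN
  rcases Affine.Y_eq_of_X_eq h'.1 h.1 rfl with hy | hy
  · refine ⟨.some X Y hN, e.trans ?_⟩
    simp only [Affine.Point.some.injEq]
    exact ⟨trivial, hy⟩
  · refine ⟨-.some X Y hN, ?_⟩
    rw [map_neg, reduceHom_apply, e, neg_eq_iff_eq_neg, Affine.Point.neg_some]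
    simp only [Affine.Point.some.injEq]
    exact ⟨trivial, hy⟩

end Reduction

end WeierstrassCurve

/-! ### Three collinear points near the origin -/

namespace WeierstrassCurve

section Chord

variable {L : Type*} [Field L]

/-- Elimination along a line `w = λz + μ` meeting the cubic
`w + a₁zw + a₃w² = z³ + a₂z²w + a₄zw² + a₆w³` at `z₁, z₂, z₃`. -/
theorem chord_identity {a₁ a₃ a₄ a₆ l μ z₁ z₂ z₃ c u B D : L}
    (hu : u = 1 + a₁ * z₂ + a₃ * (l * z₂ + μ)) (e₁ : μ * B - a₁ * l - a₃ * l ^ 2 = -c * (z₁ + z₂ + z₃))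
    (e₂ : a₄ * μ ^ 2 + 3 * a₆ * l * μ ^ 2 - l - a₁ * μ - 2 * a₃ * l * μ =
      c * (z₁ * z₂ + z₁ * z₃ + z₂ * z₃))
    (e₃ : μ * D = -c * (z₁ * z₂ * z₃)) :
    c * ((z₂ + u * z₁) * (z₂ + u * z₃) * z₂) = μ * ((a₁ + a₃ * l) * z₂ *
      (a₃ * l * z₂ + B * z₂ ^ 2 + (a₄ * μ + 3 * a₆ * l * μ - a₁ - 2 * a₃ * l) * z₂ + D) -
      a₃ * c * z₂ ^ 3 - u * z₂ ^ 2 * B - u ^ 2 * D) := by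
  -- The relations `e₁`, `e₂`, `e₃` are the coefficients of `c(z - z₁)(z - z₂)(z - z₃)`, evaluated
  -- here at `z₂`.
  have hR : c * z₂ ^ 3 + (μ * B - a₁ * l - a₃ * l ^ 2) * z₂ ^ 2 +
      (a₄ * μ ^ 2 + 3 * a₆ * l * μ ^ 2 - l - a₁ * μ - 2 * a₃ * l * μ) * z₂ + μ * D = 0 := by
    rw [e₁, e₂, e₃]; ring
  have h1 : c * ((z₂ + u * z₁) * (z₂ + u * z₃) * z₂) = c * z₂ ^ 3 * (1 - u) -
      u * z₂ ^ 2 * (μ * B - a₁ * l - a₃ * l ^ 2) - u ^ 2 * (μ * D) := by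
    rw [e₁, e₃]; ring
  rw [h1]
  clear h1 e₁ e₂ e₃
  subst hu
  linear_combination (-(a₁ + a₃ * l) * z₂) * hR

/-- Viète's formulas in the coordinates `z = x / y`, `w = 1 / y`. -/
theorem chord_viete {a₁ a₂ a₃ a₄ a₆ x₁ x₂ x₃ ℓ ν : L} (hν : ν ≠ 0)
    (h₁ : ℓ * x₁ + ν ≠ 0) (h₂ : ℓ * x₂ + ν ≠ 0) (h₃ : ℓ * x₃ + ν ≠ 0)
    (v₁ : x₁ + x₂ + x₃ = ℓ ^ 2 + a₁ * ℓ - a₂)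
    (v₂ : x₁ * x₂ + x₁ * x₃ + x₂ * x₃ = a₄ - 2 * ℓ * ν - a₁ * ν - a₃ * ℓ)
    (v₃ : x₁ * x₂ * x₃ = ν ^ 2 + a₃ * ν - a₆) {l μ c z₁ z₂ z₃ : L}
    (hl : l = -ℓ / ν) (hμ : μ = 1 / ν) (hc : c = 1 + a₂ * l + a₄ * l ^ 2 + a₆ * l ^ 3)
    (hz₁ : z₁ = x₁ / (ℓ * x₁ + ν)) (hz₂ : z₂ = x₂ / (ℓ * x₂ + ν)) (hz₃ : z₃ = x₃ / (ℓ * x₃ + ν)) :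
    μ * (a₂ + 2 * a₄ * l + 3 * a₆ * l ^ 2) - a₁ * l - a₃ * l ^ 2 = -c * (z₁ + z₂ + z₃) ∧
    a₄ * μ ^ 2 + 3 * a₆ * l * μ ^ 2 - l - a₁ * μ - 2 * a₃ * l * μ =
      c * (z₁ * z₂ + z₁ * z₃ + z₂ * z₃) ∧
    μ * (a₆ * μ ^ 2 - 1 - a₃ * μ) = -c * (z₁ * z₂ * z₃) := by
  -- The leading coefficient `c` is, up to `ν³`, the product of the three ordinates.
  have hcν : ν ^ 3 * c = (ℓ * x₁ + ν) * (ℓ * x₂ + ν) * (ℓ * x₃ + ν) := by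
    have e : (ℓ * x₁ + ν) * (ℓ * x₂ + ν) * (ℓ * x₃ + ν) = ℓ ^ 3 * (x₁ * x₂ * x₃) +
      ℓ ^ 2 * ν * (x₁ * x₂ + x₁ * x₃ + x₂ * x₃) + ℓ * ν ^ 2 * (x₁ + x₂ + x₃) + ν ^ 3 := by ring
    rw [e, v₁, v₂, v₃, hc, hl]
    field_simp
    ring
  have hc' : c = (ℓ * x₁ + ν) * (ℓ * x₂ + ν) * (ℓ * x₃ + ν) / ν ^ 3 := by
    rw [eq_div_iff (pow_ne_zero 3 hν), ← hcν]; ring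
  subst hz₁ hz₂ hz₃ hl hμ
  refine ⟨?_, ?_, ?_⟩
  · have e : c * (x₁ / (ℓ * x₁ + ν) + x₂ / (ℓ * x₂ + ν) + x₃ / (ℓ * x₃ + ν)) =
        (3 * ℓ ^ 2 * (x₁ * x₂ * x₃) + 2 * ℓ * ν * (x₁ * x₂ + x₁ * x₃ + x₂ * x₃) +
          ν ^ 2 * (x₁ + x₂ + x₃)) / ν ^ 3 := by
      rw [hc']; field_simp; ring
    rw [neg_mul, e, v₁, v₂, v₃]
    field_simp
    ring
  · have e : c * (x₁ / (ℓ * x₁ + ν) * (x₂ / (ℓ * x₂ + ν)) + x₁ / (ℓ * x₁ + ν) * (x₃ / (ℓ * x₃ + ν))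
        + x₂ / (ℓ * x₂ + ν) * (x₃ / (ℓ * x₃ + ν))) =
        (3 * ℓ * (x₁ * x₂ * x₃) + ν * (x₁ * x₂ + x₁ * x₃ + x₂ * x₃)) / ν ^ 3 := by
      rw [hc']; field_simp; ring
    rw [e, v₂, v₃]
    field_simp
    ring
  · have e : c * (x₁ / (ℓ * x₁ + ν) * (x₂ / (ℓ * x₂ + ν)) * (x₃ / (ℓ * x₃ + ν))) =
        (x₁ * x₂ * x₃) / ν ^ 3 := by
      rw [hc']; field_simp
    rw [neg_mul, e, v₃]
    field_simp
    ring

end Chord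

section ChordNorm

variable {L : Type*} [NormedField L] [IsUltrametricDist L]

theorem norm_one_add {x : L} (h : ‖x‖ < 1) : ‖1 + x‖ = 1 := by
  have := norm_eq_of_norm_sub_lt (x := 1 + x) (y := 1) (by rwa [add_sub_cancel_left, norm_one])
  rwa [norm_one] at this

omit [IsUltrametricDist L] in
theorem norm_mul_le_one {x y : L} (hx : ‖x‖ ≤ 1) (hy : ‖y‖ ≤ 1) : ‖x * y‖ ≤ 1 := by
  rw [norm_mul]; exact mul_le_one₀ hx (norm_nonneg _) hy

omit [IsUltrametricDist L] in
theorem norm_mul_lt_one {x y : L} (hx : ‖x‖ ≤ 1) (hy : ‖y‖ < 1) : ‖x * y‖ < 1 := by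
  rw [norm_mul]; exact mul_lt_one_of_nonneg_of_lt_one_right hx (norm_nonneg _) hy

theorem norm_natCast_le_one (n : ℕ) : ‖(n : L)‖ ≤ 1 := IsUltrametricDist.norm_natCast_le_one L n

/-- The negative of the second point has parameter `-z₂ / u`, so `z₂ + uz₁` is, up to the unit `u`,
the difference of the parameters of `P₁` and `-P₂`. In `chord_identity` the cofactor of `μ` is a
unit, dominated by `-u²D` with `D ≡ -1`, and `‖μ‖ = ‖z₁z₂z₃‖` by `e₃`; cancelling `‖z₂‖` leaves the
product formula. -/
theorem norm_chord_identity {a₁ a₂ a₃ a₄ a₆ l μ z₁ z₂ z₃ c u : L}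
    (h1 : ‖a₁‖ ≤ 1) (h2 : ‖a₂‖ ≤ 1) (h3 : ‖a₃‖ ≤ 1) (h4 : ‖a₄‖ ≤ 1) (h6 : ‖a₆‖ ≤ 1)
    (hl : ‖l‖ < 1) (hμ : ‖μ‖ < 1) (hz : ‖z₂‖ < 1) (hz0 : z₂ ≠ 0)
    (hc : c = 1 + a₂ * l + a₄ * l ^ 2 + a₆ * l ^ 3) (hu : u = 1 + a₁ * z₂ + a₃ * (l * z₂ + μ))
    (e₁ : μ * (a₂ + 2 * a₄ * l + 3 * a₆ * l ^ 2) - a₁ * l - a₃ * l ^ 2 = -c * (z₁ + z₂ + z₃))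
    (e₂ : a₄ * μ ^ 2 + 3 * a₆ * l * μ ^ 2 - l - a₁ * μ - 2 * a₃ * l * μ =
      c * (z₁ * z₂ + z₁ * z₃ + z₂ * z₃))
    (e₃ : μ * (a₆ * μ ^ 2 - 1 - a₃ * μ) = -c * (z₁ * z₂ * z₃)) :
    ‖z₂ + u * z₁‖ * ‖z₂ + u * z₃‖ = ‖z₁‖ * ‖z₃‖ := by
  have n2 : ‖(2 : L)‖ ≤ 1 := by exact_mod_cast norm_natCast_le_one (L := L) 2
  have n3 : ‖(3 : L)‖ ≤ 1 := by exact_mod_cast norm_natCast_le_one (L := L) 3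
  have hadd : ∀ {x y : L}, ‖x‖ ≤ 1 → ‖y‖ ≤ 1 → ‖x + y‖ ≤ 1 := norm_add_le_of_le
  have hsub : ∀ {x y : L}, ‖x‖ ≤ 1 → ‖y‖ ≤ 1 → ‖x - y‖ ≤ 1 := norm_sub_le_of_le
  have hcn : ‖c‖ = 1 := by
    rw [hc, show 1 + a₂ * l + a₄ * l ^ 2 + a₆ * l ^ 3 =
      1 + (a₂ + a₄ * l + a₆ * (l * l)) * l by ring]
    exact norm_one_add (norm_mul_lt_one (hadd (hadd h2 (norm_mul_le_one h4 hl.le))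
      (norm_mul_le_one h6 (norm_mul_le_one hl.le hl.le))) hl)
  have hwn : ‖l * z₂ + μ‖ < 1 := norm_add_lt_of_lt (norm_mul_lt_one hl.le hz) hμ
  have hu1 : ‖u - 1‖ < 1 := by
    rw [hu, show 1 + a₁ * z₂ + a₃ * (l * z₂ + μ) - 1 = a₁ * z₂ + a₃ * (l * z₂ + μ) by ring]
    exact norm_add_lt_of_lt (norm_mul_lt_one h1 hz) (norm_mul_lt_one h3 hwn)
  have hun : ‖u‖ = 1 := by
    have := norm_one_add hu1
    rwa [add_sub_cancel] at this
  set B := a₂ + 2 * a₄ * l + 3 * a₆ * l ^ 2 with hB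
  set D := a₆ * μ ^ 2 - 1 - a₃ * μ with hD
  have hBn : ‖B‖ ≤ 1 := by
    rw [hB, sq]
    exact hadd (hadd h2 (norm_mul_le_one (norm_mul_le_one n2 h4) hl.le))
      (norm_mul_le_one (norm_mul_le_one n3 h6) (norm_mul_le_one hl.le hl.le))
  have hD1 : ‖D + 1‖ < 1 := by
    rw [hD, show a₆ * μ ^ 2 - 1 - a₃ * μ + 1 = (a₆ * μ - a₃) * μ by ring]
    exact norm_mul_lt_one (hsub (norm_mul_le_one h6 hμ.le) h3) hμ
  have hDn : ‖D‖ = 1 := by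
    rw [← norm_neg, show -D = 1 + -(D + 1) by ring]
    exact norm_one_add (by rwa [norm_neg])
  have key := chord_identity hu e₁ e₂ e₃
  set S := (a₁ + a₃ * l) * z₂ *
      (a₃ * l * z₂ + B * z₂ ^ 2 + (a₄ * μ + 3 * a₆ * l * μ - a₁ - 2 * a₃ * l) * z₂ + D) -
      a₃ * c * z₂ ^ 3 - u * z₂ ^ 2 * B - u ^ 2 * D with hS
  have hSn : ‖S‖ = 1 := by
    have e : S = -(u ^ 2 * D) + ((a₁ + a₃ * l) *
        (a₃ * l * z₂ + B * (z₂ * z₂) + (a₄ * μ + 3 * a₆ * l * μ - a₁ - 2 * a₃ * l) * z₂ + D) -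
        a₃ * c * (z₂ * z₂) - u * z₂ * B) * z₂ := by rw [hS]; ring
    have hlead : ‖-(u ^ 2 * D)‖ = 1 := by
      rw [norm_neg, norm_mul, norm_pow, hun, hDn]; norm_num
    rw [← hlead]
    refine norm_eq_of_norm_sub_lt ?_
    rw [hlead, e, add_sub_cancel_left]
    refine norm_mul_lt_one (hsub (hsub (norm_mul_le_one (hadd h1 (norm_mul_le_one h3 hl.le))
      (hadd (hadd (hadd ?_ ?_) ?_) hDn.le)) ?_) ?_) hz
    · exact norm_mul_le_one (norm_mul_le_one h3 hl.le) hz.le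
    · exact norm_mul_le_one hBn (norm_mul_le_one hz.le hz.le)
    · exact norm_mul_le_one (hsub (hsub (hadd (norm_mul_le_one h4 hμ.le) (norm_mul_le_one
        (norm_mul_le_one (norm_mul_le_one n3 h6) hl.le) hμ.le)) h1)
        (norm_mul_le_one (norm_mul_le_one n2 h3) hl.le)) hz.le
    · exact norm_mul_le_one (norm_mul_le_one h3 hcn.le) (norm_mul_le_one hz.le hz.le)
    · exact norm_mul_le_one (norm_mul_le_one hun.le hz.le) hBn
  have k1 := congrArg norm key
  have k2 := congrArg norm e₃
  simp only [norm_mul, norm_neg, hcn, hSn, hDn, one_mul, mul_one] at k1 k2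
  refine mul_right_cancel₀ (norm_ne_zero_iff.2 hz0) ?_
  rw [k1, k2]
  ring

/-- Consequence of the three product formulas for the sizes of the sides of a chord. -/
theorem eq_of_isosceles {a b c d e f g h k : ℝ} (hd0 : 0 ≤ d)
    (hd : a ≠ b → d = max a b) (hd' : d ≤ max a b)
    (he : c ≠ b → e = max c b) (he' : e ≤ max c b) (hde : d * e = a * c)
    (hf : a ≠ b → f = max a b) (hg : a ≠ c → g = max a c) (hfg : f * g = b * c)
    (hh : a ≠ c → h = max a c) (hk : b ≠ c → k = max b c) (hhk : h * k = a * b)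
    (ha0 : 0 < a) (hb0 : 0 < b) (hc0 : 0 < c) : d = c := by
  -- A strict maximum among `a`, `b`, `c` would equal both factors of the corresponding product,
  -- which is then too large. So the maximum is attained at least twice, and each remaining case
  -- gives `d = c`.
  rcases lt_trichotomy a b with hab | hab | hab
  · rw [hd hab.ne, max_eq_right hab.le]
    rcases lt_trichotomy b c with hbc | hbc | hbc
    · rw [hh (hab.trans hbc).ne, hk hbc.ne, max_eq_right hbc.le,
        max_eq_right (hab.trans hbc).le] at hhk
      nlinarith
    · exact hbc
    · rw [hd hab.ne, he hbc.ne, max_eq_right hab.le, max_eq_right hbc.le] at hde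
      nlinarith
  · subst hab
    rcases lt_trichotomy a c with hac | hac | hac
    · rw [hh hac.ne, hk hac.ne, max_eq_right hac.le] at hhk
      nlinarith
    · subst hac
      rw [max_self] at hd' he'
      exact le_antisymm hd' (le_of_mul_le_mul_right
        (hde ▸ mul_le_mul_of_nonneg_left he' hd0) ha0)
    · rw [he hac.ne, max_eq_right hac.le, mul_comm] at hde
      exact mul_left_cancel₀ ha0.ne' hde
  · rw [hd hab.ne', max_eq_left hab.le]
    rcases lt_trichotomy a c with hac | hac | hac
    · rw [hh hac.ne, hk (hab.trans hac).ne, max_eq_right hac.le,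
        max_eq_right (hab.trans hac).le] at hhk
      nlinarith
    · exact hac
    · rw [hf hab.ne', hg hac.ne', max_eq_left hac.le, max_eq_left hab.le] at hfg
      nlinarith

end ChordNorm

end WeierstrassCurve

/-! ### The kernel of reduction and its parameter -/

namespace WeierstrassCurve

section FormalSubgroup

variable {L : Type*} [NormedField L] [IsUltrametricDist L]

theorem norm_sq_add_mul_sub {a b t : L} (ha : ‖a‖ ≤ 1) (hb : ‖b‖ ≤ 1) (ht : 1 < ‖t‖) :
    ‖t ^ 2 + a * t - b‖ = ‖t‖ ^ 2 := by
  rw [← norm_pow]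
  refine norm_eq_of_norm_sub_lt ?_
  rw [show t ^ 2 + a * t - b - t ^ 2 = a * t - b by ring, norm_pow]
  refine norm_sub_lt_of_lt ?_ (by nlinarith)
  rw [norm_mul]
  nlinarith [norm_nonneg a]

theorem norm_add_mul_of_ne {u z z' : L} (hu : ‖u‖ = 1) (h : ‖z'‖ ≠ ‖z‖) :
    ‖z + u * z'‖ = max ‖z'‖ ‖z‖ := by
  have := IsUltrametricDist.norm_add_eq_max_of_norm_ne_norm (x := u * z') (y := z)
    (by rwa [norm_mul, hu, one_mul])
  rwa [norm_mul, hu, one_mul, add_comm] at this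

theorem norm_add_mul_le {u z z' : L} (hu : ‖u‖ = 1) : ‖z + u * z'‖ ≤ max ‖z'‖ ‖z‖ := by
  have := IsUltrametricDist.norm_add_le_max (u * z') z
  rwa [norm_mul, hu, one_mul, add_comm] at this

/-- The chord has the form `w = λz + μ` with `λ = -ℓ/ν` and `μ = 1/ν` both small. The product
formula at each of the three points, together with the ultrametric rule for sums of unequal size,
gives the result through `eq_of_isosceles`. -/
theorem norm_chord {a₁ a₂ a₃ a₄ a₆ x₁ x₂ x₃ ℓ ν : L}
    (h1 : ‖a₁‖ ≤ 1) (h2 : ‖a₂‖ ≤ 1) (h3 : ‖a₃‖ ≤ 1) (h4 : ‖a₄‖ ≤ 1) (h6 : ‖a₆‖ ≤ 1)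
    (hx₁ : 1 < ‖x₁‖) (hx₂ : 1 < ‖x₂‖) (hx₃ : 1 < ‖x₃‖) (hy₁ : ‖x₁‖ < ‖ℓ * x₁ + ν‖)
    (hy₂ : ‖x₂‖ < ‖ℓ * x₂ + ν‖) (hy₃ : ‖x₃‖ < ‖ℓ * x₃ + ν‖)
    (v₁ : x₁ + x₂ + x₃ = ℓ ^ 2 + a₁ * ℓ - a₂)
    (v₂ : x₁ * x₂ + x₁ * x₃ + x₂ * x₃ = a₄ - 2 * ℓ * ν - a₁ * ν - a₃ * ℓ)
    (v₃ : x₁ * x₂ * x₃ = ν ^ 2 + a₃ * ν - a₆) :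
    ‖x₂ / (ℓ * x₂ + ν) + (1 + a₁ * (x₂ / (ℓ * x₂ + ν)) + a₃ * (1 / (ℓ * x₂ + ν))) *
      (x₁ / (ℓ * x₁ + ν))‖ = ‖x₃ / (ℓ * x₃ + ν)‖ := by
  have hp12 : 1 < ‖x₁‖ * ‖x₂‖ := by nlinarith
  have hp : ∀ i ∈ ({‖x₁‖, ‖x₂‖, ‖x₃‖} : Set ℝ), i < ‖x₁ * x₂ * x₃‖ := by
    rw [norm_mul, norm_mul]
    rintro i (rfl | rfl | rfl)
    · nlinarith
    · nlinarith
    · nlinarith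
  have hν1 : 1 < ‖ν‖ := by
    by_contra! hν
    have : ‖x₁ * x₂ * x₃‖ ≤ 1 := by
      rw [v₃, sq]
      exact norm_sub_le_of_le (norm_add_le_of_le (norm_mul_le_one hν hν) (norm_mul_le_one h3 hν)) h6
    have := hp ‖x₁‖ (by simp)
    linarith
  have hνp : ‖x₁ * x₂ * x₃‖ = ‖ν‖ ^ 2 := by rw [v₃, norm_sq_add_mul_sub h3 h6 hν1]
  -- Otherwise the sum of the abscissae, of norm `‖ℓ‖²`, would be at least as large as their
  -- product, of norm `‖ν‖²`; but each abscissa is smaller than the product.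
  have hℓν : ‖ℓ‖ < ‖ν‖ := by
    by_contra! hle
    have e : ‖x₁ + x₂ + x₃‖ = ‖ℓ‖ ^ 2 := by
      rw [v₁, norm_sq_add_mul_sub h1 h2 (hν1.trans_le hle)]
    have : ‖x₁ + x₂ + x₃‖ < ‖x₁ * x₂ * x₃‖ :=
      norm_add_lt_of_lt (norm_add_lt_of_lt (hp _ (by simp)) (hp _ (by simp))) (hp _ (by simp))
    rw [e, hνp] at this
    nlinarith [norm_nonneg ν]
  have hν0 : ν ≠ 0 := norm_pos_iff.1 (one_pos.trans hν1)
  have hl : ‖-ℓ / ν‖ < 1 := by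
    rw [norm_div, norm_neg, div_lt_one (one_pos.trans hν1)]; exact hℓν
  have hμ : ‖1 / ν‖ < 1 := by
    rw [norm_div, norm_one, div_lt_one (one_pos.trans hν1)]; exact hν1
  have aux : ∀ x : L, 1 < ‖x‖ → ‖x‖ < ‖ℓ * x + ν‖ → ℓ * x + ν ≠ 0 ∧ x / (ℓ * x + ν) ≠ 0 ∧
      ‖x / (ℓ * x + ν)‖ < 1 ∧ 1 / (ℓ * x + ν) = -ℓ / ν * (x / (ℓ * x + ν)) + 1 / ν ∧
      ‖1 + a₁ * (x / (ℓ * x + ν)) + a₃ * (1 / (ℓ * x + ν))‖ = 1 := by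
    intro x hx hy
    have hx0 : x ≠ 0 := norm_pos_iff.1 (one_pos.trans hx)
    have hpos : 0 < ‖ℓ * x + ν‖ := (norm_nonneg x).trans_lt hy
    have hy0 : ℓ * x + ν ≠ 0 := norm_pos_iff.1 hpos
    have hz : ‖x / (ℓ * x + ν)‖ < 1 := by rw [norm_div, div_lt_one hpos]; exact hy
    refine ⟨hy0, div_ne_zero hx0 hy0, hz, ?_, ?_⟩
    · field_simp
      ring
    · rw [add_assoc]
      refine norm_one_add (norm_add_lt_of_lt (norm_mul_lt_one h1 hz) (norm_mul_lt_one h3 ?_))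
      rw [norm_div, norm_one, div_lt_one hpos]
      exact hx.trans hy
  obtain ⟨y₁, z₁, n₁, w₁, u₁⟩ := aux x₁ hx₁ hy₁
  obtain ⟨y₂, z₂, n₂, w₂, u₂⟩ := aux x₂ hx₂ hy₂
  obtain ⟨y₃, z₃, n₃, w₃, u₃⟩ := aux x₃ hx₃ hy₃
  obtain ⟨e₁, e₂, e₃⟩ := chord_viete hν0 y₁ y₂ y₃ v₁ v₂ v₃ rfl rfl rfl rfl rfl rfl
  have p₂ := norm_chord_identity h1 h2 h3 h4 h6 hl hμ n₂ z₂ rfl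
    (by rw [← w₂]) e₁ e₂ e₃
  have p₁ := norm_chord_identity (z₁ := x₂ / (ℓ * x₂ + ν)) (z₃ := x₃ / (ℓ * x₃ + ν))
    h1 h2 h3 h4 h6 hl hμ n₁ z₁ rfl (by rw [← w₁])
    (by rw [e₁]; ring) (by rw [e₂]; ring) (by rw [e₃]; ring)
  have p₃ := norm_chord_identity (z₁ := x₁ / (ℓ * x₁ + ν)) (z₃ := x₂ / (ℓ * x₂ + ν))
    h1 h2 h3 h4 h6 hl hμ n₃ z₃ rfl (by rw [← w₃])
    (by rw [e₁]; ring) (by rw [e₂]; ring) (by rw [e₃]; ring)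
  exact eq_of_isosceles (norm_nonneg _) (norm_add_mul_of_ne u₂) (norm_add_mul_le u₂)
    (norm_add_mul_of_ne u₂) (norm_add_mul_le u₂) p₂
    (fun h => (norm_add_mul_of_ne u₁ h.symm).trans (max_comm _ _))
    (fun h => (norm_add_mul_of_ne u₁ h.symm).trans (max_comm _ _)) p₁
    (norm_add_mul_of_ne u₃) (norm_add_mul_of_ne u₃) p₃
    (norm_pos_iff.2 z₁) (norm_pos_iff.2 z₂) (norm_pos_iff.2 z₃)

variable {V : Subring L} (hV : ∀ x, x ∈ V ↔ ‖x‖ ≤ 1) (W : WeierstrassCurve V)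

/-- The points reducing to zero: those without integral coordinates. -/
def formalSubgroup : AddSubgroup (W.map V.subtype).toAffine.Point where
  carrier := {P | ∀ x y h, P = .some x y h → x ∉ V}
  zero_mem' := fun x y h e => absurd e.symm (Affine.Point.some_ne_zero h)
  add_mem' := by
    rintro (_ | ⟨x₁, y₁, h₁⟩) (_ | ⟨x₂, y₂, h₂⟩) hP hQ
    · exact fun x y h e => absurd e.symm (Affine.Point.some_ne_zero h)
    · exact hQ
    · exact hP
    · have hx₁ := hP x₁ y₁ h₁ rfl
      have hx₂ := hQ x₂ y₂ h₂ rfl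
      intro x y h e
      by_cases hxy : x₁ = x₂ ∧ y₁ = (W.map V.subtype).toAffine.negY x₂ y₂
      · rw [Affine.Point.add_of_Y_eq hxy.1 hxy.2] at e
        exact absurd e.symm (Affine.Point.some_ne_zero h)
      · rw [Affine.Point.add_some hxy, Affine.Point.some.injEq] at e
        rw [← e.1]
        exact addX_notMem hV W h₁ h₂ hxy hx₁ hx₂
  neg_mem' := by
    rintro (_ | ⟨x₁, y₁, h₁⟩) hP x y h e
    · exact absurd e.symm (Affine.Point.some_ne_zero h)
    · rw [Affine.Point.neg_some, Affine.Point.some.injEq] at e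
      rw [← e.1]
      exact hP x₁ y₁ h₁ rfl

theorem some_mem_formalSubgroup {x y : L} (h : (W.map V.subtype).toAffine.Nonsingular x y) :
    .some x y h ∈ formalSubgroup hV W ↔ x ∉ V :=
  ⟨fun hP => hP x y h rfl, fun hx x' y' h' e => by
    rw [Affine.Point.some.injEq] at e
    rwa [← e.1]⟩

/-- The parameter `z = x / y` at the origin. -/
noncomputable def paramZ {W' : WeierstrassCurve L} : W'.toAffine.Point → L
  | .zero => 0
  | .some x y _ => x / y

/-- The function `w = 1 / y`. -/
noncomputable def paramW {W' : WeierstrassCurve L} : W'.toAffine.Point → L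
  | .zero => 0
  | .some _ y _ => 1 / y

omit [IsUltrametricDist L] in
theorem paramZ_some {W' : WeierstrassCurve L} {x y : L} (h : W'.toAffine.Nonsingular x y) :
    paramZ (.some x y h) = x / y := rfl

omit [IsUltrametricDist L] in
theorem paramW_some {W' : WeierstrassCurve L} {x y : L} (h : W'.toAffine.Nonsingular x y) :
    paramW (.some x y h) = 1 / y := rfl

omit [IsUltrametricDist L] in
theorem paramZ_zero {W' : WeierstrassCurve L} : paramZ (0 : W'.toAffine.Point) = 0 := rfl

include hV in
theorem norm_x_lt_norm_y {x y : L} (h : (W.map V.subtype).toAffine.Equation x y) (hx : x ∉ V) :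
    1 < ‖x‖ ∧ ‖x‖ < ‖y‖ := by
  rw [hV, not_le] at hx
  have h1 := norm_y_sq_of_one_lt_norm_x hV W h hx
  refine ⟨hx, lt_of_pow_lt_pow_left₀ 2 (norm_nonneg y) ?_⟩
  rw [h1]
  exact pow_lt_pow_right₀ hx (by norm_num)

variable {W}

theorem paramZ_eq_zero_iff {P : (W.map V.subtype).toAffine.Point} (hP : P ∈ formalSubgroup hV W) :
    paramZ P = 0 ↔ P = 0 := by
  rcases P with _ | ⟨x, y, h⟩
  · exact ⟨fun _ => rfl, fun _ => rfl⟩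
  · rw [some_mem_formalSubgroup] at hP
    obtain ⟨h1, h2⟩ := norm_x_lt_norm_y hV W h.1 hP
    refine ⟨fun h0 => ?_, fun h0 => absurd h0 (Affine.Point.some_ne_zero h)⟩
    exact absurd h0 (div_ne_zero (norm_pos_iff.1 (by linarith)) (norm_pos_iff.1 (by linarith)))

theorem norm_paramZ_lt_one {P : (W.map V.subtype).toAffine.Point}
    (hP : P ∈ formalSubgroup hV W) : ‖paramZ P‖ < 1 := by
  rcases P with _ | ⟨x, y, h⟩
  · exact norm_zero.trans_lt one_pos
  · rw [some_mem_formalSubgroup] at hP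
    obtain ⟨h1, h2⟩ := norm_x_lt_norm_y hV W h.1 hP
    rw [paramZ_some, norm_div, div_lt_one (by linarith)]
    exact h2

theorem norm_paramW_lt_one {P : (W.map V.subtype).toAffine.Point}
    (hP : P ∈ formalSubgroup hV W) : ‖paramW P‖ < 1 := by
  rcases P with _ | ⟨x, y, h⟩
  · exact norm_zero.trans_lt one_pos
  · rw [some_mem_formalSubgroup] at hP
    obtain ⟨h1, h2⟩ := norm_x_lt_norm_y hV W h.1 hP
    rw [paramW_some, norm_div, norm_one, div_lt_one (by linarith)]
    linarith

/-- Negation sends `y` to `-y - a₁x - a₃`, which is `-y(1 + a₁z + a₃w)`. -/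
theorem paramZ_neg_mul {P : (W.map V.subtype).toAffine.Point} (hP : P ∈ formalSubgroup hV W) :
    paramZ (-P) * (1 + W.a₁ * paramZ P + W.a₃ * paramW P) = -paramZ P := by
  have hP' := (formalSubgroup hV W).neg_mem hP
  rcases P with _ | ⟨x, y, h⟩
  · change (0 : L) * _ = -0
    rw [zero_mul, neg_zero]
  · rw [Affine.Point.neg_some] at hP' ⊢
    rw [some_mem_formalSubgroup] at hP hP'
    have hy := (norm_x_lt_norm_y hV W h.1 hP).2
    have hy' := (norm_x_lt_norm_y hV W ((Affine.nonsingular_neg ..).2 h).1 hP').2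
    have hy0 : y ≠ 0 := norm_pos_iff.1 ((norm_nonneg x).trans_lt hy)
    have hy0' := norm_pos_iff.1 ((norm_nonneg x).trans_lt hy')
    rw [paramZ_some, paramZ_some, paramW_some, div_mul_eq_mul_div, div_eq_iff hy0', Affine.negY]
    simp only [map_a₁, map_a₃, Subring.subtype_apply]
    field_simp
    ring

theorem norm_one_add_param {P : (W.map V.subtype).toAffine.Point}
    (hP : P ∈ formalSubgroup hV W) : ‖1 + W.a₁ * paramZ P + W.a₃ * paramW P‖ = 1 := by
  rw [add_assoc]
  exact norm_one_add (norm_add_lt_of_lt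
    (norm_mul_lt_one (norm_coe_le_one hV _) (norm_paramZ_lt_one hV hP))
    (norm_mul_lt_one (norm_coe_le_one hV _) (norm_paramW_lt_one hV hP)))

theorem norm_paramZ_neg {P : (W.map V.subtype).toAffine.Point}
    (hP : P ∈ formalSubgroup hV W) : ‖paramZ (-P)‖ = ‖paramZ P‖ := by
  have := congrArg norm (paramZ_neg_mul hV hP)
  rwa [norm_mul, norm_one_add_param hV hP, mul_one, norm_neg] at this

/-- The parameter `z` is an isometry from the formal group to the maximal ideal. -/
theorem norm_paramZ_sub {P Q : (W.map V.subtype).toAffine.Point} (hP : P ∈ formalSubgroup hV W)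
    (hQ : Q ∈ formalSubgroup hV W) : ‖paramZ (P - Q)‖ = ‖paramZ P - paramZ Q‖ := by
  by_cases hPQ : P = Q
  · rw [hPQ, sub_self, sub_self, paramZ_zero]
  by_cases hP0 : P = 0
  · rw [hP0, zero_sub, norm_paramZ_neg hV hQ, paramZ_zero, zero_sub, norm_neg]
  by_cases hQ0 : Q = 0
  · rw [hQ0, sub_zero, paramZ_zero, sub_zero]
  -- With `Q = -R`, the point `-(P - Q)` is the third point on the chord through `P` and `R`.
  obtain ⟨R, rfl⟩ : ∃ R, Q = -R := ⟨-Q, (neg_neg Q).symm⟩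
  rw [neg_mem_iff] at hQ
  have hPR := (formalSubgroup hV W).add_mem hP hQ
  have hzR := paramZ_neg_mul hV hQ
  have hu := norm_one_add_param hV hQ
  rw [sub_neg_eq_add, ← norm_paramZ_neg hV hPR]
  have e : ‖paramZ P - paramZ (-R)‖ =
      ‖paramZ R + (1 + W.a₁ * paramZ R + W.a₃ * paramW R) * paramZ P‖ := by
    rw [← mul_one ‖paramZ P - paramZ (-R)‖, ← hu, ← norm_mul]
    congr 1
    linear_combination -hzR
  rw [e]
  rcases P with _ | ⟨x₁, y₁, h₁⟩
  · exact absurd rfl hP0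
  rcases R with _ | ⟨x₂, y₂, h₂⟩
  · exact absurd rfl hQ0
  by_cases hxy : x₁ = x₂ ∧ y₁ = (W.map V.subtype).toAffine.negY x₂ y₂
  · refine absurd ?_ hPQ
    rw [Affine.Point.neg_some, Affine.Point.some.injEq]
    exact hxy
  obtain ⟨ℓ, ν, hℓ, hy₁, hy₂, v₁, v₂, v₃⟩ := viete_slope h₁.1 h₂.1 hxy
  have h₃ := Affine.nonsingular_negAdd h₁ h₂ hxy
  have e₃ : -(.some x₁ y₁ h₁ + .some x₂ y₂ h₂ : (W.map V.subtype).toAffine.Point) =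
      .some _ _ h₃ := by
    rw [Affine.Point.add_some hxy, Affine.Point.neg_some, Affine.Point.some.injEq]
    exact ⟨rfl, Affine.negY_negY ..⟩
  have hmem := (formalSubgroup hV W).neg_mem hPR
  rw [e₃] at hmem ⊢
  rw [some_mem_formalSubgroup] at hP hQ hmem
  obtain ⟨n₁, m₁⟩ := norm_x_lt_norm_y hV W h₁.1 hP
  obtain ⟨n₂, m₂⟩ := norm_x_lt_norm_y hV W h₂.1 hQ
  obtain ⟨n₃, m₃⟩ := norm_x_lt_norm_y hV W h₃.1 hmem
  rw [paramZ_some, paramZ_some, paramW_some, paramZ_some]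
  have hy₃ : (W.map V.subtype).toAffine.negAddY x₁ x₂ y₁
      ((W.map V.subtype).toAffine.slope x₁ x₂ y₁ y₂) =
      ℓ * (W.map V.subtype).toAffine.addX x₁ x₂
        ((W.map V.subtype).toAffine.slope x₁ x₂ y₁ y₂) + ν := by
    rw [Affine.negAddY, hℓ]
    linear_combination hy₁
  rw [hy₃] at m₃ ⊢
  rw [hℓ] at n₃ m₃ ⊢
  simp only [map_a₁, map_a₂, map_a₃, map_a₄, map_a₆, Subring.subtype_apply] at v₁ v₂ v₃
  rw [hy₁] at m₁ ⊢
  rw [hy₂] at m₂ ⊢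
  exact (norm_chord (norm_coe_le_one hV W.a₁) (norm_coe_le_one hV W.a₂) (norm_coe_le_one hV W.a₃)
    (norm_coe_le_one hV W.a₄) (norm_coe_le_one hV W.a₆) n₁ n₂ n₃ m₁ m₂ m₃ v₁
    (by rw [← v₂]; ring) v₃).symm

end FormalSubgroup

end WeierstrassCurve

/-! ### Odd divisibility of the kernel of reduction -/

namespace WeierstrassCurve

section CoordSubgroup

variable {L : Type*} [Field L] (W : WeierstrassCurve L) (F : Subfield L)
  (h₁ : W.a₁ ∈ F) (h₂ : W.a₂ ∈ F) (h₃ : W.a₃ ∈ F) (h₄ : W.a₄ ∈ F)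

include h₁ h₂ h₃ h₄ in
theorem slope_mem {x₁ x₂ y₁ y₂ : L} (hx₁ : x₁ ∈ F) (hx₂ : x₂ ∈ F) (hy₁ : y₁ ∈ F) (hy₂ : y₂ ∈ F) :
    W.toAffine.slope x₁ x₂ y₁ y₂ ∈ F := by
  have n2 : (2 : L) ∈ F := ofNat_mem F 2
  have n3 : (3 : L) ∈ F := ofNat_mem F 3
  rw [Affine.slope]
  have hn : ∀ x y : L, x ∈ F → y ∈ F → W.toAffine.negY x y ∈ F := fun x y hx hy =>
    F.sub_mem (F.sub_mem (F.neg_mem hy) (F.mul_mem h₁ hx)) h₃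
  split_ifs
  · exact F.zero_mem
  · exact F.div_mem (F.sub_mem (F.add_mem (F.add_mem (F.mul_mem n3 (pow_mem hx₁ 2))
      (F.mul_mem (F.mul_mem n2 h₂) hx₁)) h₄) (F.mul_mem h₁ hy₁)) (F.sub_mem hy₁ (hn _ _ hx₁ hy₁))
  · exact F.div_mem (F.sub_mem hy₁ hy₂) (F.sub_mem hx₁ hx₂)

/-- The points with coordinates in a subfield containing the coefficients. -/
def coordSubgroup : AddSubgroup W.toAffine.Point where
  carrier := {P | ∀ x y h, P = .some x y h → x ∈ F ∧ y ∈ F}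
  zero_mem' := fun x y h e => absurd e.symm (Affine.Point.some_ne_zero h)
  add_mem' := by
    rintro (_ | ⟨x₁, y₁, k₁⟩) (_ | ⟨x₂, y₂, k₂⟩) hP hQ
    · exact fun x y h e => absurd e.symm (Affine.Point.some_ne_zero h)
    · exact hQ
    · exact hP
    · obtain ⟨hx₁, hy₁⟩ := hP x₁ y₁ k₁ rfl
      obtain ⟨hx₂, hy₂⟩ := hQ x₂ y₂ k₂ rfl
      intro x y h e
      by_cases hxy : x₁ = x₂ ∧ y₁ = W.toAffine.negY x₂ y₂
      · rw [Affine.Point.add_of_Y_eq hxy.1 hxy.2] at e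
        exact absurd e.symm (Affine.Point.some_ne_zero h)
      · have hs := slope_mem W F h₁ h₂ h₃ h₄ hx₁ hx₂ hy₁ hy₂
        rw [Affine.Point.add_some hxy, Affine.Point.some.injEq] at e
        generalize W.toAffine.slope x₁ x₂ y₁ y₂ = ℓ at e hs
        have hX : W.toAffine.addX x₁ x₂ ℓ ∈ F := F.sub_mem (F.sub_mem (F.sub_mem
          (F.add_mem (pow_mem hs 2) (F.mul_mem h₁ hs)) h₂) hx₁) hx₂
        rw [← e.1, ← e.2]
        exact ⟨hX, F.sub_mem (F.sub_mem (F.neg_mem (F.add_mem (F.mul_mem hs (F.sub_mem hX hx₁)) hy₁))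
          (F.mul_mem h₁ hX)) h₃⟩
  neg_mem' := by
    rintro (_ | ⟨x₁, y₁, k₁⟩) hP x y h e
    · exact absurd e.symm (Affine.Point.some_ne_zero h)
    · obtain ⟨hx₁, hy₁⟩ := hP x₁ y₁ k₁ rfl
      rw [Affine.Point.neg_some, Affine.Point.some.injEq] at e
      rw [← e.1, ← e.2]
      exact ⟨hx₁, F.sub_mem (F.sub_mem (F.neg_mem hy₁) (F.mul_mem h₁ hx₁)) h₃⟩

end CoordSubgroup

section FormalSubgroup

variable {L : Type*} [NormedField L] [IsUltrametricDist L]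
  {V : Subring L} (hV : ∀ x, x ∈ V ↔ ‖x‖ ≤ 1) {W : WeierstrassCurve V}

theorem norm_paramZ_add_le {P Q : (W.map V.subtype).toAffine.Point}
    (hP : P ∈ formalSubgroup hV W) (hQ : Q ∈ formalSubgroup hV W) {c : ℝ}
    (hc : ‖paramZ P‖ ≤ c) (hc' : ‖paramZ Q‖ ≤ c) : ‖paramZ (P + Q)‖ ≤ c := by
  have := norm_paramZ_sub hV hP ((formalSubgroup hV W).neg_mem hQ)
  rw [sub_neg_eq_add] at this
  rw [this]
  exact norm_sub_le_of_le hc (by rwa [norm_paramZ_neg hV hQ])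

theorem norm_paramZ_zsmul_le {P : (W.map V.subtype).toAffine.Point}
    (hP : P ∈ formalSubgroup hV W) (n : ℤ) : ‖paramZ (n • P)‖ ≤ ‖paramZ P‖ := by
  have hnat : ∀ n : ℕ, ‖paramZ (n • P)‖ ≤ ‖paramZ P‖ := by
    intro n
    induction n with
    | zero => rw [zero_smul, paramZ_zero, norm_zero]; exact norm_nonneg _
    | succ n ih =>
      rw [succ_nsmul]
      exact norm_paramZ_add_le hV ((formalSubgroup hV W).nsmul_mem hP n) hP ih le_rfl
  obtain ⟨m, rfl | rfl⟩ := n.eq_nat_or_neg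
  · rw [natCast_zsmul]; exact hnat m
  · rw [neg_smul, natCast_zsmul, norm_paramZ_neg hV ((formalSubgroup hV W).nsmul_mem hP m)]
    exact hnat m

theorem norm_paramW_le_norm_paramZ {P : (W.map V.subtype).toAffine.Point}
    (hP : P ∈ formalSubgroup hV W) : ‖paramW P‖ ≤ ‖paramZ P‖ := by
  rcases P with _ | ⟨x, y, h⟩
  · exact le_rfl
  · rw [some_mem_formalSubgroup] at hP
    have := (norm_x_lt_norm_y hV W h.1 hP).1.le
    rw [paramZ_some, paramW_some, norm_div, norm_div, norm_one]
    gcongr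

/-- By the isometry the size of `z(2P)` is that of `z(P) - z(-P)`, which equals `z(2 + a₁z + a₃w)`
up to a unit. -/
theorem norm_paramZ_two_zsmul_le {P : (W.map V.subtype).toAffine.Point}
    (hP : P ∈ formalSubgroup hV W) {c : ℝ} (h2 : ‖(2 : L)‖ ≤ c) (hc : ‖paramZ P‖ ≤ c) :
    ‖paramZ ((2 : ℤ) • P)‖ ≤ c * ‖paramZ P‖ := by
  have h := norm_paramZ_sub hV hP ((formalSubgroup hV W).neg_mem hP)
  rw [sub_neg_eq_add, ← two_zsmul] at h
  rw [h, ← mul_one ‖paramZ P - paramZ (-P)‖, ← norm_one_add_param hV hP, ← norm_mul,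
    show (paramZ P - paramZ (-P)) * (1 + W.a₁ * paramZ P + W.a₃ * paramW P) =
      paramZ P * (2 + W.a₁ * paramZ P + W.a₃ * paramW P) by
        linear_combination -paramZ_neg_mul hV hP, norm_mul, mul_comm]
  refine mul_le_mul_of_nonneg_right (norm_add_le_of_le (norm_add_le_of_le h2 ?_) ?_) (norm_nonneg _)
  · rw [norm_mul]
    exact (mul_le_of_le_one_left (norm_nonneg _) (norm_coe_le_one hV _)).trans hc
  · rw [norm_mul]
    exact (mul_le_of_le_one_left (norm_nonneg _) (norm_coe_le_one hV _)).trans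
      ((norm_paramW_le_norm_paramZ hV hP).trans hc)

theorem norm_paramZ_even_zsmul_le {P : (W.map V.subtype).toAffine.Point}
    (hP : P ∈ formalSubgroup hV W) {c : ℝ} (h2 : ‖(2 : L)‖ ≤ c) (hc : ‖paramZ P‖ ≤ c) (m : ℤ) :
    ‖paramZ ((2 * m) • P)‖ ≤ c * ‖paramZ P‖ := by
  have h := norm_paramZ_zsmul_le hV hP m
  rw [mul_smul]
  refine (norm_paramZ_two_zsmul_le hV ((formalSubgroup hV W).zsmul_mem hP m) h2
    (h.trans hc)).trans ?_
  have : 0 ≤ c := (norm_nonneg _).trans h2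
  gcongr

/-- An odd multiple of `P` is `P` minus an even multiple, and the parameter of the latter is
strictly smaller. -/
theorem norm_paramZ_odd_zsmul {P : (W.map V.subtype).toAffine.Point}
    (hP : P ∈ formalSubgroup hV W) (h2 : ‖(2 : L)‖ < 1) {n : ℤ} (hn : Odd n) :
    ‖paramZ (n • P)‖ = ‖paramZ P‖ := by
  obtain ⟨m, rfl⟩ := hn
  by_cases hz : paramZ P = 0
  · rw [paramZ_eq_zero_iff hV hP] at hz
    rw [hz, smul_zero]
  have h := norm_paramZ_even_zsmul_le hV hP (c := max ‖(2 : L)‖ ‖paramZ P‖)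
    (le_max_left _ _) (le_max_right _ _) (-m)
  have hc : max ‖(2 : L)‖ ‖paramZ P‖ < 1 := max_lt h2 (norm_paramZ_lt_one hV hP)
  have hpos : 0 < ‖paramZ P‖ := norm_pos_iff.2 hz
  have e : (2 * m + 1) • P = P - (2 * -m) • P := by
    rw [mul_neg, neg_smul, sub_neg_eq_add, add_smul, one_smul, add_comm]
  rw [e, norm_paramZ_sub hV hP ((formalSubgroup hV W).zsmul_mem hP _)]
  refine norm_eq_of_norm_sub_lt ?_
  rw [sub_sub_cancel_left, norm_neg]
  nlinarith

theorem eq_zero_of_odd_zsmul_eq_zero {P : (W.map V.subtype).toAffine.Point}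
    (hP : P ∈ formalSubgroup hV W) (h2 : ‖(2 : L)‖ < 1) {n : ℤ} (hn : Odd n) (h : n • P = 0) :
    P = 0 := by
  rw [← paramZ_eq_zero_iff hV hP, ← norm_eq_zero, ← norm_paramZ_odd_zsmul hV hP h2 hn, h,
    paramZ_zero, norm_zero]

omit [IsUltrametricDist L] in
theorem param_equation {P : (W.map V.subtype).toAffine.Point}
    (hP : paramW P = 0 → P = 0) :
    paramW P + W.a₁ * paramZ P * paramW P + W.a₃ * paramW P ^ 2 =
      paramZ P ^ 3 + W.a₂ * paramZ P ^ 2 * paramW P + W.a₄ * paramZ P * paramW P ^ 2 +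
        W.a₆ * paramW P ^ 3 := by
  rcases P with _ | ⟨x, y, h⟩
  · change (0 : L) + _ * 0 * 0 + _ * 0 ^ 2 = 0 ^ 3 + _ * 0 ^ 2 * 0 + _ * 0 * 0 ^ 2 + _ * 0 ^ 3
    ring
  · have hy : y ≠ 0 := fun hy =>
      Affine.Point.some_ne_zero h (hP (by rw [paramW_some, hy, div_zero]))
    have he := (Affine.equation_iff _ _).1 h.1
    simp only [map_a₁, map_a₂, map_a₃, map_a₄, map_a₆, Subring.subtype_apply] at he
    rw [paramZ_some, paramW_some]
    field_simp
    linear_combination he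

theorem eq_zero_of_paramW_eq_zero {P : (W.map V.subtype).toAffine.Point}
    (hP : P ∈ formalSubgroup hV W) (h : paramW P = 0) : P = 0 := by
  rcases P with _ | ⟨x, y, h'⟩
  · rfl
  · rw [some_mem_formalSubgroup] at hP
    have := norm_x_lt_norm_y hV W h'.1 hP
    have hy : y ≠ 0 := norm_pos_iff.1 (by linarith)
    exact absurd h (one_div_ne_zero hy)

/-- The difference of the two curve equations is `(W₁ - W₂)` times a unit equal to `(Z₁ - Z₂)` times
an integral element. Convergence of `z` thus forces convergence of `w`. -/
theorem norm_paramW_sub_le {P Q : (W.map V.subtype).toAffine.Point}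
    (hP : P ∈ formalSubgroup hV W) (hQ : Q ∈ formalSubgroup hV W) :
    ‖paramW P - paramW Q‖ ≤ ‖paramZ P - paramZ Q‖ := by
  have eP := param_equation (eq_zero_of_paramW_eq_zero hV hP)
  have eQ := param_equation (eq_zero_of_paramW_eq_zero hV hQ)
  have z₁ := norm_paramZ_lt_one hV hP
  have z₂ := (norm_paramZ_lt_one hV hQ).le
  have w₁ := norm_paramW_lt_one hV hP
  have w₂ := norm_paramW_lt_one hV hQ
  have h1 := norm_coe_le_one hV W.a₁
  have h2 := norm_coe_le_one hV W.a₂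
  have h3 := norm_coe_le_one hV W.a₃
  have h4 := norm_coe_le_one hV W.a₄
  have h6 := norm_coe_le_one hV W.a₆
  generalize paramZ P = Z₁ at *
  generalize paramZ Q = Z₂ at *
  generalize paramW P = W₁ at *
  generalize paramW Q = W₂ at *
  have key : (W₁ - W₂) * (1 + (W.a₁ * Z₁ + W.a₃ * (W₁ + W₂) - W.a₂ * Z₁ * Z₁ -
      W.a₄ * Z₁ * (W₁ + W₂) - (W.a₆ * W₁ * (W₁ + W₂) + W.a₆ * W₂ * W₂))) =
      (Z₁ - Z₂) * (Z₁ * Z₁ + Z₁ * Z₂ + Z₂ * Z₂ + W.a₂ * (Z₁ + Z₂) * W₂ + W.a₄ * W₂ * W₂ -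
        W.a₁ * W₂) := by
    linear_combination eP - eQ
  have hW := norm_add_lt_of_lt w₁ w₂
  have hZ := norm_add_le_of_le z₁.le z₂
  have k := congrArg norm key
  rw [norm_mul, norm_mul, norm_one_add, mul_one] at k
  · rw [k]
    refine mul_le_of_le_one_right (norm_nonneg _) ?_
    refine norm_sub_le_of_le (norm_add_le_of_le (norm_add_le_of_le (norm_add_le_of_le
      (norm_add_le_of_le ?_ ?_) ?_) ?_) ?_) ?_
    · exact norm_mul_le_one z₁.le z₁.le
    · exact norm_mul_le_one z₁.le z₂
    · exact norm_mul_le_one z₂ z₂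
    · exact norm_mul_le_one (norm_mul_le_one h2 hZ) w₂.le
    · exact norm_mul_le_one (norm_mul_le_one h4 w₂.le) w₂.le
    · exact norm_mul_le_one h1 w₂.le
  · refine norm_sub_lt_of_lt (norm_sub_lt_of_lt (norm_sub_lt_of_lt (norm_add_lt_of_lt
      (norm_mul_lt_one h1 z₁) (norm_mul_lt_one h3 hW)) ?_) ?_) (norm_add_lt_of_lt ?_ ?_)
    · exact norm_mul_lt_one (norm_mul_le_one h2 z₁.le) z₁
    · exact norm_mul_lt_one (norm_mul_le_one h4 z₁.le) hW
    · exact norm_mul_lt_one (norm_mul_le_one h6 w₁.le) hW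
    · exact norm_mul_lt_one (norm_mul_le_one h6 w₂.le) w₂

theorem exists_mem_formalSubgroup_of_param [(W.map V.subtype).IsElliptic] {z w : L}
    (hw : ‖w‖ < 1) (he : w + W.a₁ * z * w + W.a₃ * w ^ 2 =
      z ^ 3 + W.a₂ * z ^ 2 * w + W.a₄ * z * w ^ 2 + W.a₆ * w ^ 3) :
    ∃ P ∈ formalSubgroup hV W, paramZ P = z := by
  by_cases hw0 : w = 0
  · subst hw0
    refine ⟨0, zero_mem _, ?_⟩
    have : z ^ 3 = 0 := by linear_combination -he
    rw [paramZ_zero, pow_eq_zero_iff (by norm_num) |>.1 this]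
  · have hE : (W.map V.subtype).toAffine.Equation (z / w) (1 / w) := by
      rw [Affine.equation_iff]
      simp only [map_a₁, map_a₂, map_a₃, map_a₄, map_a₆, Subring.subtype_apply]
      field_simp
      linear_combination he
    refine ⟨.some _ _ (Affine.equation_iff_nonsingular.1 hE), ?_, ?_⟩
    · rw [some_mem_formalSubgroup]
      intro hx
      have := y_mem_of_x_mem hV W hE hx
      rw [hV, norm_div, norm_one, div_le_one (norm_pos_iff.2 hw0)] at this
      linarith
    · rw [paramZ_some]
      field_simp

open Filter Topology in
/-- The formal group is divisible by odd numbers, over a complete field of coordinates. -/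
theorem exists_mem_formalSubgroup_zsmul_eq [(W.map V.subtype).IsElliptic]
    {P : (W.map V.subtype).toAffine.Point} (hP : P ∈ formalSubgroup hV W) (h2 : ‖(2 : L)‖ < 1)
    {n : ℤ} (hn : Odd n) (F : Subfield L) (hF : IsComplete (F : Set L))
    (h₁ : (W.map V.subtype).a₁ ∈ F) (h₂ : (W.map V.subtype).a₂ ∈ F)
    (h₃ : (W.map V.subtype).a₃ ∈ F) (h₄ : (W.map V.subtype).a₄ ∈ F)
    (hPF : P ∈ coordSubgroup (W.map V.subtype) F h₁ h₂ h₃ h₄) :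
    ∃ Q ∈ formalSubgroup hV W, n • Q = P := by
  set G := formalSubgroup hV W
  obtain ⟨m, rfl⟩ := hn
  set c := max ‖(2 : L)‖ ‖paramZ P‖
  have hc1 : c < 1 := max_lt h2 (norm_paramZ_lt_one hV hP)
  have hc0 : 0 ≤ c := (norm_nonneg _).trans (le_max_left _ _)
  -- Terms of the geometric series for the inverse of `2m + 1 = 1 - 2(-m)`, applied to `P`; each
  -- even factor shrinks the parameter by at least `c < 1`.
  set T : ℕ → (W.map V.subtype).toAffine.Point := fun j => ((2 * -m) ^ j) • P
  have hTG : ∀ j, T j ∈ G := fun j => G.zsmul_mem hP _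
  have hT : ∀ j, ‖paramZ (T j)‖ ≤ 1 * c ^ j := by
    intro j
    induction j with
    | zero =>
      change ‖paramZ (((2 * -m) ^ 0) • P)‖ ≤ _
      rw [pow_zero, one_smul, pow_zero, mul_one]
      exact (norm_paramZ_lt_one hV hP).le
    | succ j ih =>
      change ‖paramZ (((2 * -m) ^ (j + 1)) • P)‖ ≤ _
      rw [pow_succ', mul_smul]
      refine (norm_paramZ_even_zsmul_le hV (hTG j) (le_max_left _ _)
        ((norm_paramZ_zsmul_le hV hP _).trans (le_max_right _ _)) (-m)).trans ?_
      calc c * ‖paramZ (T j)‖ ≤ c * (1 * c ^ j) := by gcongr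
        _ = _ := by ring
  set S : ℕ → (W.map V.subtype).toAffine.Point := fun J => ∑ j ∈ Finset.range J, T j
  have hSG : ∀ J, S J ∈ G := fun J => sum_mem fun j _ => hTG j
  have hSF : ∀ J, S J ∈ coordSubgroup (W.map V.subtype) F h₁ h₂ h₃ h₄ := fun J =>
    sum_mem fun j _ => zsmul_mem hPF _
  have hSz : ∀ J, paramZ (S J) ∈ F ∧ paramW (S J) ∈ F := by
    intro J
    have := hSF J
    generalize S J = R at this ⊢
    rcases R with _ | ⟨x, y, h⟩
    · exact ⟨F.zero_mem, F.zero_mem⟩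
    · obtain ⟨hx, hy⟩ := this x y h rfl
      exact ⟨F.div_mem hx hy, F.div_mem F.one_mem hy⟩
  have hdz : ∀ J, dist (paramZ (S J)) (paramZ (S (J + 1))) ≤ 1 * c ^ J := by
    intro J
    rw [dist_comm, dist_eq_norm, ← norm_paramZ_sub hV (hSG _) (hSG _)]
    have : S (J + 1) - S J = T J := by
      simp only [S, Finset.sum_range_succ, add_sub_cancel_left]
    rw [this]
    exact hT J
  have hdw : ∀ J, dist (paramW (S J)) (paramW (S (J + 1))) ≤ 1 * c ^ J := by
    intro J
    refine le_trans ?_ (hdz J)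
    rw [dist_eq_norm, dist_eq_norm]
    exact norm_paramW_sub_le hV (hSG _) (hSG _)
  -- Partial sums keep their coordinates in `F`, so limits exist although `L` itself need not be
  -- complete.
  obtain ⟨z, -, hz⟩ := cauchySeq_tendsto_of_isComplete hF (fun J => (hSz J).1)
    (cauchySeq_of_le_geometric c 1 hc1 hdz)
  obtain ⟨w, -, hw⟩ := cauchySeq_tendsto_of_isComplete hF (fun J => (hSz J).2)
    (cauchySeq_of_le_geometric c 1 hc1 hdw)
  have he : w + W.a₁ * z * w + W.a₃ * w ^ 2 =
      z ^ 3 + W.a₂ * z ^ 2 * w + W.a₄ * z * w ^ 2 + W.a₆ * w ^ 3 := by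
    refine tendsto_nhds_unique (f := fun J => paramW (S J) + W.a₁ * paramZ (S J) * paramW (S J) +
      W.a₃ * paramW (S J) ^ 2) (l := atTop) ?_ ?_
    · exact (hw.add ((hz.const_mul _).mul hw)).add ((hw.pow 2).const_mul _)
    · have : (fun J => paramW (S J) + W.a₁ * paramZ (S J) * paramW (S J) +
          W.a₃ * paramW (S J) ^ 2) = fun J => paramZ (S J) ^ 3 +
          W.a₂ * paramZ (S J) ^ 2 * paramW (S J) + W.a₄ * paramZ (S J) * paramW (S J) ^ 2 +
            W.a₆ * paramW (S J) ^ 3 := funext fun J =>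
        param_equation (eq_zero_of_paramW_eq_zero hV (hSG J))
      rw [this]
      exact (((hz.pow 3).add (((hz.pow 2).const_mul _).mul hw)).add
        ((hz.const_mul _).mul (hw.pow 2))).add ((hw.pow 3).const_mul _)
  have hw1 : ‖w‖ < 1 := by
    obtain ⟨J, hJ⟩ := ((tendsto_iff_norm_sub_tendsto_zero.1 hw).eventually_lt_const
      one_pos).exists
    have e : w = paramW (S J) - (paramW (S J) - w) := by ring
    rw [e]
    exact norm_sub_lt_of_lt (norm_paramW_lt_one hV (hSG J)) hJ
  obtain ⟨Q, hQ, rfl⟩ := exists_mem_formalSubgroup_of_param hV hw1 he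
  refine ⟨Q, hQ, ?_⟩
  rw [← sub_eq_zero, ← paramZ_eq_zero_iff hV (G.sub_mem (G.zsmul_mem hQ _) hP), ← norm_le_zero_iff]
  have hlim : Tendsto (fun J => ‖paramZ (S J) - paramZ Q‖ + c ^ J) atTop (𝓝 0) := by
    simpa using (tendsto_iff_norm_sub_tendsto_zero.1 hz).add
      (tendsto_pow_atTop_nhds_zero_of_lt_one hc0 hc1)
  refine ge_of_tendsto' hlim fun J => ?_
  -- The series telescopes; the error `T J` tends to zero.
  have hS : (2 * m + 1) • S J = P - T J := by
    have h := mul_neg_geom_sum (2 * -m) J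
    simp only [S, T]
    rw [← Finset.sum_smul, ← mul_smul, show (2 * m + 1) = 1 - 2 * -m by ring, h, sub_smul, one_smul]
  have e : (2 * m + 1) • Q - P = (2 * m + 1) • (Q - S J) + (- T J) := by
    rw [smul_sub, hS]; abel
  rw [e]
  refine norm_paramZ_add_le hV (G.zsmul_mem (G.sub_mem hQ (hSG J)) _) (G.neg_mem (hTG J)) ?_ ?_
  · refine (norm_paramZ_zsmul_le hV (G.sub_mem hQ (hSG J)) _).trans ?_
    rw [norm_paramZ_sub hV hQ (hSG J), norm_sub_rev]
    exact le_add_of_nonneg_right (pow_nonneg hc0 J)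
  · rw [norm_paramZ_neg hV (hTG J)]
    refine (hT J).trans ?_
    rw [one_mul]
    exact le_add_of_nonneg_left (norm_nonneg _)

end FormalSubgroup

end WeierstrassCurve

/-! ### Lifting the module structure along an abstract reduction map -/

namespace WeierstrassCurve

section AbstractReduction

variable {M N M₀ G : Type*} [AddCommGroup M] [AddCommGroup N] [AddCommGroup M₀] [Group G]
  [DistribMulAction G M] {p : ℕ} {red : M →+ N} {ι : M₀ →+ M}
  (hsurj : Function.Surjective red)
  (hinj : ∀ P, red P = 0 → p • P = 0 → P = 0)
  (hkdiv : ∀ P, red P = 0 → ∃ Q, red Q = 0 ∧ p • Q = P)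

include hinj in
theorem eq_zero_of_pow_nsmul_eq_zero (n : ℕ) {P : M} (hP : red P = 0) (h : p ^ n • P = 0) :
    P = 0 := by
  induction n with
  | zero => simpa using h
  | succ n ih =>
    refine ih (hinj _ (by rw [map_nsmul, hP, smul_zero]) ?_)
    rwa [← mul_nsmul', ← pow_succ']

include hinj in
theorem eq_of_red_eq (n : ℕ) {P Q : M} (h : red P = red Q) (hPQ : p ^ n • P = p ^ n • Q) :
    P = Q := by
  rw [← sub_eq_zero]
  exact eq_zero_of_pow_nsmul_eq_zero hinj n (by rw [map_sub, h, sub_self])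
    (by rw [smul_sub, hPQ, sub_self])

include hkdiv in
theorem exists_pow_nsmul_eq_of_red_eq_zero (n : ℕ) {P : M} (hP : red P = 0) :
    ∃ Q, red Q = 0 ∧ p ^ n • Q = P := by
  induction n with
  | zero => exact ⟨P, hP, by simp⟩
  | succ n ih =>
    obtain ⟨Q, hQ, hQP⟩ := ih
    obtain ⟨R, hR, hRQ⟩ := hkdiv Q hQ
    exact ⟨R, hR, by rw [pow_succ, mul_nsmul', hRQ, hQP]⟩

include hsurj hkdiv in
theorem exists_nsmul_eq_of_red (hN : ∀ P : N, ∃ Q, p • Q = P) (P : M) : ∃ Q, p • Q = P := by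
  obtain ⟨Q, hQ⟩ := hN (red P)
  obtain ⟨Q, rfl⟩ := hsurj Q
  obtain ⟨R, -, hR⟩ := hkdiv (P - p • Q) (by rw [map_sub, map_nsmul, hQ, sub_self])
  exact ⟨Q + R, by rw [smul_add, hR, add_sub_cancel]⟩

include hsurj hkdiv in
theorem exists_torsion_lift (n : ℕ) {T : N} (hT : p ^ n • T = 0) :
    ∃ P, red P = T ∧ p ^ n • P = 0 := by
  obtain ⟨P, rfl⟩ := hsurj T
  obtain ⟨R, hR, hRP⟩ := exists_pow_nsmul_eq_of_red_eq_zero hkdiv n (P := p ^ n • P)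
    (by rw [map_nsmul, hT])
  exact ⟨P - R, by rw [map_sub, hR, sub_zero], by rw [smul_sub, hRP, sub_self]⟩

variable {s : ℤ} {a : ℕ}
  (hequiv : ∀ σ : G, ∃ τ : N →+ N, (∀ P, red (σ • P) = τ (red P)) ∧
    ∀ n : ℕ, ∃ i : ℕ, ∀ P, p ^ n • P = 0 → τ P = (s ^ i) • P)

-- Reduction is injective on `p`-power torsion, so the scalar by which Galois acts can be read after
-- reduction.
include hinj hequiv in
theorem exists_smul_eq_pow_zsmul_of_red (n : ℕ) (σ : G) :
    ∃ i : ℕ, ∀ P : M, p ^ n • P = 0 → σ • P = (s ^ i) • P := by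
  obtain ⟨τ, hτ, h⟩ := hequiv σ
  obtain ⟨i, hi⟩ := h n
  refine ⟨i, fun P hP => eq_of_red_eq hinj n ?_ ?_⟩
  · rw [hτ, hi _ (by rw [← map_nsmul, hP, map_zero]), map_zsmul]
  · rw [← smul_comm, hP, smul_zero, ← smul_comm, hP, smul_zero]

variable (hfix : ∀ P : M, (∀ σ : G, σ • P = P) → ∃ P₀, ι P₀ = P)
  (hιs : ∀ P₀, (s - 1) • red (ι P₀) = 0)

include hsurj hkdiv hfix hιs in
theorem exists_torsion_smul_ne_of_red
    (hN : ∃ P : N, p ^ (a + 1) • P = 0 ∧ (s - 1) • P ≠ 0) :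
    ∃ P : M, p ^ (a + 1) • P = 0 ∧ ∃ σ : G, σ • P ≠ P := by
  obtain ⟨T, hT, hne⟩ := hN
  obtain ⟨P, rfl, hP⟩ := exists_torsion_lift hsurj hkdiv _ hT
  refine ⟨P, hP, ?_⟩
  by_contra! hcon
  obtain ⟨P₀, rfl⟩ := hfix P hcon
  exact hne (hιs P₀)

-- The reduction of `eP` is `pᵃ`-torsion and lifts to a `pᵃ`-torsion point, unique and therefore
-- rational. The difference reduces to zero, so it is `pᵐ` times a unique element of the kernel,
-- rational for the same reason. Finally `(1 - e)P` is a multiple of `pᵐ`.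
include hsurj hinj hkdiv hequiv hfix hιs in
theorem exists_eq_add_pow_nsmul_of_red [hp : Fact p.Prime] {u : ℤ} (hs : s = 1 + p ^ a * u)
    (hu : ¬ (p : ℤ) ∣ u) (hι : Function.Injective ι) (hισ : ∀ (σ : G) P₀, σ • ι P₀ = ι P₀)
    (m : ℕ) (P : M₀) : ∃ T R : M₀, P = T + p ^ m • R ∧ p ^ a • T = 0 := by
  obtain ⟨e, c, hec, h⟩ := exists_coprime_multiplier (M := N) p hs hu m
  have hP := h _ (hιs P)
  rw [← Nat.cast_pow, natCast_zsmul] at hP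
  obtain ⟨T, hT, hTa⟩ := exists_torsion_lift hsurj hkdiv a hP
  rw [← map_zsmul, ← map_zsmul] at hT
  have hτ : ∀ (σ : G) {Q Q' : M}, red Q = red Q' → red (σ • Q) = red (σ • Q') := fun σ Q Q' hQ => by
    obtain ⟨τ, hτ, -⟩ := hequiv σ
    rw [hτ, hτ, hQ]
  obtain ⟨T₀, rfl⟩ := hfix T fun σ => eq_of_red_eq hinj a
    (by rw [hτ σ hT, hισ, hT]) (by rw [← smul_comm, hTa, smul_zero])
  obtain ⟨S, hS, hSP⟩ := exists_pow_nsmul_eq_of_red_eq_zero hkdiv m (P := ι (e • P - T₀))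
    (by rw [map_sub, map_sub, hT, sub_self])
  obtain ⟨S₀, rfl⟩ := hfix S fun σ => eq_of_red_eq hinj m
    (by rw [hτ σ (hS.trans (map_zero red).symm), smul_zero, map_zero, hS])
    (by rw [← smul_comm, hSP, hισ])
  rw [← map_nsmul] at hSP
  refine ⟨T₀, S₀ + c • P, ?_, hι (by rw [map_nsmul, hTa, map_zero])⟩
  have h1 : (p ^ m) • c • P = (1 - e) • P := by
    rw [hec, mul_smul, ← Nat.cast_pow, natCast_zsmul]
  rw [smul_add, hι hSP, h1, sub_smul, one_smul]
  abel

end AbstractReduction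

end WeierstrassCurve

/-! ### Curves with an integral model reducing to `A` -/

namespace WeierstrassCurve

theorem curveA_isElliptic (k : Type*) [Field k] [CharP k 2] : (curveA k).IsElliptic := by
  rw [isElliptic_iff, isUnit_iff_ne_zero]
  have h2 : (2 : k) = 0 := CharTwo.two_eq_zero
  have : (curveA k).Δ = 1 - 2 * 222 := by
    simp only [Δ, b₂, b₄, b₆, b₈, curveA]
    ring
  rw [this, h2, zero_mul, sub_zero]
  exact one_ne_zero

section GoodReduction

variable {K L Ω κ : Type*} [Field K] [NormedField L] [IsUltrametricDist L] [Algebra K L]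
  [Field Ω] [Field κ] [Algebra κ Ω]
  {V : Subring L} (hV : ∀ x, x ∈ V ↔ ‖x‖ ≤ 1) (E : WeierstrassCurve K) [E.IsElliptic]
  (C : VariableChange K) (W : WeierstrassCurve V)
  (hW : W.map V.subtype = (C • E).map (algebraMap K L))

/-- The points of an integral model, as points of the original curve. -/
noncomputable def modelEquiv : (W.map V.subtype).toAffine.Point ≃+ E.Pts L :=
  (pointCongr (hW.trans (map_variableChange E C (algebraMap K L)).symm)).trans
    (AddEquiv.ofBijective (pointOfVariableChange (E.map (algebraMap K L)) (C.map (algebraMap K L)))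
      (pointOfVariableChange_bijective _ _))

omit [IsUltrametricDist L] in
theorem modelEquiv_some {x y : L} (h : (W.map V.subtype).toAffine.Nonsingular x y) :
    ∃ h', modelEquiv E C W hW (.some x y h) =
      Affine.Point.some (algebraMap K L C.u ^ 2 * x + algebraMap K L C.r)
        (algebraMap K L C.u ^ 3 * y + algebraMap K L C.u ^ 2 * algebraMap K L C.s * x +
          algebraMap K L C.t) h' := by
  have e := hW.trans (map_variableChange E C (algebraMap K L)).symm
  exact ⟨(nonsingular_variableChange_iff (E.map (algebraMap K L)) (C.map (algebraMap K L)) x y).1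
    (nonsingular_congr e h), congrArg (pointOfVariableChange (E.map (algebraMap K L))
      (C.map (algebraMap K L))) (pointCongr_some e h)⟩

omit [IsUltrametricDist L] in
theorem smul_modelEquiv_some (σ : Gal(L/K)) {x y : L}
    (h : (W.map V.subtype).toAffine.Nonsingular x y) :
    ∃ h', σ • modelEquiv E C W hW (.some x y h) = modelEquiv E C W hW (.some (σ x) (σ y) h') := by
  have hN : (W.map V.subtype).toAffine.Nonsingular (σ x) (σ y) := by
    have h1 := nonsingular_congr hW h
    refine nonsingular_congr hW.symm ?_
    have h2 := (Affine.map_nonsingular (W := ((C • E).map (algebraMap K L)).toAffine)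
      (f := (σ : L →+* L)) (σ : L →+* L).injective x y).2 h1
    refine nonsingular_congr ?_ h2
    change ((C • E).map (algebraMap K L)).map (σ : L →+* L) = _
    rw [map_map]
    congr 1
    exact RingHom.ext fun a => σ.commutes a
  refine ⟨hN, ?_⟩
  obtain ⟨h', e'⟩ := modelEquiv_some E C W hW h
  obtain ⟨h'', e''⟩ := modelEquiv_some E C W hW hN
  rw [e', e'']
  refine pts_some_congr E ?_ ?_
  all_goals
    simp only [map_add, map_mul, map_pow, AlgHom.commutes]
    rfl

variable (ρ : V →+* Ω) [CharP Ω 2] (hWρ : W.map ρ = curveA Ω)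
  (hρ : ∀ x, ρ x = 0 ↔ ‖(x : L)‖ < 1)

include hWρ in
omit [IsUltrametricDist L] in
theorem isElliptic_map_of_eq_curveA : (W.map ρ).IsElliptic := by
  rw [hWρ]; exact curveA_isElliptic Ω

/-- The reduction map of a curve with good reduction equal to `curveA`. -/
noncomputable def modelRed : E.Pts L →+ (curveA Ω).toAffine.Point :=
  haveI := isElliptic_map_of_eq_curveA W ρ hWρ
  (pointCongr hWρ).toAddMonoidHom.comp
    ((reduceHom hV W ρ hρ).comp (modelEquiv E C W hW).symm.toAddMonoidHom)

theorem modelRed_coe (x y : V) (h : (W.map V.subtype).toAffine.Nonsingular (x : L) (y : L)) :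
    ∃ h', modelRed hV E C W hW ρ hWρ hρ (modelEquiv E C W hW (.some x y h)) =
      .some (ρ x) (ρ y) h' := by
  have := isElliptic_map_of_eq_curveA W ρ hWρ
  obtain ⟨h', e⟩ := reducePt_coe hV W ρ x y h
  refine ⟨nonsingular_congr hWρ h', ?_⟩
  change pointCongr hWρ (reducePt hV W ρ ((modelEquiv E C W hW).symm (modelEquiv E C W hW _))) = _
  rw [AddEquiv.symm_apply_apply, e, pointCongr_some]

theorem modelRed_eq_zero_iff (P : (W.map V.subtype).toAffine.Point) :
    modelRed hV E C W hW ρ hWρ hρ (modelEquiv E C W hW P) = 0 ↔ P ∈ formalSubgroup hV W := by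
  have := isElliptic_map_of_eq_curveA W ρ hWρ
  change pointCongr hWρ (reducePt hV W ρ ((modelEquiv E C W hW).symm (modelEquiv E C W hW P))) = 0 ↔ _
  rw [AddEquiv.symm_apply_apply, map_eq_zero_iff _ (pointCongr hWρ).injective]
  rcases P with _ | ⟨x, y, h⟩
  · exact ⟨fun _ => zero_mem _, fun _ => rfl⟩
  · rw [reducePt_eq_zero_iff_of_some, some_mem_formalSubgroup]

theorem modelRed_surjective [IsAlgClosed L] (hsurj : Function.Surjective ρ) :
    Function.Surjective (modelRed hV E C W hW ρ hWρ hρ) := by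
  have := isElliptic_map_of_eq_curveA W ρ hWρ
  exact (pointCongr hWρ).surjective.comp
    ((reduceHom_surjective hV W ρ hρ hsurj).comp (modelEquiv E C W hW).symm.surjective)

theorem modelRed_smul (σ : Gal(L/K)) (hσ : ∀ x, ‖σ x‖ = ‖x‖) (τ : Ω →+* Ω)
    (hτ : ∀ x y : V, (y : L) = σ x → ρ y = τ (ρ x)) (P : E.Pts L) :
    modelRed hV E C W hW ρ hWρ hρ (σ • P) = curveAMap τ (modelRed hV E C W hW ρ hWρ hρ P) := by
  obtain ⟨P, rfl⟩ := (modelEquiv E C W hW).surjective P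
  rcases P with _ | ⟨x, y, h⟩
  · change modelRed hV E C W hW ρ hWρ hρ (σ • modelEquiv E C W hW 0) =
      curveAMap τ (modelRed hV E C W hW ρ hWρ hρ (modelEquiv E C W hW 0))
    simp only [map_zero, smul_zero]
  · obtain ⟨h', e⟩ := smul_modelEquiv_some E C W hW σ h
    rw [e]
    by_cases hx : x ∈ V
    · have hy := y_mem_of_x_mem hV W h.1 hx
      have hx' : σ x ∈ V := by rw [hV, hσ, ← hV]; exact hx
      have hy' : σ y ∈ V := by rw [hV, hσ, ← hV]; exact hy
      obtain ⟨k, e₁⟩ := modelRed_coe hV E C W hW ρ hWρ hρ ⟨x, hx⟩ ⟨y, hy⟩ h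
      obtain ⟨k', e₂⟩ := modelRed_coe hV E C W hW ρ hWρ hρ ⟨σ x, hx'⟩ ⟨σ y, hy'⟩ h'
      obtain ⟨k'', e₃⟩ := curveAMap_some τ k
      refine e₂.trans (Eq.trans ?_ ((congrArg (curveAMap τ) e₁).trans e₃).symm)
      rw [Affine.Point.some.injEq]
      exact ⟨hτ _ _ rfl, hτ _ _ rfl⟩
    · have hx' : σ x ∉ V := by rw [hV, hσ, ← hV]; exact hx
      rw [(modelRed_eq_zero_iff hV E C W hW ρ hWρ hρ _).2 ((some_mem_formalSubgroup hV W h).2 hx),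
        (modelRed_eq_zero_iff hV E C W hW ρ hWρ hρ _).2 ((some_mem_formalSubgroup hV W h').2 hx'),
        map_zero]

/-- A rational point with nonzero reduction has Galois-fixed integral coordinates, so its reduction
has coordinates in `κ`; there `s - 1` vanishes. -/
theorem modelRed_ptsIncl [IsGalois K L] [Finite κ] {r : ℕ} (hκr : Nat.card κ = 4 ^ r)
    (hκ : ∀ (a : K) (x : V), (x : L) = algebraMap K L a → ∃ b : κ, ρ x = algebraMap κ Ω b)
    (P : E.toAffine.Point) :
    ((-2 : ℤ) ^ r - 1) • modelRed hV E C W hW ρ hWρ hρ (E.ptsIncl L P) = 0 := by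
  have : CharP κ 2 := (algebraMap κ Ω).charP (algebraMap κ Ω).injective 2
  rw [← mem_range_curveAMap_iff hκr (algebraMap κ Ω)]
  have hfix := fun σ : Gal(L/K) => galSMul_ptsIncl E σ P
  obtain ⟨Q, hQ⟩ := (modelEquiv E C W hW).surjective (E.ptsIncl L P)
  rw [← hQ] at hfix ⊢
  by_cases hQ0 : Q ∈ formalSubgroup hV W
  · exact ⟨0, by rw [(modelRed_eq_zero_iff hV E C W hW ρ hWρ hρ _).2 hQ0, map_zero]⟩
  rcases Q with _ | ⟨x, y, h⟩
  · exact absurd (zero_mem _) hQ0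
  rw [some_mem_formalSubgroup, not_not] at hQ0
  have hcoord : ∀ σ : Gal(L/K), σ x = x ∧ σ y = y := fun σ => by
    obtain ⟨h', e⟩ := smul_modelEquiv_some E C W hW σ h
    have := (modelEquiv E C W hW).injective (e.symm.trans (hfix σ))
    rwa [Affine.Point.some.injEq] at this
  have hy := y_mem_of_x_mem hV W h.1 hQ0
  obtain ⟨X, hX⟩ := (InfiniteGalois.mem_range_algebraMap_iff_fixed (k := K) x).2
    fun σ => (hcoord σ).1
  obtain ⟨Y, hY⟩ := (InfiniteGalois.mem_range_algebraMap_iff_fixed (k := K) y).2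
    fun σ => (hcoord σ).2
  obtain ⟨b, hb⟩ := hκ X ⟨x, hQ0⟩ hX.symm
  obtain ⟨c, hc⟩ := hκ Y ⟨y, hy⟩ hY.symm
  obtain ⟨h', e⟩ := modelRed_coe hV E C W hW ρ hWρ hρ ⟨x, hQ0⟩ ⟨y, hy⟩ h
  obtain ⟨P', hP'⟩ := mem_range_curveAMap (algebraMap κ Ω) h' ⟨b, hb.symm⟩ ⟨c, hc.symm⟩
  exact ⟨P', hP'.trans e.symm⟩

theorem modelRed_eq_zero_of_nsmul_eq_zero (h2 : ‖(2 : L)‖ < 1) {p : ℕ} (hp2 : Odd p) (P : E.Pts L)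
    (hP : modelRed hV E C W hW ρ hWρ hρ P = 0) (h : p • P = 0) : P = 0 := by
  obtain ⟨P, rfl⟩ := (modelEquiv E C W hW).surjective P
  rw [modelRed_eq_zero_iff] at hP
  rw [← map_nsmul, map_eq_zero_iff _ (modelEquiv E C W hW).injective, ← natCast_zsmul] at h
  rw [eq_zero_of_odd_zsmul_eq_zero hV hP h2 (by exact_mod_cast hp2) h, map_zero]

theorem exists_nsmul_eq_of_modelRed_eq_zero (h2 : ‖(2 : L)‖ < 1)
    (hcomp : ∀ x y : L, ∃ F : Subfield L, IsComplete (F : Set L) ∧ x ∈ F ∧ y ∈ F ∧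
      ∀ a : K, algebraMap K L a ∈ F)
    {p : ℕ} (hp2 : Odd p) (P : E.Pts L) (hP : modelRed hV E C W hW ρ hWρ hρ P = 0) :
    ∃ Q, modelRed hV E C W hW ρ hWρ hρ Q = 0 ∧ p • Q = P := by
  have := isElliptic_map_of_eq_curveA W ρ hWρ
  have := isElliptic_map_subtype W ρ
  obtain ⟨P, rfl⟩ := (modelEquiv E C W hW).surjective P
  rw [modelRed_eq_zero_iff] at hP
  rcases P with _ | ⟨x, y, h⟩
  · exact ⟨0, map_zero _, (smul_zero _).trans (map_zero (modelEquiv E C W hW)).symm⟩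
  obtain ⟨F, hF, hx, hy, hK⟩ := hcomp x y
  obtain ⟨Q, hQ, e⟩ := exists_mem_formalSubgroup_zsmul_eq hV hP h2
    (show Odd (p : ℤ) by exact_mod_cast hp2) F hF
    (by rw [hW]; exact hK _) (by rw [hW]; exact hK _) (by rw [hW]; exact hK _)
    (by rw [hW]; exact hK _) (by
      intro x' y' h' e
      rw [Affine.Point.some.injEq] at e
      rw [← e.1, ← e.2]
      exact ⟨hx, hy⟩)
  exact ⟨modelEquiv E C W hW Q, (modelRed_eq_zero_iff hV E C W hW ρ hWρ hρ Q).2 hQ, by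
    rw [← map_nsmul, ← natCast_zsmul, e]⟩

include hV hW hWρ hρ in
/-- The Galois module structure of a curve with good reduction equal to `curveA`. -/
theorem galois_action_of_goodReduction (h2 : ‖(2 : L)‖ < 1)
    (hcomp : ∀ x y : L, ∃ F : Subfield L, IsComplete (F : Set L) ∧ x ∈ F ∧ y ∈ F ∧
      ∀ a : K, algebraMap K L a ∈ F)
    [IsAlgClosed L] [IsGalois K L] [IsAlgClosed Ω] [Finite κ] [Algebra.IsAlgebraic κ Ω]
    (hsurj : Function.Surjective ρ) (hσ : ∀ (σ : Gal(L/K)) x, ‖σ x‖ = ‖x‖)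
    (hτ : ∀ σ : Gal(L/K), ∃ τ : Gal(Ω/κ), ∀ x y : V, (y : L) = σ x → ρ y = τ (ρ x))
    (hκ : ∀ (a : K) (x : V), (x : L) = algebraMap K L a → ∃ b : κ, ρ x = algebraMap κ Ω b)
    {r : ℕ} (hκr : Nat.card κ = 4 ^ r) (p : ℕ) [hp : Fact p.Prime] (hp2 : Odd p) {a : ℕ} {u : ℤ}
    (hs : (-2 : ℤ) ^ r = 1 + p ^ a * u) (hu : ¬ (p : ℤ) ∣ u) :
    (∀ P : E.Pts L, ∃ Q : E.Pts L, p • Q = P) ∧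
    (∀ (N : ℕ) (σ : Gal(L/K)), ∃ i : ℕ, ∀ P : E.Pts L, p ^ N • P = 0 →
      σ • P = (((-2 : ℤ) ^ r) ^ i) • P) ∧
    (∃ P : E.Pts L, p ^ (a + 1) • P = 0 ∧ ∃ σ : Gal(L/K), σ • P ≠ P) ∧
    ∀ (m : ℕ) (P : E.toAffine.Point), ∃ T R : E.toAffine.Point,
      P = T + p ^ m • R ∧ p ^ a • T = 0 := by
  have s₁ := modelRed_surjective hV E C W hW ρ hWρ hρ hsurj
  have s₂ := modelRed_eq_zero_of_nsmul_eq_zero hV E C W hW ρ hWρ hρ h2 hp2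
  have s₃ := exists_nsmul_eq_of_modelRed_eq_zero hV E C W hW ρ hWρ hρ h2 hcomp hp2
  have s₄ : ∀ σ : Gal(L/K), ∃ τ : (curveA Ω).toAffine.Point →+ (curveA Ω).toAffine.Point,
      (∀ P, modelRed hV E C W hW ρ hWρ hρ (σ • P) = τ (modelRed hV E C W hW ρ hWρ hρ P)) ∧
      ∀ n : ℕ, ∃ i : ℕ, ∀ P, p ^ n • P = 0 → τ P = (((-2 : ℤ) ^ r) ^ i) • P := fun σ => by
    obtain ⟨τ, h⟩ := hτ σ
    exact ⟨curveAMap (τ : Ω →+* Ω), modelRed_smul hV E C W hW ρ hWρ hρ σ (hσ σ) _ h, fun n =>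
      exists_curveAMap_eq_pow_zsmul Ω p hp2 hκr n τ⟩
  have s₅ := fun P hP => E.mem_range_ptsIncl_of_fixed (L := L) P hP
  have s₆ := modelRed_ptsIncl hV E C W hW ρ hWρ hρ hκr hκ
  exact ⟨exists_nsmul_eq_of_red s₁ s₃ (curveA_nsmul_surjective Ω p hp2 κ),
    exists_smul_eq_pow_zsmul_of_red s₂ s₄,
    exists_torsion_smul_ne_of_red s₁ s₃ s₅ s₆
      (exists_mem_nTorsion_sub_one_zsmul_ne_zero Ω p hp2 hs hu),
    exists_eq_add_pow_nsmul_of_red s₁ s₂ s₃ s₄ s₅ s₆ hs hu (E.ptsIncl_injective L)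
      (galSMul_ptsIncl E)⟩

end GoodReduction

end WeierstrassCurve

/-! ### Orders of residue fields -/

theorem IsLocalRing.natCard_residueField_eq_pow_inertiaDeg (R S : Type*) [CommRing R] [CommRing S]
    [IsLocalRing R] [IsLocalRing S] [Algebra R S] [Module.Finite R S]
    [Finite (IsLocalRing.ResidueField R)] :
    Finite (IsLocalRing.ResidueField S) ∧ Nat.card (IsLocalRing.ResidueField S) =
      Nat.card (IsLocalRing.ResidueField R) ^ (IsLocalRing.maximalIdeal S).inertiaDeg R := by
  let P := IsLocalRing.maximalIdeal R
  let Q := IsLocalRing.maximalIdeal S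
  have hmax : (Q.comap (algebraMap R S)).IsMaximal :=
    Ideal.isMaximal_comap_of_isIntegral_of_isMaximal Q
  have : Q.LiesOver P := ⟨(IsLocalRing.eq_maximalIdeal hmax).symm⟩
  have h := Ideal.inertiaDeg_eq_of_isMaximal P Q
  have : Finite (R ⧸ P) := ‹Finite (IsLocalRing.ResidueField R)›
  let : Field (R ⧸ P) := Ideal.Quotient.field P
  have : Module.Finite (R ⧸ P) (S ⧸ Q) := inferInstance
  exact ⟨Module.finite_of_finite (R ⧸ P) (M := S ⧸ Q),
    (Module.natCard_eq_pow_finrank (K := R ⧸ P) (V := S ⧸ Q)).trans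
      (congrArg (Nat.card (R ⧸ P) ^ ·) h.symm)⟩

namespace LocalInt

section

variable (q : ℕ) [Fact q.Prime] (K : Type*) [Field K] [Algebra ℚ_[q] K]
  [FiniteDimensional ℚ_[q] K] [Algebra ℤ_[q] K] [IsScalarTower ℤ_[q] ℚ_[q] K]

theorem finite_and_natCard_residueField :
    Finite (κ q K) ∧ Nat.card (κ q K) = q ^ residueDegree q K := by
  have : Module.Finite ℤ_[q] (𝒪 q K) := IsIntegralClosure.finite ℤ_[q] ℚ_[q] K (𝒪 q K)
  have : Finite (IsLocalRing.ResidueField ℤ_[q]) :=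
    .of_equiv _ (PadicInt.residueField (p := q)).symm.toEquiv
  have h := IsLocalRing.natCard_residueField_eq_pow_inertiaDeg ℤ_[q] (𝒪 q K)
  rwa [Nat.card_congr (PadicInt.residueField (p := q)).toEquiv, Nat.card_zmod] at h

end

end LocalInt

/-! ### The unit ball, its residue field, and integral models -/

namespace WeierstrassCurve

section UnitBall

variable (L : Type*) [NormedField L] [IsUltrametricDist L]

/-- The closed unit ball of an ultrametric field. -/
noncomputable abbrev unitBall : Subring L := (NormedField.valuation (K := L)).integer

variable {L}

theorem mem_unitBall {x : L} : x ∈ unitBall L ↔ ‖x‖ ≤ 1 := by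
  rw [Valuation.mem_integer_iff, NormedField.valuation_apply, ← NNReal.coe_le_coe]
  rfl

theorem isUnit_unitBall_iff {x : unitBall L} : IsUnit x ↔ ‖(x : L)‖ = 1 := by
  rw [(Valuation.integer.integers (NormedField.valuation (K := L))).isUnit_iff_valuation_eq_one,
    ← NNReal.coe_inj]
  rfl

instance : IsLocalRing (unitBall L) := by
  refine .of_isUnit_or_isUnit_one_sub_self fun x => ?_
  rw [isUnit_unitBall_iff, isUnit_unitBall_iff]
  rcases (mem_unitBall.1 x.2).eq_or_lt with h | h
  · exact Or.inl h
  · right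
    push_cast
    rw [sub_eq_add_neg]
    exact norm_one_add (by rwa [norm_neg])

theorem residue_unitBall_eq_zero_iff {x : unitBall L} :
    IsLocalRing.residue (unitBall L) x = 0 ↔ ‖(x : L)‖ < 1 := by
  rw [IsLocalRing.residue_eq_zero_iff, IsLocalRing.mem_maximalIdeal, mem_nonunits_iff,
    isUnit_unitBall_iff, (mem_unitBall.1 x.2).lt_iff_ne]

/-- A monic lift of the polynomial has a root in `L`, which is integral over the unit ball and so
belongs to it. -/
instance isAlgClosed_residueField_unitBall [IsAlgClosed L] :
    IsAlgClosed (IsLocalRing.ResidueField (unitBall L)) := by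
  refine IsAlgClosed.of_exists_root _ fun P hP hirr => ?_
  have hl : P ∈ Polynomial.lifts (IsLocalRing.residue (unitBall L)) := by
    rw [Polynomial.lifts_iff_coeff_lifts]
    exact fun n => IsLocalRing.residue_surjective _
  obtain ⟨Q, hQ, hdeg, hmon⟩ := Polynomial.lifts_and_degree_eq_and_monic hl hP
  obtain ⟨x, hx⟩ := IsAlgClosed.exists_root (Q.map (unitBall L).subtype) (by
    rw [hmon.degree_map, hdeg]
    exact hirr.degree_pos.ne')
  have hint : _root_.IsIntegral (unitBall L) x := ⟨Q, hmon, by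
    rw [Polynomial.IsRoot, Polynomial.eval_map] at hx; exact hx⟩
  have hxV : x ∈ unitBall L :=
    (Valuation.integer.integers (NormedField.valuation (K := L))).mem_of_integral hint
  refine ⟨IsLocalRing.residue (unitBall L) ⟨x, hxV⟩, ?_⟩
  rw [← hQ, Polynomial.eval_map_apply]
  rw [Polynomial.IsRoot, show x = (unitBall L).subtype ⟨x, hxV⟩ from rfl,
    Polynomial.eval_map_apply] at hx
  rw [show Q.eval ⟨x, hxV⟩ = 0 from Subtype.ext hx, map_zero]

end UnitBall

section Lift

variable {R K : Type*} [CommRing R] [IsLocalRing R] [Field K] [Algebra R K]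

theorem exists_variableChange_lift (D : VariableChange (IsLocalRing.ResidueField R)) :
    ∃ D' : VariableChange R, D'.map (IsLocalRing.residue R) = D := by
  obtain ⟨u, hu⟩ := IsLocalRing.residue_surjective (D.u : IsLocalRing.ResidueField R)
  obtain ⟨r, hr⟩ := IsLocalRing.residue_surjective D.r
  obtain ⟨s, hs⟩ := IsLocalRing.residue_surjective D.s
  obtain ⟨t, ht⟩ := IsLocalRing.residue_surjective D.t
  have hunit : IsUnit u := isUnit_of_map_unit (IsLocalRing.residue R) u (hu ▸ D.u.isUnit)
  refine ⟨⟨hunit.unit, r, s, t⟩, ?_⟩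
  ext
  · exact hu
  · exact hr
  · exact hs
  · exact ht

/-- An integral model whose reduction is a prescribed curve isomorphic to the reduction. -/
theorem exists_model_map_residue_eq {W : WeierstrassCurve K} {W₁ : WeierstrassCurve R}
    (h : W₁.map (algebraMap R K) = W) {D : VariableChange (IsLocalRing.ResidueField R)}
    {B : WeierstrassCurve (IsLocalRing.ResidueField R)}
    (hD : D • W₁.map (IsLocalRing.residue R) = B) :
    ∃ (D' : VariableChange K) (W₂ : WeierstrassCurve R),
      W₂.map (algebraMap R K) = D' • W ∧ W₂.map (IsLocalRing.residue R) = B := by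
  obtain ⟨D, rfl⟩ := exists_variableChange_lift D
  refine ⟨D.map (algebraMap R K), D • W₁, ?_, ?_⟩
  · rw [← map_variableChange, h]
  · rw [← map_variableChange, hD]

end Lift

end WeierstrassCurve

namespace WeierstrassCurve

section LocalModel

variable {K L R : Type*} [Field K] [NormedField L] [IsUltrametricDist L] [Algebra K L]
  [CommRing R] [IsLocalRing R] [Algebra R K]
  (E : WeierstrassCurve K) [E.IsElliptic] (f : R →+* unitBall L) [IsLocalHom f]
  (hf : ∀ o, (f o : L) = algebraMap K L (algebraMap R K o))

-- An isometry preserves the unit ball, hence acts on its residue field, fixing the image of `R`.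
include hf in
theorem exists_residueField_algEquiv (σ : Gal(L/K)) (hσ : ∀ x, ‖σ x‖ = ‖x‖) :
    letI := (IsLocalRing.ResidueField.map f).toAlgebra
    ∃ τ : Gal(IsLocalRing.ResidueField (unitBall L)/IsLocalRing.ResidueField R),
      ∀ x y : unitBall L, (y : L) = σ x →
        IsLocalRing.residue _ y = τ (IsLocalRing.residue _ x) := by
  let := (IsLocalRing.ResidueField.map f).toAlgebra
  have hmem : ∀ (σ : Gal(L/K)), (∀ x, ‖σ x‖ = ‖x‖) → ∀ x : unitBall L, σ x ∈ unitBall L :=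
    fun σ hσ x => by rw [mem_unitBall, hσ]; exact mem_unitBall.1 x.2
  have hσ' : ∀ x, ‖σ.symm x‖ = ‖x‖ := fun x => by
    rw [← hσ (σ.symm x), AlgEquiv.apply_symm_apply]
  let g : unitBall L ≃+* unitBall L :=
    { toFun := fun x => ⟨σ x, hmem σ hσ x⟩
      invFun := fun x => ⟨σ.symm x, hmem σ.symm hσ' x⟩
      left_inv := fun x => Subtype.ext (σ.symm_apply_apply x)
      right_inv := fun x => Subtype.ext (σ.apply_symm_apply x)
      map_mul' := fun x y => Subtype.ext (map_mul σ (x : L) y)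
      map_add' := fun x y => Subtype.ext (map_add σ (x : L) y) }
  refine ⟨AlgEquiv.ofRingEquiv (f := IsLocalRing.ResidueField.mapEquiv g) fun b => ?_, ?_⟩
  · obtain ⟨o, rfl⟩ := IsLocalRing.residue_surjective b
    change IsLocalRing.residue _ (g (f o)) = IsLocalRing.residue _ (f o)
    congr 1
    refine Subtype.ext ?_
    change σ (f o) = f o
    rw [hf, AlgEquiv.commutes]
  · intro x y hxy
    change IsLocalRing.residue _ y = IsLocalRing.residue _ (g x)
    congr 1
    exact Subtype.ext hxy

include hf in
theorem galois_action_of_model (h2 : ‖(2 : L)‖ < 1)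
    (hcomp : ∀ x y : L, ∃ F : Subfield L, IsComplete (F : Set L) ∧ x ∈ F ∧ y ∈ F ∧
      ∀ a : K, algebraMap K L a ∈ F)
    [IsAlgClosed L] [IsGalois K L] (hσ : ∀ (σ : Gal(L/K)) x, ‖σ x‖ = ‖x‖)
    (hfK : ∀ a : K, ‖algebraMap K L a‖ ≤ 1 → ∃ o, algebraMap R K o = a) (hfint : f.IsIntegral)
    [Finite (IsLocalRing.ResidueField R)] {C : VariableChange K} {W : WeierstrassCurve R}
    (hW : W.map (algebraMap R K) = C • E)
    (hWr : W.map (IsLocalRing.residue R) = curveA (IsLocalRing.ResidueField R))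
    {r : ℕ} (hr : Nat.card (IsLocalRing.ResidueField R) = 4 ^ r)
    (p : ℕ) [hp : Fact p.Prime] (hp2 : Odd p) {a : ℕ} {u : ℤ}
    (hs : (-2 : ℤ) ^ r = 1 + p ^ a * u) (hu : ¬ (p : ℤ) ∣ u) :
    (∀ P : E.Pts L, ∃ Q : E.Pts L, p • Q = P) ∧
    (∀ (N : ℕ) (σ : Gal(L/K)), ∃ i : ℕ, ∀ P : E.Pts L, p ^ N • P = 0 →
      σ • P = (((-2 : ℤ) ^ r) ^ i) • P) ∧
    (∃ P : E.Pts L, p ^ (a + 1) • P = 0 ∧ ∃ σ : Gal(L/K), σ • P ≠ P) ∧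
    ∀ (m : ℕ) (P : E.toAffine.Point), ∃ T R : E.toAffine.Point,
      P = T + p ^ m • R ∧ p ^ a • T = 0 := by
  let := (IsLocalRing.ResidueField.map f).toAlgebra
  have h2' : (2 : IsLocalRing.ResidueField (unitBall L)) = 0 := by
    rw [← map_ofNat (IsLocalRing.residue (unitBall L)) 2, residue_unitBall_eq_zero_iff]
    exact h2
  have : CharP (IsLocalRing.ResidueField (unitBall L)) 2 :=
    CharTwo.of_one_ne_zero_of_two_eq_zero one_ne_zero h2'
  have hW₁ : (W.map f).map (unitBall L).subtype = (C • E).map (algebraMap K L) := by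
    rw [← hW, map_map, map_map]
    congr 1
    exact RingHom.ext hf
  have hW₂ : (W.map f).map (IsLocalRing.residue (unitBall L)) =
      curveA (IsLocalRing.ResidueField (unitBall L)) := by
    rw [map_map, ← IsLocalRing.ResidueField.map_comp_residue, ← map_map, hWr, curveA_map]
  -- Integral equations over `R` reduce to algebraic equations over its residue field.
  have halg : Algebra.IsAlgebraic (IsLocalRing.ResidueField R)
      (IsLocalRing.ResidueField (unitBall L)) := by
    refine ⟨fun x => ?_⟩
    obtain ⟨x, rfl⟩ := IsLocalRing.residue_surjective x
    obtain ⟨P, hP, hPx⟩ := hfint x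
    have : _root_.IsIntegral (IsLocalRing.ResidueField R) (IsLocalRing.residue (unitBall L) x) := by
      refine ⟨P.map (IsLocalRing.residue R), hP.map _, ?_⟩
      have h := congrArg (IsLocalRing.residue (unitBall L)) hPx
      rw [Polynomial.hom_eval₂, map_zero] at h
      rw [Polynomial.eval₂_map]
      exact h
    exact this.isAlgebraic
  refine galois_action_of_goodReduction (κ := IsLocalRing.ResidueField R) (fun _ => mem_unitBall) E C
    (W.map f) hW₁ (IsLocalRing.residue (unitBall L)) hW₂ (fun _ => residue_unitBall_eq_zero_iff)
    h2 hcomp IsLocalRing.residue_surjective hσ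
    (fun σ => exists_residueField_algEquiv f hf σ (hσ σ)) ?_ hr p hp2 hs hu
  intro b x hx
  obtain ⟨o, rfl⟩ := hfK b (hx ▸ mem_unitBall.1 x.2)
  refine ⟨IsLocalRing.residue R o, ?_⟩
  rw [show x = f o from Subtype.ext (hx.trans (hf o).symm)]
  rfl

end LocalModel

end WeierstrassCurve

/-! ### Algebraic extensions of `ℚ_q` with the spectral norm -/

namespace LocalInt

section

variable (q : ℕ) [Fact q.Prime]

/-- Integrality and spectral norm are both insensitive to the ambient field, so the finite extension
generated by `x` suffices. -/
theorem isIntegral_iff_of_isAlgebraic {L : Type*} [Field L] [Algebra ℚ_[q] L]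
    [Algebra.IsAlgebraic ℚ_[q] L] [Algebra ℤ_[q] L] [IsScalarTower ℤ_[q] ℚ_[q] L] (x : L) :
    IsIntegral ℤ_[q] x ↔ spectralNorm ℚ_[q] L x ≤ 1 := by
  have hx : x ∈ IntermediateField.adjoin ℚ_[q] {x} := IntermediateField.mem_adjoin_simple_self _ x
  let F := IntermediateField.adjoin ℚ_[q] {x}
  have : FiniteDimensional ℚ_[q] F :=
    IntermediateField.adjoin.finiteDimensional (Algebra.IsIntegral.isIntegral x)
  have : IsScalarTower ℤ_[q] F L := .of_algebraMap_eq fun a => by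
    rw [IsScalarTower.algebraMap_apply ℤ_[q] ℚ_[q] L, IsScalarTower.algebraMap_apply ℤ_[q] ℚ_[q] F,
      ← IsScalarTower.algebraMap_apply ℚ_[q] F L]
  have h := isIntegral_iff q F ⟨x, hx⟩
  rw [spectralNorm.eq_of_tower (L := L)] at h
  rw [← isIntegral_algebraMap_iff (A := F) (B := L) (algebraMap F L).injective] at h
  exact h

variable {K : Type*} [Field K] [Algebra ℚ_[q] K]
  [FiniteDimensional ℚ_[q] K] [Algebra ℤ_[q] K] [IsScalarTower ℤ_[q] ℚ_[q] K]

omit [Algebra ℤ_[q] K] [IsScalarTower ℤ_[q] ℚ_[q] K] in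
/-- A finite extension generated by two elements is complete inside the spectrally normed algebraic
closure. -/
theorem exists_isComplete_subfield {L : Type*} [Field L] [Algebra ℚ_[q] L] [Algebra K L]
    [IsScalarTower ℚ_[q] K L] [Algebra.IsAlgebraic ℚ_[q] L] (x y : L) :
    letI := spectralNorm.normedField ℚ_[q] L
    ∃ F : Subfield L, IsComplete (F : Set L) ∧ x ∈ F ∧ y ∈ F ∧ ∀ a : K, algebraMap K L a ∈ F := by
  let := spectralNorm.normedField ℚ_[q] L
  let := spectralNorm.normedSpace ℚ_[q] L
  have : Algebra.IsAlgebraic K L := Algebra.IsAlgebraic.tower_top (K := ℚ_[q]) K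
  let F := IntermediateField.adjoin K ({x, y} : Set L)
  have hF : FiniteDimensional K F := IntermediateField.finiteDimensional_adjoin
    fun x _ => Algebra.IsIntegral.isIntegral x
  let F' : IntermediateField ℚ_[q] L := F.restrictScalars ℚ_[q]
  have hF' : FiniteDimensional ℚ_[q] F' := Module.Finite.trans (R := ℚ_[q]) K F
  refine ⟨F.toSubfield, ?_, IntermediateField.subset_adjoin K _ (by simp),
    IntermediateField.subset_adjoin K _ (by simp), fun a => F.algebraMap_mem a⟩
  -- A finite-dimensional subspace over the complete field `ℚ_q` is complete.
  have : FiniteDimensional ℚ_[q] F'.toSubalgebra.toSubmodule := hF'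
  exact F'.toSubalgebra.toSubmodule.complete_of_finiteDimensional

end

end LocalInt

namespace WeierstrassCurve

open LocalInt in
/-- The Galois module structure of a curve over a finite extension of `ℚ₂` with good reduction
`curveA`. -/
theorem galois_action_of_hasReduction {K L : Type*} [Field K] [Algebra ℚ_[2] K]
    [FiniteDimensional ℚ_[2] K] [Algebra ℤ_[2] K] [IsScalarTower ℤ_[2] ℚ_[2] K]
    [Field L] [Algebra K L] [Algebra ℚ_[2] L] [Algebra ℤ_[2] L] [IsScalarTower ℚ_[2] K L]
    [IsScalarTower ℤ_[2] K L] [IsAlgClosed L] [IsGalois K L]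
    (E : WeierstrassCurve K) [E.IsElliptic] (hE : HasReduction 2 E (curveA (κ 2 K)))
    {r : ℕ} (hr : Nat.card (κ 2 K) = 4 ^ r)
    (p : ℕ) [hp : Fact p.Prime] (hp2 : Odd p) {a : ℕ} {u : ℤ}
    (hs : (-2 : ℤ) ^ r = 1 + p ^ a * u) (hu : ¬ (p : ℤ) ∣ u) :
    (∀ P : E.Pts L, ∃ Q : E.Pts L, p • Q = P) ∧
    (∀ (N : ℕ) (σ : Gal(L/K)), ∃ i : ℕ, ∀ P : E.Pts L,
      p ^ N • P = 0 → σ • P = (((-2 : ℤ) ^ r) ^ i) • P) ∧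
    (∃ P : E.Pts L, p ^ (a + 1) • P = 0 ∧ ∃ σ : Gal(L/K), σ • P ≠ P) ∧
    ∀ (m : ℕ) (P : E.toAffine.Point), ∃ T R : E.toAffine.Point,
      P = T + p ^ m • R ∧ p ^ a • T = 0 := by
  obtain ⟨C, hC, D, hD⟩ := hE
  -- The residual change of variables is lifted to `𝒪`, so that the model reduces to `A` itself and
  -- not merely to an isomorphic curve.
  obtain ⟨D', W, hW, hWr⟩ := exists_model_map_residue_eq
    (baseChange_integralModel_eq (𝒪 2 K) (C • E)) hD
  rw [← mul_smul] at hW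
  have : Algebra.IsAlgebraic ℚ_[2] L := Algebra.IsAlgebraic.trans ℚ_[2] K L
  have : IsScalarTower ℤ_[2] ℚ_[2] L := .of_algebraMap_eq fun a => by
    rw [IsScalarTower.algebraMap_apply ℤ_[2] K L, IsScalarTower.algebraMap_apply ℤ_[2] ℚ_[2] K,
      ← IsScalarTower.algebraMap_apply ℚ_[2] K L]
  have : Finite (κ 2 K) := (finite_and_natCard_residueField 2 K).1
  have hcomp := exists_isComplete_subfield 2 (K := K) (L := L)
  let := spectralNorm.normedField ℚ_[2] L
  have : IsUltrametricDist L :=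
    IsUltrametricDist.isUltrametricDist_of_isNonarchimedean_norm isNonarchimedean_spectralNorm
  have hnorm : ∀ x : L, ‖x‖ = spectralNorm ℚ_[2] L x := fun _ => rfl
  have hint : ∀ x : L, _root_.IsIntegral ℤ_[2] x ↔ ‖x‖ ≤ 1 := isIntegral_iff_of_isAlgebraic 2
  let f : 𝒪 2 K →+* unitBall L :=
    ((algebraMap K L).comp (algebraMap (𝒪 2 K) K)).codRestrict (unitBall L) fun o => by
      rw [mem_unitBall, ← hint]
      exact o.2.map (IsScalarTower.toAlgHom ℤ_[2] K L)
  have hf : ∀ o, (f o : L) = algebraMap K L (algebraMap (𝒪 2 K) K o) := fun _ => rfl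
  have hfinj : Function.Injective f := fun x y hxy => Subtype.ext
    ((algebraMap K L).injective (congrArg Subtype.val hxy))
  have hfint : f.IsIntegral := by
    intro x
    obtain ⟨P, hP, hPx⟩ := (hint x).2 (mem_unitBall.1 x.2)
    refine ⟨P.map (algebraMap ℤ_[2] (𝒪 2 K)), hP.map _, Subtype.ext ?_⟩
    rw [Polynomial.eval₂_map]
    change (unitBall L).subtype _ = 0
    rw [Polynomial.hom_eval₂, ← hPx]
    congr 1
    refine RingHom.ext fun a => ?_
    exact (IsScalarTower.algebraMap_apply ℤ_[2] K L a).symm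
  have : IsLocalHom f := hfint.isLocalHom hfinj
  refine galois_action_of_model E f hf ?_ hcomp ?_ ?_ hfint hW hWr hr p hp2 hs hu
  · have h := spectralNorm_extends (L := L) (2 : ℚ_[2])
    rw [map_ofNat] at h
    rw [hnorm, h]
    have := Padic.norm_p_lt_one (p := 2)
    exact_mod_cast this
  · intro σ x
    exact (spectralNorm_eq_of_equiv (σ.restrictScalars ℚ_[2]) x).symm
  · intro b hb
    rw [← hint, isIntegral_algebraMap_iff (algebraMap K L).injective] at hb
    exact ⟨⟨b, hb⟩, rfl⟩

end WeierstrassCurve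

/-! ### Assembly -/

theorem natCard_eq_four_pow_of_even {n f : ℕ} (h : n = 2 ^ f) (hf : Even f) :
    ∃ r, n = 4 ^ r := by
  obtain ⟨r, rfl⟩ := hf
  exact ⟨r, by rw [h, ← two_mul, pow_mul]; norm_num⟩

theorem charP_two_of_natCard_eq_two_pow {F : Type*} [Field F] [Finite F] {f : ℕ}
    (h : Nat.card F = 2 ^ f) : CharP F 2 := by
  have := Fintype.ofFinite F
  have h1 : ((Nat.card F : ℕ) : F) = 0 := by
    rw [Nat.card_eq_fintype_card, FiniteField.cast_card_eq_zero]
  rw [h, Nat.cast_pow] at h1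
  exact CharTwo.of_one_ne_zero_of_two_eq_zero one_ne_zero
    (by exact_mod_cast eq_zero_of_pow_eq_zero h1)

theorem mainTheorem11 (p : ℕ) (hp : p.Prime) (hp2 : Odd p) :
    -- finite fields of even degree over `𝔽₂`
    (∀ (F : Type*) [Field F] [Finite F] [Algebra (ZMod 2) F],
      Even (Module.finrank (ZMod 2) F) →
      (∃ k : ℕ, Nonempty (AddCommGroup.primaryComponent (WeierstrassCurve.curveA F).toAffine.Point p
        ≃+ ZMod (p ^ k) × ZMod (p ^ k))) ∧
      ∀ k : ℕ, 1 ≤ k →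
        Nonempty (AddCommGroup.primaryComponent (WeierstrassCurve.curveA F).toAffine.Point p
          ≃+ ZMod (p ^ k) × ZMod (p ^ k)) →
        (∀ (L : Type*) [Field L] [Algebra F L], Module.finrank F L = p →
          Nonempty (AddCommGroup.primaryComponent (WeierstrassCurve.curveA L).toAffine.Point p
            ≃+ ZMod (p ^ (k + 1)) × ZMod (p ^ (k + 1)))) ∧
        ∀ m : ℕ,
          Module.finrank F ((WeierstrassCurve.curveA F).torsionField (p ^ (k + m))) = p ^ m ∧
          Nonempty (Gal((WeierstrassCurve.curveA F).torsionField (p ^ (k + m))/F)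
            ≃* Multiplicative (ZMod (p ^ m))) ∧
          (WeierstrassCurve.curveA F).KummerStable (pow_dvd_pow p (Nat.le_add_left m k))) ∧
    -- local fields
    (∀ (K : Type*) [Field K] [Algebra ℚ_[2] K] [FiniteDimensional ℚ_[2] K]
        [Algebra ℤ_[2] K] [IsScalarTower ℤ_[2] ℚ_[2] K],
      Even (LocalInt.residueDegree 2 K) →
      ∀ (E : WeierstrassCurve K) [E.IsElliptic],
      LocalInt.HasReduction 2 E (WeierstrassCurve.curveA (LocalInt.κ 2 K)) →
      ∀ k : ℕ, 1 ≤ k →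
        Nonempty (AddCommGroup.primaryComponent
          (WeierstrassCurve.curveA (LocalInt.κ 2 K)).toAffine.Point p
            ≃+ ZMod (p ^ k) × ZMod (p ^ k)) →
        ∀ m : ℕ,
          Nonempty (Gal(E.torsionField (p ^ (k + m))/K) ≃* Multiplicative (ZMod (p ^ m))) ∧
          E.KummerStable (pow_dvd_pow p (Nat.le_add_left m k))) := by
  have : Fact p.Prime := ⟨hp⟩
  refine ⟨fun F _ _ _ hF => ?_, fun K _ _ _ _ _ hK E _ hE k hk e m => ?_⟩
  · have hcard : Nat.card F = 2 ^ Module.finrank (ZMod 2) F := by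
      rw [Module.natCard_eq_pow_finrank (K := ZMod 2), Nat.card_zmod]
    -- Even degree makes the order of `F` a power of `4`, so that Frobenius is an integer.
    obtain ⟨r, hr⟩ := natCard_eq_four_pow_of_even hcard hF
    have : CharP F 2 := charP_two_of_natCard_eq_two_pow hcard
    refine ⟨?_, fun k hk e => ⟨fun L _ _ hL => ?_, fun m => ?_⟩⟩
    · obtain ⟨v, u, hs, hu⟩ := WeierstrassCurve.exists_neg_two_pow_eq_one_add p
        (WeierstrassCurve.ne_zero_of_card_eq_four_pow hr)
      exact ⟨v, WeierstrassCurve.nonempty_primaryComponent_equiv p hp2 hr hs hu⟩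
    · exact WeierstrassCurve.nonempty_primaryComponent_equiv_of_finrank p hp2 hr hk e hL
    · exact WeierstrassCurve.curveA_torsionField_and_kummerStable p hp2 hr hk e m
  · obtain ⟨hfin, hcard⟩ := LocalInt.finite_and_natCard_residueField 2 K
    obtain ⟨r, hr⟩ := natCard_eq_four_pow_of_even hcard hK
    have : CharP (LocalInt.κ 2 K) 2 := charP_two_of_natCard_eq_two_pow hcard
    obtain ⟨u, hs, hu⟩ := WeierstrassCurve.neg_two_pow_eq_of_primaryComponent_equiv p hp2 hr e
    have : CharZero K := charZero_of_injective_algebraMap (algebraMap ℚ_[2] K).injective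
    have : IsGalois K (AlgebraicClosure K) := {}
    obtain ⟨hdiv, hscal, htor, hmod⟩ :=
      WeierstrassCurve.galois_action_of_hasReduction (L := AlgebraicClosure K) E hE hr p hp2 hs hu
    exact ⟨WeierstrassCurve.nonempty_gal_torsionField_mulEquiv E p hp2 hk hs hu hdiv hscal htor m,
      WeierstrassCurve.kummerStable_of_scalar_action E p hp2 hk hs hu hdiv hscal htor hmod m⟩
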